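/- **Conventions.** All categories have Hom-sets, "coproducts/products" are indexed by sets, $[1]$ is the shift of a triangulated category, and subcategories are full and closed under isomorphisms. A t-structure on a triangulated category $\mathcal T$ is written $\mathbb T=(\mathbb T^{\le 0},\mathbb T^{\ge 0})$, with $\mathbb T^{\le n}=\mathbb T^{\le 0}[-n]$, $\mathbb T^{\ge n}=\mathbb T^{\ge 0}[-n]$, abelian heart $\mathcal H(\mathbb T)=\mathbb T^{\le 0}\cap\mathbb T^{\ge 0}$ and cohomology functors $\mathsf H^i_{\mathbb T}\colon\mathcal T\to\mathcal H(\mathbb T)$. $\mathsf C^b(\mathcal A)$ is the category of bounded cochain complexes in an abelian category $\mathcal A$, and $Q\colon\mathsf C^b(\mathcal A)\to\mathsf D^b(\mathcal A)$ is its localisation at the quasi-isomorphisms. **f-categories.** An *f-category* is a triangulated category $\mathcal X$ with a triangle autoequivalence $s$, a natural transformation $\alpha\colon \mathrm{id}_{\mathcal X}\to s$ and triangulated subcategories $\mathcal X(\ge 0)$, $\mathcal X(\le 0)$ such that, for $\mathcal X(\ge n)=s^n\mathcal X(\ge 0)$ and $\mathcal X(\le n)=s^n\mathcal X(\le 0)$: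 (i) $\mathrm{Hom}(\mathcal X(\ge 1),\mathcal X(\le 0))=0$; (ii) every $A\in\mathcal X$ lies in a triangle $Y\to A\to Z\to Y[1]$ with $Y\in\mathcal X(\ge1)$, $Z\in\mathcal X(\le 0)$; (iii) $\mathcal X=\bigcup_n\mathcal X(\ge n)=\bigcup_n\mathcal X(\le n)$; (iv) $\mathcal X(\ge 1)\subseteq\mathcal X(\ge 0)$ and $\mathcal X(\le -1)\subseteq\mathcal X(\le 0)$; (v) $\alpha_A=s(\alpha_{s^{-1}A})$ for all $A$; (vi) for $A\in\mathcal X(\ge 1)$, $B\in\mathcal X(\le 0)$, the maps $\mathrm{Hom}(\alpha_B,A)\colon\mathrm{Hom}(sB,A)\to\mathrm{Hom}(B,A)$ and $\mathrm{Hom}(B,\alpha_A)\colon\mathrm{Hom}(B,A)\to\mathrm{Hom}(B,sA)$ are bijective. The pairs $(\mathcal X(\ge n+1),\mathcal X(\le n))$ then yield truncation functors $\sigma_{\ge n}$, $\sigma_{\le n}$. An *f-category over* $\mathcal T$ is a pair $(\mathcal X,\theta)$ with $\mathcal X$ an f-category and $\theta\colon\mathcal T\to\mathcal X(\ge 0)\cap\mathcal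 X(\le 0)$ a triangle equivalence; put $\mathsf{gr}^n=\theta^{-1}s^{-n}\sigma_{\le n}\sigma_{\ge n}\colon\mathcal X\to\mathcal T$. An *f-forgetful functor* is a triangle functor $\omega\colon\mathcal X\to\mathcal T$ such that $\omega|_{\mathcal X(\ge0)}$ is right adjoint to $\theta\colon\mathcal T\to\mathcal X(\ge 0)$, $\omega|_{\mathcal X(\le 0)}$ is left adjoint to $\theta\colon\mathcal T\to\mathcal X(\le 0)$, $\omega(\alpha_A)$ is an isomorphism for all $A$, and $\omega$ induces bijections $\mathrm{Hom}_{\mathcal X}(A,B)\to\mathrm{Hom}_{\mathcal T}(\omega A,\omega B)$ for $A\in\mathcal X(\le 0)$, $B\in\mathcal X(\ge 0)$. **Realisation functors.** Let $\mathbb T$ be a t-structure on $\mathcal T$ and $(\mathcal X,\theta)$ an f-category over $\mathcal T$. The induced t-structure $\mathbb X$ on $\mathcal X$ is given by $\mathbb X^{\le0}=\{A\mid \mathsf{gr}^nA\in\mathbb T^{\le n}\ \forall n\}$ and $\mathbb X^{\ge0}=\{A\mid \mathsf{gr}^nA\in\mathbb T^{\ge n}\ \forall n\}$. Given $\omega$,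 one has $\omega\sigma_{\le n}\sigma_{\ge n}\cong\mathsf{gr}^n$, and one assigns to $A\in\mathcal X$ the complex $\mathsf H^0_{\mathbb X}(A)$ in $\mathcal H(\mathbb T)$ with $i$-th term $\mathsf H^i_{\mathbb T}(\mathsf{gr}^iA)$ and differential $\mathsf H^i_{\mathbb T}(\bar d^i)$, where $\bar d^i$ is the third morphism of the triangle $$\omega\sigma_{\le i+1}\sigma_{\ge i+1}A\to\omega\sigma_{\le i+1}\sigma_{\ge i}A\to\omega\sigma_{\le i}\sigma_{\ge i}A\xrightarrow{\ \bar d^i\ }(\omega\sigma_{\le i+1}\sigma_{\ge i+1}A)[1].$$ A *realisation functor* of $\mathbb T$ with respect to $(\mathcal X,\theta)$ is a functor $\mathsf{real}\colon\mathsf D^b(\mathcal H(\mathbb T))\to\mathcal T$ such that $\mathsf{real}\circ Q\cong\omega|_{\mathcal H(\mathbb X)}\circ G$ for some f-forgetful functor $\omega$ and some equivalence $G\colon\mathsf C^b(\mathcal H(\mathbb T))\to\mathcal H(\mathbb X)$ inverse to $\mathsf H^0_{\mathbb X}|_{\mathcal H(\mathbb X)}$. **(Co)silting and (co)tilting objects.**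 For $M\in\mathcal T$ and a condition $I$ on integers let $M^{\perp_I}=\{Y\mid\mathrm{Hom}(M,Y[i])=0\ \forall i\in I\}$ and ${}^{\perp_I}M=\{Y\mid\mathrm{Hom}(Y,M[i])=0\ \forall i\in I\}$. Let $\mathrm{Add}(M)$ (resp. $\mathrm{Prod}(M)$) be the class of direct summands of coproducts (resp. products) of copies of $M$ existing in $\mathcal T$. The object $M$ is *silting* if $(M^{\perp_{>0}},M^{\perp_{<0}})$ is a t-structure and $M\in M^{\perp_{>0}}$; *cosilting* if $({}^{\perp_{<0}}M,{}^{\perp_{>0}}M)$ is a t-structure and $M\in{}^{\perp_{>0}}M$; *tilting* if it is silting and $\mathrm{Add}(M)\subseteq M^{\perp_{\ne0}}$; *cotilting* if it is cosilting and $\mathrm{Prod}(M)\subseteq{}^{\perp_{\ne0}}M$. In the silting and cosilting case, $\mathcal H_M$ denotes the heart of the t-structure, and a realisation functor of this t-structure is denoted $\mathsf{real}^{\mathcal X}_M\colon\mathsf D^b(\mathcal H_M)\to\mathcal T$. **Proposition.** Let $(\mathcal X,\theta)$ be an f-category over a triangulated category $\mathcal T$ that has all set-indexed coproducts (TR5)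 (respectively, all set-indexed products (TR5*)), and let $M$ be a silting (respectively, cosilting) object of $\mathcal T$. Then a realisation functor $\mathsf{real}^{\mathcal X}_M\colon\mathsf D^b(\mathcal H_M)\to\mathcal T$ exists, and every such functor is fully faithful if and only if $M$ is a tilting (respectively, cotilting) object. -/

import Mathlib

open CategoryTheory CategoryTheory.Limits CategoryTheory.Pretriangulated
open CategoryTheory.Triangulated ZeroObject

universe v u v' u'

noncomputable section

lemma distTriang_of_iso {C : Type u} [Category.{v} C] [Preadditive C] [HasZeroObject C]
    [HasShift C ℤ] [∀ n : ℤ, (shiftFunctor C n).Additive] [Pretriangulated C]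
    {A₁ A₂ A₃ B₁ B₂ B₃ : C} {f : A₁ ⟶ A₂} {g : A₂ ⟶ A₃} {h : A₃ ⟶ A₁⟦(1 : ℤ)⟧}
    {f' : B₁ ⟶ B₂} {g' : B₂ ⟶ B₃} {h' : B₃ ⟶ B₁⟦(1 : ℤ)⟧}
    (hT : Triangle.mk f' g' h' ∈ distTriang C) (e₁ : A₁ ≅ B₁) (e₂ : A₂ ≅ B₂) (e₃ : A₃ ≅ B₃)
    (h₁ : f ≫ e₂.hom = e₁.hom ≫ f') (h₂ : g ≫ e₃.hom = e₂.hom ≫ g')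
    (h₃ : h ≫ e₁.hom⟦(1 : ℤ)⟧' = e₃.hom ≫ h') : Triangle.mk f g h ∈ distTriang C :=
  isomorphic_distinguished _ hT _ (Triangle.isoMk _ _ e₁ e₂ e₃ h₁ h₂ h₃)

/-! ### The heart of a t-structure is abelian -/

section Heart

variable {T : Type u} [Category.{v} T] [Preadditive T] [HasZeroObject T] [HasShift T ℤ]
  [∀ n : ℤ, (shiftFunctor T n).Additive] [Pretriangulated T] (t : TStructure T)

/-- The heart of `t`, as a category: the full subcategory on `t.le 0 ⊓ t.ge 0`. -/
abbrev HeartCat : Type u := t.heart.FullSubcategory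

lemma heart_hasFiniteProducts : HasFiniteProducts (HeartCat t) := by
  have h0 : t.heart.ContainsZero :=
    ⟨(0 : T), isZero_zero T, by rw [t.mem_heart_iff]; exact ⟨inferInstance, inferInstance⟩⟩
  have h2 : t.heart.IsClosedUnderBinaryProducts := by
    refine ⟨?_⟩
    rintro Z ⟨p⟩
    have hX := p.prop_diag_obj ⟨WalkingPair.left⟩
    have hY := p.prop_diag_obj ⟨WalkingPair.right⟩
    rw [t.mem_heart_iff] at hX hY
    obtain ⟨hX1, hX2⟩ := hX
    obtain ⟨hY1, hY2⟩ := hY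
    have e : Z ≅ (p.diag.obj ⟨WalkingPair.left⟩) ⊞ (p.diag.obj ⟨WalkingPair.right⟩) :=
      (p.isLimit.conePointUniqueUpToIso (limit.isLimit p.diag)) ≪≫
        (HasLimit.isoOfNatIso (diagramIsoPair p.diag)) ≪≫ (biprod.isoProd _ _).symm
    refine t.heart.prop_of_iso e.symm ?_
    rw [t.mem_heart_iff]
    exact ⟨t.isLE₂ _ (binaryBiproductTriangle_distinguished _ _) 0 hX1 hY1,
      t.isGE₂ _ (binaryBiproductTriangle_distinguished _ _) 0 hX2 hY2⟩
  have := ObjectProperty.IsClosedUnderFiniteProducts.mk' (P := t.heart)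
  infer_instance

lemma heart_hom_shift_eq_zero ⦃X Y : HeartCat t⦄ ⦃n : ℤ⦄
    (f : t.heart.ι.obj X ⟶ (t.heart.ι.obj Y)⟦n⟧) (hn : n < 0) : f = 0 := by
  have hX := (t.mem_heart_iff _).1 X.property
  have hY := (t.mem_heart_iff _).1 Y.property
  obtain ⟨hX1, -⟩ := hX
  obtain ⟨-, hY2⟩ := hY
  have := t.isGE_shift Y.obj 0 n (-n) (by lia)
  exact t.zero_of_isLE_of_isGE f 0 (-n) (by lia) hX1 this

lemma heart_admissible [IsTriangulated T] :
    AbelianSubcategory.admissibleMorphism t.heart.ι = ⊤ := by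
  ext X Y f
  simp only [MorphismProperty.top_apply, iff_true]
  intro Z f₂ f₃ hT
  obtain ⟨hX1, hX2⟩ := (t.mem_heart_iff _).1 X.property
  obtain ⟨hY1, hY2⟩ := (t.mem_heart_iff _).1 Y.property
  have hXs1 : t.IsLE (X.obj⟦(1 : ℤ)⟧) 0 := by
    have := t.isLE_shift X.obj 0 1 (-1) (by lia)
    exact t.isLE_of_le _ (-1) 0
  have hXs2 : t.IsGE (X.obj⟦(1 : ℤ)⟧) (-1) := t.isGE_shift X.obj 0 1 (-1) (by lia)
  have hY2' : t.IsGE Y.obj (-1) := t.isGE_of_ge _ (-1) 0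
  have hrot := rot_of_distTriang _ hT
  have hZ1 : t.IsLE Z 0 := t.isLE₂ _ hrot 0 hY1 hXs1
  have hZ2 : t.IsGE Z (-1) := t.isGE₂ _ hrot (-1) hY2' hXs2
  -- the truncation triangle of `Z`
  have hK1 : t.IsLE ((t.truncLT 0).obj Z) (-1) := t.isLE_truncLT_obj Z 0 (-1) (by lia)
  have hK2 : t.IsGE ((t.truncLT 0).obj Z) (-1) := inferInstance
  have hQ1 : t.IsLE ((t.truncGE 0).obj Z) 0 := inferInstance
  have hQ2 : t.IsGE ((t.truncGE 0).obj Z) 0 := inferInstance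
  let K : HeartCat t := ⟨((t.truncLT 0).obj Z)⟦(-1 : ℤ)⟧, (t.mem_heart_iff _).2
    ⟨t.isLE_shift _ (-1) (-1) 0 (by lia), t.isGE_shift _ (-1) (-1) 0 (by lia)⟩⟩
  let Q : HeartCat t := ⟨(t.truncGE 0).obj Z, (t.mem_heart_iff _).2 ⟨hQ1, hQ2⟩⟩
  let e : K.obj⟦(1 : ℤ)⟧ ≅ (t.truncLT 0).obj Z :=
    (shiftEquiv T (1 : ℤ)).counitIso.app ((t.truncLT 0).obj Z)
  refine ⟨K, Q, e.hom ≫ (t.truncLTι 0).app Z, (t.truncGEπ 0).app Z,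
    (t.truncGEδLT 0).app Z ≫ (shiftFunctor T (1 : ℤ)).map e.inv, ?_⟩
  refine distTriang_of_iso (t.triangleLTGE_distinguished 0 Z) e (Iso.refl Z)
    (Iso.refl ((t.truncGE 0).obj Z)) ?_ ?_ ?_
  · exact Category.comp_id _
  · exact (Category.comp_id _).trans (Category.id_comp _).symm
  · refine Eq.trans ?_ (Category.id_comp _).symm
    rw [Category.assoc, ← Functor.map_comp, e.inv_hom_id, CategoryTheory.Functor.map_id]
    exact Category.comp_id _

/-- The heart of a t-structure on a triangulated category is an abelian category. -/
@[reducible]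
def heartAbelian [IsTriangulated T] : Abelian (HeartCat t) :=
  have := heart_hasFiniteProducts t
  AbelianSubcategory.abelian t.heart.ι (heart_hom_shift_eq_zero t) (heart_admissible t)

instance heart_categoryWithHomology [IsTriangulated T] : CategoryWithHomology (HeartCat t) :=
  letI := heartAbelian t
  inferInstanceAs (CategoryWithHomology (HeartCat t))

end Heart

/-! ### Bounded complexes and the bounded derived category -/

section BoundedDerived

variable (A : Type u) [Category.{v} A] [Preadditive A]

/-- The property of being a bounded cochain complex. -/
def isBoundedComplex : ObjectProperty (CochainComplex A ℤ) :=
  fun K => ∃ a b : ℤ, K.IsStrictlyGE a ∧ K.IsStrictlyLE b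

/-- The category of bounded cochain complexes in `A`. -/
abbrev BoundedComplex := (isBoundedComplex A).FullSubcategory

/-- The class of quasi-isomorphisms between bounded complexes. -/
def boundedQuasiIso [CategoryWithHomology A] : MorphismProperty (BoundedComplex A) :=
  (HomologicalComplex.quasiIso A (ComplexShape.up ℤ)).inverseImage (isBoundedComplex A).ι

/-- The bounded derived category of `A`: the localisation of the category of bounded complexes
at the quasi-isomorphisms. -/
abbrev BoundedDerived [CategoryWithHomology A] := (boundedQuasiIso A).Localization

/-- The localisation functor from bounded complexes to the bounded derived category. -/
abbrev boundedQ [CategoryWithHomology A] : BoundedComplex A ⥤ BoundedDerived A :=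
  (boundedQuasiIso A).Q

end BoundedDerived

/-! ### Cohomology with respect to a t-structure -/

section Cohomology

variable {T : Type u} [Category.{v} T] [Preadditive T] [HasZeroObject T] [HasShift T ℤ]
  [∀ n : ℤ, (shiftFunctor T n).Additive] [Pretriangulated T] [IsTriangulated T]
  (t : TStructure T)

/-- The zeroth cohomology `τ^{≥ 0} τ^{≤ 0}`, with values in the heart. -/
def tH0 : T ⥤ HeartCat t :=
  t.heart.lift (t.truncLE 0 ⋙ t.truncGE 0) (fun X => (t.mem_heart_iff _).2
    ⟨(inferInstance : t.IsLE ((t.truncGE 0).obj ((t.truncLE 0).obj X)) 0),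
      (inferInstance : t.IsGE ((t.truncGE 0).obj ((t.truncLE 0).obj X)) 0)⟩)

instance : (tH0 t).Additive where
  map_add {X Y f g} := by
    apply t.heart.ι.map_injective
    exact (t.truncLE 0 ⋙ t.truncGE 0).map_add

/-- The `n`-th cohomology functor `X ↦ H⁰(X⟦n⟧)`, with values in the heart. -/
def tH (n : ℤ) : T ⥤ HeartCat t := shiftFunctor T n ⋙ tH0 t

instance (n : ℤ) : (tH t n).Additive := by
  dsimp only [tH]
  infer_instance

/-- The canonical isomorphism `Hⁿ(X⟦1⟧) ≅ Hⁿ⁺¹(X)`. -/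
def tHShift (n : ℤ) : shiftFunctor T (1 : ℤ) ⋙ tH t n ≅ tH t (n + 1) :=
  Functor.isoWhiskerRight (shiftFunctorAdd' T (1 : ℤ) n (n + 1) (add_comm 1 n)).symm (tH0 t)

end Cohomology

lemma pow_index {C : Type u} [Category.{v} C] {P : ℤ → ObjectProperty C} (e : C ≌ C) (d : ℤ)
    (h : ∀ (n : ℤ) (A : C), P n A → P (n + d) (e.functor.obj A)) (k : ℕ) :
    ∀ (n : ℤ) (A : C), P n A → P (n + k * d) ((e.powNat k).functor.obj A) := by
  induction k with
  | zero =>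
    intro n A hA
    have h : P (n + ((0 : ℕ) : ℤ) * d) A := by simpa using hA
    exact h
  | succ k ih =>
    intro n A hA
    cases k with
    | zero =>
      have h' : P (n + ((0 + 1 : ℕ) : ℤ) * d) (e.functor.obj A) := by simpa using h n A hA
      exact h'
    | succ k =>
      have := ih (n + d) _ (h n A hA)
      rw [show n + ((k + 1 + 1 : ℕ) : ℤ) * d = n + d + ((k + 1 : ℕ) : ℤ) * d by push_cast; ring]
      exact this

/-! ### f-categories -/

section FCategories

variable (X : Type u) [Category.{v} X] [Preadditive X] [HasZeroObject X] [HasShift X ℤ]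
  [∀ n : ℤ, (shiftFunctor X n).Additive] [Pretriangulated X]

/-- The structure of an f-category on a triangulated category `X`.  Here `ge n` and `le n` are the
subcategories `X(≥ n) = sⁿ X(≥ 0)` and `X(≤ n) = sⁿ X(≤ 0)`: this is what `ge_s` and `le_s`
express, as these are strict subcategories and `s` is an autoequivalence. -/
structure FCategory where
  /-- The f-shift, a triangle autoequivalence. -/
  s : X ≌ X
  [commShift_s : s.functor.CommShift ℤ]
  [isTriangulated_s : s.functor.IsTriangulated]
  /-- The natural transformation from the identity to the f-shift. -/
  α : 𝟭 X ⟶ s.functor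
  /-- The subcategories `X(≥ n)`. -/
  ge : ℤ → ObjectProperty X
  /-- The subcategories `X(≤ n)`. -/
  le : ℤ → ObjectProperty X
  ge_iso (n : ℤ) : (ge n).IsClosedUnderIsomorphisms
  le_iso (n : ℤ) : (le n).IsClosedUnderIsomorphisms
  ge_s (n : ℤ) (A : X) : ge (n + 1) (s.functor.obj A) ↔ ge n A
  le_s (n : ℤ) (A : X) : le (n + 1) (s.functor.obj A) ↔ le n A
  ge_zero_triangulated : (ge 0).IsTriangulated
  le_zero_triangulated : (le 0).IsTriangulated
  hom_eq_zero ⦃A B : X⦄ (f : A ⟶ B) (hA : ge 1 A) (hB : le 0 B) : f = 0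
  exists_triangle (A : X) : ∃ (Y Z : X) (_ : ge 1 Y) (_ : le 0 Z)
    (f : Y ⟶ A) (g : A ⟶ Z) (h : Z ⟶ Y⟦(1 : ℤ)⟧), Triangle.mk f g h ∈ distTriang X
  exists_ge (A : X) : ∃ n : ℤ, ge n A
  exists_le (A : X) : ∃ n : ℤ, le n A
  ge_one_le : ge 1 ≤ ge 0
  le_neg_one_le : le (-1) ≤ le 0
  α_s (A : X) : α.app (s.functor.obj A) = s.functor.map (α.app A)
  bijective_α_comp ⦃A B : X⦄ (hA : ge 1 A) (hB : le 0 B) :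
    Function.Bijective (fun f : s.functor.obj B ⟶ A => α.app B ≫ f)
  bijective_comp_α ⦃A B : X⦄ (hA : ge 1 A) (hB : le 0 B) :
    Function.Bijective (fun f : B ⟶ A => f ≫ α.app A)

attribute [instance] FCategory.commShift_s FCategory.isTriangulated_s FCategory.ge_iso
  FCategory.le_iso FCategory.ge_zero_triangulated FCategory.le_zero_triangulated

namespace FCategory

variable {X} (F : FCategory X)

/-- A property of integers that is invariant under `n ↦ n + 1` in both directions. -/
lemma int_induct {p : ℤ → Prop} (h0 : p 0) (h : ∀ n, p n ↔ p (n + 1)) (n : ℤ) : p n := by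
  induction n using Int.induction_on with
  | zero => exact h0
  | succ n ih => exact (h _).1 ih
  | pred n ih => exact (h _).2 (by simpa using ih)

lemma ge_shift (n a : ℤ) : ∀ A : X, F.ge n A → F.ge n (A⟦a⟧) := by
  refine int_induct (p := fun n => ∀ A : X, F.ge n A → F.ge n (A⟦a⟧))
    (fun A hA => (F.ge 0).le_shift a A hA) (fun n => ⟨fun h A hA => ?_, fun h A hA => ?_⟩) n
  · let e := F.s.counitIso.app A
    have h1 : F.ge n (F.s.inverse.obj A) := (F.ge_s n _).1 ((F.ge (n + 1)).prop_of_iso e.symm hA)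
    have h2 := (F.ge_s n _).2 (h _ h1)
    exact (F.ge (n + 1)).prop_of_iso ((F.s.functor.commShiftIso a).app _ ≪≫
      (shiftFunctor X a).mapIso e) h2
  · exact (F.ge_s n _).1 ((F.ge (n + 1)).prop_of_iso ((F.s.functor.commShiftIso a).app A).symm
      (h _ ((F.ge_s n A).2 hA)))

lemma le_shift (n a : ℤ) : ∀ A : X, F.le n A → F.le n (A⟦a⟧) := by
  refine int_induct (p := fun n => ∀ A : X, F.le n A → F.le n (A⟦a⟧))
    (fun A hA => (F.le 0).le_shift a A hA) (fun n => ⟨fun h A hA => ?_, fun h A hA => ?_⟩) n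
  · let e := F.s.counitIso.app A
    have h1 : F.le n (F.s.inverse.obj A) := (F.le_s n _).1 ((F.le (n + 1)).prop_of_iso e.symm hA)
    have h2 := (F.le_s n _).2 (h _ h1)
    exact (F.le (n + 1)).prop_of_iso ((F.s.functor.commShiftIso a).app _ ≪≫
      (shiftFunctor X a).mapIso e) h2
  · exact (F.le_s n _).1 ((F.le (n + 1)).prop_of_iso ((F.s.functor.commShiftIso a).app A).symm
      (h _ ((F.le_s n A).2 hA)))

lemma hom_eq_zero' (n : ℤ) : ∀ ⦃A B : X⦄ (f : A ⟶ B), F.ge (n + 1) A → F.le n B → f = 0 := by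
  refine int_induct (p := fun n => ∀ ⦃A B : X⦄ (f : A ⟶ B), F.ge (n + 1) A → F.le n B → f = 0)
    (fun A B f hA hB => F.hom_eq_zero f (by simpa using hA) hB)
    (fun n => ⟨fun h A B f hA hB => ?_, fun h A B f hA hB => ?_⟩) n
  · have hA' := (F.ge_s (n + 1) _).1
      ((F.ge (n + 1 + 1)).prop_of_iso (F.s.counitIso.app A).symm hA)
    have hB' := (F.le_s n _).1 ((F.le (n + 1)).prop_of_iso (F.s.counitIso.app B).symm hB)
    have h0 := h (F.s.inverse.map f) hA' hB'
    exact F.s.inverse.map_injective (by rw [h0, Functor.map_zero])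
  · have h0 := h (F.s.functor.map f) ((F.ge_s (n + 1) A).2 hA) ((F.le_s n B).2 hB)
    exact F.s.functor.map_injective (by rw [h0, Functor.map_zero])

lemma ge_succ_le (n : ℤ) : F.ge (n + 1) ≤ F.ge n := by
  refine int_induct (p := fun n => F.ge (n + 1) ≤ F.ge n) (by simpa using F.ge_one_le)
    (fun n => ⟨fun h A hA => ?_, fun h A hA => ?_⟩) n
  · have hA' := (F.ge_s (n + 1) _).1
      ((F.ge (n + 1 + 1)).prop_of_iso (F.s.counitIso.app A).symm hA)
    exact (F.ge (n + 1)).prop_of_iso (F.s.counitIso.app A) ((F.ge_s n _).2 (h _ hA'))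
  · exact (F.ge_s n A).1 (h _ ((F.ge_s (n + 1) A).2 hA))

lemma le_le_succ (n : ℤ) : F.le n ≤ F.le (n + 1) := by
  have key (m : ℤ) : F.le (m - 1) ≤ F.le m := by
    refine int_induct (p := fun m => F.le (m - 1) ≤ F.le m) (by simpa using F.le_neg_one_le)
      (fun m => ⟨fun h A hA => ?_, fun h A hA => ?_⟩) m
    · have hA' : F.le (m - 1) (F.s.inverse.obj A) := (F.le_s (m - 1) _).1 (by
        rw [show m - 1 + 1 = m + 1 - 1 by ring]
        exact (F.le (m + 1 - 1)).prop_of_iso (F.s.counitIso.app A).symm hA)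
      exact (F.le (m + 1)).prop_of_iso (F.s.counitIso.app A) ((F.le_s m _).2 (h _ hA'))
    · refine (F.le_s m A).1 (h _ ?_)
      rw [show m + 1 - 1 = m - 1 + 1 by ring]
      exact (F.le_s (m - 1) A).2 hA
  simpa using key (n + 1)

lemma exists_triangle' (n : ℤ) : ∀ A : X, ∃ (Y Z : X) (_ : F.ge (n + 1) Y) (_ : F.le n Z)
    (f : Y ⟶ A) (g : A ⟶ Z) (h : Z ⟶ Y⟦(1 : ℤ)⟧), Triangle.mk f g h ∈ distTriang X := by
  refine int_induct (p := fun n => ∀ A : X, ∃ (Y Z : X) (_ : F.ge (n + 1) Y) (_ : F.le n Z)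
    (f : Y ⟶ A) (g : A ⟶ Z) (h : Z ⟶ Y⟦(1 : ℤ)⟧), Triangle.mk f g h ∈ distTriang X)
    (by simpa using F.exists_triangle)
    (fun n => ⟨fun H A => ?_, fun H A => ?_⟩) n
  · obtain ⟨Y, Z, hY, hZ, f, g, h, hT⟩ := H (F.s.inverse.obj A)
    let e : F.s.functor.obj (F.s.inverse.obj A) ≅ A := F.s.counitIso.app A
    refine ⟨F.s.functor.obj Y, F.s.functor.obj Z, (F.ge_s _ _).2 hY, (F.le_s _ _).2 hZ,
      F.s.functor.map f ≫ e.hom, e.inv ≫ F.s.functor.map g,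
      F.s.functor.map h ≫ (F.s.functor.commShiftIso (1 : ℤ)).hom.app Y, ?_⟩
    refine distTriang_of_iso (F.s.functor.map_distinguished _ hT) (Iso.refl (F.s.functor.obj Y))
      e.symm (Iso.refl (F.s.functor.obj Z)) ?_ ?_ ?_
    · refine Eq.trans ?_ (Category.id_comp _).symm
      exact (Category.assoc _ _ _).trans ((congrArg _ e.hom_inv_id).trans (Category.comp_id _))
    · exact Category.comp_id _
    · refine Eq.trans ?_ (Category.id_comp _).symm
      exact (congrArg _ (CategoryTheory.Functor.map_id _ _)).trans (Category.comp_id _)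
  · obtain ⟨Y, Z, hY, hZ, f, g, h, hT⟩ := H (F.s.functor.obj A)
    let eY : F.s.functor.obj (F.s.inverse.obj Y) ≅ Y := F.s.counitIso.app Y
    let eZ : F.s.functor.obj (F.s.inverse.obj Z) ≅ Z := F.s.counitIso.app Z
    let f' : F.s.inverse.obj Y ⟶ A := F.s.functor.preimage (eY.hom ≫ f)
    let g' : A ⟶ F.s.inverse.obj Z := F.s.functor.preimage (g ≫ eZ.inv)
    let h' : F.s.inverse.obj Z ⟶ (F.s.inverse.obj Y)⟦(1 : ℤ)⟧ :=
      F.s.functor.preimage (eZ.hom ≫ h ≫ (shiftFunctor X (1 : ℤ)).map eY.inv ≫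
        (F.s.functor.commShiftIso (1 : ℤ)).inv.app _)
    refine ⟨F.s.inverse.obj Y, F.s.inverse.obj Z,
      (F.ge_s _ _).1 ((F.ge _).prop_of_iso eY.symm hY),
      (F.le_s _ _).1 ((F.le _).prop_of_iso eZ.symm hZ), f', g', h', ?_⟩
    rw [← F.s.functor.map_distinguished_iff]
    refine distTriang_of_iso hT eY (Iso.refl (F.s.functor.obj A)) eZ ?_ ?_ ?_
    · exact (Category.comp_id _).trans (F.s.functor.map_preimage _)
    · refine Eq.trans ?_ (Category.id_comp _).symm
      refine (congrArg (· ≫ eZ.hom) (F.s.functor.map_preimage (g ≫ eZ.inv))).trans ?_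
      exact (Category.assoc _ _ _).trans ((congrArg _ eZ.inv_hom_id).trans (Category.comp_id _))
    · refine (congrArg (fun k => (k ≫ (F.s.functor.commShiftIso (1 : ℤ)).hom.app _) ≫
        (shiftFunctor X (1 : ℤ)).map eY.hom) (F.s.functor.map_preimage _)).trans ?_
      have aux {A B C D E : X} (p : A ⟶ B) (q : B ⟶ C) (r : C ⟶ D) (u : D ⟶ E) (u' : E ⟶ D)
          (r' : D ⟶ C) (hu : u ≫ u' = 𝟙 D) (hr : r ≫ r' = 𝟙 C) :
          ((p ≫ q ≫ r ≫ u) ≫ u') ≫ r' = p ≫ q := by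
        simp [reassoc_of% hu, hr]
      exact aux _ _ _ _ _ _ (Iso.inv_hom_id_app _ _)
        (by rw [← Functor.map_comp, eY.inv_hom_id, CategoryTheory.Functor.map_id])

/-- The stable t-structure with aisle `X(≥ n)` and coaisle `X(≤ n - 1)`. -/
def stable (n : ℤ) : TStructure X where
  le _ := F.ge n
  ge _ := F.le (n - 1)
  le_shift _ a _ _ A hA := F.ge_shift n a A hA
  ge_shift _ a _ _ A hA := F.le_shift (n - 1) a A hA
  zero' A B f hA hB := F.hom_eq_zero' (n - 1) f (by simpa using hA) hB
  le_zero_le := le_refl _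
  ge_one_le := le_refl _
  exists_triangle_zero_one A := by simpa using F.exists_triangle' (n - 1) A

/-- The truncation functor `σ_{≥ n}`. -/
def σge (n : ℤ) : X ⥤ X := (F.stable n).truncLT 0

/-- The truncation functor `σ_{≤ n}`. -/
def σle (n : ℤ) : X ⥤ X := (F.stable (n + 1)).truncGE 0

/-- The canonical morphism `σ_{≥ n} A ⟶ A`. -/
def σgeι (n : ℤ) : F.σge n ⟶ 𝟭 X := (F.stable n).truncLTι 0

/-- The canonical morphism `A ⟶ σ_{≤ n} A`. -/
def σleπ (n : ℤ) : 𝟭 X ⟶ F.σle n := (F.stable (n + 1)).truncGEπ 0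

/-- The connecting morphism of the triangle `σ_{≥ n + 1} A ⟶ A ⟶ σ_{≤ n} A ⟶ (σ_{≥ n + 1} A)⟦1⟧`. -/
def σδ (n : ℤ) : F.σle n ⟶ F.σge (n + 1) ⋙ shiftFunctor X (1 : ℤ) :=
  (F.stable (n + 1)).truncGEδLT 0

lemma ge_σge (n : ℤ) (A : X) : F.ge n ((F.σge n).obj A) :=
  (inferInstance : (F.stable n).IsLE (((F.stable n).truncLT 0).obj A) (0 - 1)).le

lemma le_σle (n : ℤ) (A : X) : F.le n ((F.σle n).obj A) := by
  have h : F.le (n + 1 - 1) ((F.σle n).obj A) :=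
    ((inferInstance : (F.stable (n + 1)).IsGE (((F.stable (n + 1)).truncGE 0).obj A) 0)).ge
  simpa using h

lemma σleπ_σδ (n : ℤ) (A : X) : (F.σleπ n).app A ≫ (F.σδ n).app A = 0 :=
  (F.stable (n + 1)).truncGEπ_comp_truncGEδLT_app 0 A

lemma ge_σle (n : ℤ) (A : X) (hA : F.ge n A) : F.ge n ((F.σle n).obj A) := by
  have h : (F.stable n).IsLE ((F.σle n).obj A) 0 := by
    rw [(F.stable n).isLE_iff_orthogonal 0 1 rfl]
    intro Y f hY
    have hY' : F.le (n - 1) Y := hY.ge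
    have hY1 : (F.stable (n + 1)).IsGE Y 0 := by
      refine ⟨?_⟩
      change F.le (n + 1 - 1) Y
      have := F.le_le_succ (n - 1) Y hY'
      rwa [show n + 1 - 1 = n - 1 + 1 by ring]
    refine (F.stable (n + 1)).from_truncGE_obj_ext ?_
    exact (F.hom_eq_zero' (n - 1) _ (by simpa using hA) hY').trans comp_zero.symm
  exact h.le

/-- The functor `σ_{≤ n} σ_{≥ n}`. -/
def piece (n : ℤ) : X ⥤ X := F.σge n ⋙ F.σle n

lemma ge_pow (a n : ℤ) (A : X) (hA : F.ge n A) : F.ge (n + a) ((F.s.pow a).functor.obj A) := by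
  cases a with
  | ofNat k =>
    have h := pow_index F.s 1 (fun n A hA => (F.ge_s n A).2 hA) k n A hA
    rw [mul_one] at h
    exact h
  | negSucc k =>
    have := pow_index (P := F.ge) F.s.symm (-1) (fun n A hA => (F.ge_s (n + -1) _).1 (by
      rw [show n + -1 + 1 = n by ring]
      exact (F.ge n).prop_of_iso (F.s.counitIso.app A).symm hA)) (k + 1) n A hA
    rw [show n + Int.negSucc k = n + ((k + 1 : ℕ) : ℤ) * -1 by rw [Int.negSucc_eq]; push_cast; ring]
    exact this

lemma le_pow (a n : ℤ) (A : X) (hA : F.le n A) : F.le (n + a) ((F.s.pow a).functor.obj A) := by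
  cases a with
  | ofNat k =>
    have h := pow_index F.s 1 (fun n A hA => (F.le_s n A).2 hA) k n A hA
    rw [mul_one] at h
    exact h
  | negSucc k =>
    have := pow_index (P := F.le) F.s.symm (-1) (fun n A hA => (F.le_s (n + -1) _).1 (by
      rw [show n + -1 + 1 = n by ring]
      exact (F.le n).prop_of_iso (F.s.counitIso.app A).symm hA)) (k + 1) n A hA
    rw [show n + Int.negSucc k = n + ((k + 1 : ℕ) : ℤ) * -1 by rw [Int.negSucc_eq]; push_cast; ring]
    exact this

/-- The functor `s⁻ⁿ σ_{≤ n} σ_{≥ n}` takes values in `X(≥ 0) ∩ X(≤ 0)`. -/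
lemma piece_pow_mem (n : ℤ) (A : X) :
    (F.ge 0 ⊓ F.le 0) ((F.s.pow (-n)).functor.obj ((F.piece n).obj A)) := by
  have h1 := F.ge_pow (-n) n _ (F.ge_σle n _ (F.ge_σge n A))
  have h2 := F.le_pow (-n) n _ (F.le_σle n ((F.σge n).obj A))
  rw [add_neg_cancel] at h1 h2
  exact ⟨h1, h2⟩

/-- The third morphism of the triangle
`σ_{≤ n+1} σ_{≥ n+1} A ⟶ σ_{≤ n+1} σ_{≥ n} A ⟶ σ_{≤ n} σ_{≥ n} A ⟶ (σ_{≤ n+1} σ_{≥ n+1} A)⟦1⟧`,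
which is obtained by applying `σ_{≤ n+1}` to the truncation triangle
`σ_{≥ n+1} σ_{≥ n} A ⟶ σ_{≥ n} A ⟶ σ_{≤ n} σ_{≥ n} A ⟶ (σ_{≥ n+1} σ_{≥ n} A)⟦1⟧`
and using the identification `σ_{≥ n+1} σ_{≥ n} A ≅ σ_{≥ n+1} A`. -/
def pieceδ (n : ℤ) : F.piece n ⟶ F.piece (n + 1) ⋙ shiftFunctor X (1 : ℤ) :=
  Functor.whiskerLeft (F.σge n) (F.σδ n) ≫
    Functor.whiskerRight
      (Functor.whiskerRight (F.σgeι n) (F.σge (n + 1)) ≫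
        Functor.whiskerLeft (F.σge (n + 1)) (F.σleπ (n + 1))) (shiftFunctor X (1 : ℤ))

lemma pieceδ_comp (n : ℤ) (A : X) :
    (F.pieceδ n).app A ≫ ((F.pieceδ (n + 1)).app A)⟦(1 : ℤ)⟧' = 0 := by
  have h := F.σleπ_σδ (n + 1) ((F.σge (n + 1)).obj A)
  have aux {B C D E P Q : X} (p : B ⟶ C⟦(1 : ℤ)⟧) (q : C ⟶ D) (r : D ⟶ E) (u : E ⟶ P) (v : P ⟶ Q)
      (hr : r ≫ u = 0) :
      (p ≫ (q ≫ r)⟦(1 : ℤ)⟧') ≫ (u ≫ v)⟦(1 : ℤ)⟧' = 0 := by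
    rw [Category.assoc, ← Functor.map_comp, Category.assoc, reassoc_of% hr, zero_comp, comp_zero,
      Functor.map_zero, comp_zero]
  exact aux _ _ _ _ _ h

end FCategory

end FCategories

section Enhancements

variable {T : Type u} [Category.{v} T] [Preadditive T] [HasZeroObject T] [HasShift T ℤ]
  [∀ n : ℤ, (shiftFunctor T n).Additive] [Pretriangulated T]
  {X : Type u'} [Category.{v'} X] [Preadditive X] [HasZeroObject X] [HasShift X ℤ]
  [∀ n : ℤ, (shiftFunctor X n).Additive] [Pretriangulated X]

namespace FCategory

variable (F : FCategory X)

/-- A triangle equivalence `θ` from `T` to `X(≥ 0) ∩ X(≤ 0)`, i.e. a fully faithful triangle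
functor from `T` to `X` whose essential image is `X(≥ 0) ∩ X(≤ 0)`; it makes the f-category `X`
into an f-category over `T`. -/
structure Enhancement (T : Type u) [Category.{v} T] [Preadditive T] [HasZeroObject T]
    [HasShift T ℤ] [∀ n : ℤ, (shiftFunctor T n).Additive] [Pretriangulated T] where
  /-- The underlying functor. -/
  θ : T ⥤ X
  [commShift : θ.CommShift ℤ]
  [isTriangulated : θ.IsTriangulated]
  [full : θ.Full]
  [faithful : θ.Faithful]
  essImage_eq : θ.essImage = F.ge 0 ⊓ F.le 0

attribute [instance] Enhancement.commShift Enhancement.isTriangulated Enhancement.full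
  Enhancement.faithful

namespace Enhancement

variable {F} (E : F.Enhancement T)

lemma ge_zero_θ (Z : T) : F.ge 0 (E.θ.obj Z) := by
  have h := E.θ.obj_mem_essImage Z
  rw [E.essImage_eq] at h
  exact h.1

lemma le_zero_θ (Z : T) : F.le 0 (E.θ.obj Z) := by
  have h := E.θ.obj_mem_essImage Z
  rw [E.essImage_eq] at h
  exact h.2

/-- The functor `T ⥤ X(≥ 0)` induced by `θ`. -/
def toGE : T ⥤ (F.ge 0).FullSubcategory := (F.ge 0).lift E.θ E.ge_zero_θ

/-- The functor `T ⥤ X(≤ 0)` induced by `θ`. -/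
def toLE : T ⥤ (F.le 0).FullSubcategory := (F.le 0).lift E.θ E.le_zero_θ

instance : E.θ.toEssImage.IsEquivalence where

/-- The functor `grⁿ = θ⁻¹ s⁻ⁿ σ_{≤ n} σ_{≥ n}`. -/
def gr (n : ℤ) : X ⥤ T :=
  E.θ.essImage.lift (F.piece n ⋙ (F.s.pow (-n)).functor)
    (fun A => by rw [E.essImage_eq]; exact F.piece_pow_mem n A) ⋙ E.θ.toEssImage.inv

/-- The f-forgetful functors: triangle functors `ω` from `X` to `T` with the four characteristic
properties. -/
structure Forgetful where
  /-- The underlying functor. -/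
  ω : X ⥤ T
  [commShift : ω.CommShift ℤ]
  [isTriangulated : ω.IsTriangulated]
  adj_ge : Nonempty (E.toGE ⊣ (F.ge 0).ι ⋙ ω)
  adj_le : Nonempty ((F.le 0).ι ⋙ ω ⊣ E.toLE)
  isIso_map_α (A : X) : IsIso (ω.map (F.α.app A))
  bijective_map ⦃A B : X⦄ (hA : F.le 0 A) (hB : F.ge 0 B) :
    Function.Bijective (fun f : A ⟶ B => ω.map f)

attribute [instance] Forgetful.commShift Forgetful.isTriangulated

/-- The heart of the t-structure on `X` induced by `t`.  The aisle consists of the objects `A` with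
`grⁿ A` in `t.le n` for all `n`, the coaisle of the objects `A` with `grⁿ A` in `t.ge n`
for all `n`. -/
def heartProp (t : TStructure T) : ObjectProperty X :=
  fun A => (∀ n : ℤ, t.le n ((E.gr n).obj A)) ∧ (∀ n : ℤ, t.ge n ((E.gr n).obj A))

namespace Forgetful

variable {E} (w : E.Forgetful)

/-- The morphism `ω σ_{≤ n} σ_{≥ n} A ⟶ (ω σ_{≤ n+1} σ_{≥ n+1} A)⟦1⟧`. -/
def dbar (n : ℤ) : F.piece n ⋙ w.ω ⟶ (F.piece (n + 1) ⋙ w.ω) ⋙ shiftFunctor T (1 : ℤ) where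
  app A := w.ω.map ((F.pieceδ n).app A) ≫ (w.ω.commShiftIso (1 : ℤ)).hom.app _
  naturality A B f := by
    have h1 := (F.pieceδ n).naturality f
    have h2 := (w.ω.commShiftIso (1 : ℤ)).hom.naturality ((F.piece (n + 1)).map f)
    dsimp at h1 h2 ⊢
    rw [Category.assoc, ← h2, ← Category.assoc, ← Category.assoc, ← Functor.map_comp, h1,
      Functor.map_comp]

lemma dbar_comp (n : ℤ) (A : X) :
    (w.dbar n).app A ≫ ((w.dbar (n + 1)).app A)⟦(1 : ℤ)⟧' = 0 := by
  have h := F.pieceδ_comp n A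
  have h2 := (w.ω.commShiftIso (1 : ℤ)).hom.naturality ((F.pieceδ (n + 1)).app A)
  dsimp [dbar] at h2 ⊢
  rw [Functor.map_comp, Category.assoc, ← reassoc_of% h2, ← Functor.map_comp_assoc, h,
    Functor.map_zero, zero_comp]

variable [IsTriangulated T] (t : TStructure T)

/-- The differential `Hⁱ(ω σ_{≤ i} σ_{≥ i} A) ⟶ Hⁱ⁺¹(ω σ_{≤ i+1} σ_{≥ i+1} A)`. -/
def dH (i : ℤ) : (F.piece i ⋙ w.ω) ⋙ tH t i ⟶ (F.piece (i + 1) ⋙ w.ω) ⋙ tH t (i + 1) :=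
  Functor.whiskerRight (w.dbar i) (tH t i) ≫
    Functor.whiskerLeft (F.piece (i + 1) ⋙ w.ω) (tHShift t i).hom

lemma dH_comp (i : ℤ) (A : X) : (w.dH t i).app A ≫ (w.dH t (i + 1)).app A = 0 := by
  have h := w.dbar_comp i A
  have h2 := (tHShift t i).hom.naturality ((w.dbar (i + 1)).app A)
  dsimp [dH] at h2 ⊢
  rw [Category.assoc, ← reassoc_of% h2, ← Functor.map_comp_assoc, h, Functor.map_zero, zero_comp]

/-- The functor from `X` to complexes in the heart of `t` which sends `A` to the complex with
`i`-th term `Hⁱ(grⁱ A)`, where `grⁱ A` is identified with `ω σ_{≤ i} σ_{≥ i} A`. -/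
def H0 : X ⥤ CochainComplex (HeartCat t) ℤ where
  obj A := CochainComplex.of (fun i => ((F.piece i ⋙ w.ω) ⋙ tH t i).obj A)
    (fun i => (w.dH t i).app A) (fun i => w.dH_comp t i A)
  map f := CochainComplex.ofHom (fun i => ((F.piece i ⋙ w.ω) ⋙ tH t i).map f)
    (fun i => by
      have h (A : X) : (CochainComplex.of (fun i => ((F.piece i ⋙ w.ω) ⋙ tH t i).obj A)
          (fun i => (w.dH t i).app A) (fun i => w.dH_comp t i A)).d i (i + 1) =
          (w.dH t i).app A := CochainComplex.of_d (fun i => ((F.piece i ⋙ w.ω) ⋙ tH t i).obj A)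
          (fun i => (w.dH t i).app A) i
      exact (congrArg _ (h _)).trans (((w.dH t i).naturality f).trans
        (congrArg (fun k => k ≫ _) (h _).symm)))
  map_id A := by
    ext i : 1
    exact ((F.piece i ⋙ w.ω) ⋙ tH t i).map_id A
  map_comp f g := by
    ext i : 1
    exact ((F.piece i ⋙ w.ω) ⋙ tH t i).map_comp f g

end Forgetful

/-- `R` is a realisation functor of the t-structure `t`: there are an f-forgetful functor `ω` and an
inverse `G` of the equivalence given by `H0` from the heart of the induced t-structure to bounded
complexes, such that the composition of `R` with the localisation functor is isomorphic to the
composition of `G` with the restriction of `ω`. -/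
def IsRealisation [IsTriangulated T] (t : TStructure T)
    (R : BoundedDerived (HeartCat t) ⥤ T) : Prop :=
  ∃ (w : E.Forgetful) (G : BoundedComplex (HeartCat t) ⥤ (E.heartProp t).FullSubcategory),
    G.IsEquivalence ∧
    Nonempty (G ⋙ (E.heartProp t).ι ⋙ w.H0 t ≅ (isBoundedComplex (HeartCat t)).ι) ∧
    Nonempty (boundedQ (HeartCat t) ⋙ R ≅ G ⋙ (E.heartProp t).ι ⋙ w.ω)

end Enhancement

end FCategory

end Enhancements

/-! ### Silting, cosilting, tilting and cotilting objects -/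

section Silting

variable {T : Type u} [Category.{v} T] [Preadditive T] [HasZeroObject T] [HasShift T ℤ]
  [∀ n : ℤ, (shiftFunctor T n).Additive] [Pretriangulated T]

/-- The objects `Y` with `Hom(M, Y⟦i⟧) = 0` for all `i` in `I`. -/
def rightPerp (M : T) (I : Set ℤ) : ObjectProperty T :=
  fun Y => ∀ i ∈ I, ∀ f : M ⟶ Y⟦i⟧, f = 0

/-- The objects `Y` with `Hom(Y, M⟦i⟧) = 0` for all `i` in `I`. -/
def leftPerp (M : T) (I : Set ℤ) : ObjectProperty T :=
  fun Y => ∀ i ∈ I, ∀ f : Y ⟶ M⟦i⟧, f = 0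

/-- The direct summands of coproducts of copies of `M`. -/
def inAdd (M : T) : ObjectProperty T :=
  fun Y => ∃ (I : Type v) (c : Cofan (fun _ : I => M)),
    Nonempty (IsColimit c) ∧ Nonempty (Retract Y c.pt)

/-- The direct summands of products of copies of `M`. -/
def inProd (M : T) : ObjectProperty T :=
  fun Y => ∃ (I : Type v) (c : Fan (fun _ : I => M)),
    Nonempty (IsLimit c) ∧ Nonempty (Retract Y c.pt)

/-- `M` is silting: `M` lies in `M^{⊥ > 0}`, and `(M^{⊥ > 0}, M^{⊥ < 0})` is a t-structure
(aisle `T^{≤ 0}`, coaisle `T^{≥ 0}`). -/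
def IsSilting (M : T) : Prop :=
  (∃ t : TStructure T, t.le 0 = rightPerp M (Set.Ioi 0) ∧ t.ge 0 = rightPerp M (Set.Iio 0)) ∧
    rightPerp M (Set.Ioi 0) M

/-- `M` is cosilting: `M` lies in `^{⊥ > 0}M`, and `(^{⊥ < 0}M, ^{⊥ > 0}M)` is a t-structure
(aisle `T^{≤ 0}`, coaisle `T^{≥ 0}`). -/
def IsCosilting (M : T) : Prop :=
  (∃ t : TStructure T, t.le 0 = leftPerp M (Set.Iio 0) ∧ t.ge 0 = leftPerp M (Set.Ioi 0)) ∧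
    leftPerp M (Set.Ioi 0) M

/-- `M` is tilting: it is silting and `Add(M) ⊆ M^{⊥ ≠ 0}`. -/
def IsTilting (M : T) : Prop :=
  IsSilting M ∧ inAdd M ≤ rightPerp M {i | i ≠ 0}

/-- `M` is cotilting: it is cosilting and `Prod(M) ⊆ ^{⊥ ≠ 0}M`. -/
def IsCotilting (M : T) : Prop :=
  IsCosilting M ∧ inProd M ≤ leftPerp M {i | i ≠ 0}

/-- The t-structure of a silting object (it is determined by its aisle and coaisle). -/
def IsSilting.tStructure {M : T} (h : IsSilting M) : TStructure T := h.1.choose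

/-- The t-structure of a cosilting object (it is determined by its aisle and coaisle). -/
def IsCosilting.tStructure {M : T} (h : IsCosilting M) : TStructure T := h.1.choose

end Silting

end

/-! Let `Φ` be the functor on bounded complexes over the heart obtained by composing an inverse of
`H0` with an f-forgetful functor `ω`. A realisation functor `R` is `Φ` factored through the
localisation, so everything is read off from `Φ`. What is needed is collected in `RealisesHeart`:
short exact sequences become triangles, two-term complexes with invertible differential die, and
complexes concentrated in degree `n` correspond fully faithfully to objects of `T` concentrated in
degree `n`. It follows that `Φ` inverts exactly the quasi-isomorphisms (`boundedQuasiIso_iff`), and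
that `R` is full and faithful precisely when every morphism `Φ K ⟶ Φ L` is a roof `Φ(s)⁻¹ Φ(f)`
(`RealisesHeart.full_faithful_iff`).

Existence needs `ω` and an inverse of `H0`. For `ω`, divide `X` by the objects that receive no
morphisms from `X(≤ n)` for some `n`: the cones of `α` are of this kind, and `θ` followed by the
quotient functor is an equivalence (`nonempty_forgetful`). `H0` is an equivalence because an object
of the induced heart is glued from its pieces, and for degree reasons there is neither ambiguity in
gluing morphisms nor an obstruction beyond `d² = 0` in gluing objects (`exists_of_pieceHom`,
`exists_of_pieces`).

If `M` is tilting, coproducts `P` of copies of `M` lie in the heart, have no non-zero morphisms to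
`T^{≤ -1}`, and every `Y` in the heart receives an epimorphism from such a `P`. A morphism from `P`
to `Φ L` only sees the degree zero part of `L`, where it is a roof. The cone of `P ⟶ Y` is
concentrated one degree lower, hence closer to the bottom of `L`, so a dévissage along these
triangles and along truncations ends and makes all morphisms roofs (`isRoof_devissage`,
`isRoof_of_all`).

Conversely, let `R` be full. A morphism from `Y` in the heart to an object concentrated in some
negative degree is a roof, so it vanishes on an epimorphism onto `Y` in the heart and therefore
factors through an object concentrated in degree `-1` (`exists_factorisation`). Thus vanishing of
first extensions in the heart implies vanishing of all higher ones in `T`. Now let `N` be a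
coproduct of copies of `M`. It lies in the aisle and has no morphisms to `T^{≤ -1}`, which makes `P
= τ^{≥ 0} N` projective in the heart. Hence every morphism from `W = τ^{< 0} N` to its top
cohomology extends to `N`, where it must vanish; so `W` lies in every `T^{≤ n}` and is zero.
Therefore `N` lies in the heart, which means that `M` is tilting (`isGE_zero_of_hom_eq_zero`). The
cosilting case is dual, with products and injectives; its dévissage is run on `Φ.op`. -/

set_option linter.unusedSectionVars false

/-! ### Distinguished triangles -/

section DistTriang

variable {T : Type*} [Category T] [Preadditive T] [HasZeroObject T] [HasShift T ℤ]
  [∀ n : ℤ, (shiftFunctor T n).Additive] [Pretriangulated T]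

namespace DistTriang

variable {A B D W : T} {f : A ⟶ B} {g : B ⟶ D} {h : D ⟶ A⟦(1 : ℤ)⟧}

lemma zero₁₂ (hT : Triangle.mk f g h ∈ distTriang T) : f ≫ g = 0 :=
  comp_distTriang_mor_zero₁₂ _ hT

lemma zero₂₃ (hT : Triangle.mk f g h ∈ distTriang T) : g ≫ h = 0 :=
  comp_distTriang_mor_zero₂₃ _ hT

lemma zero₃₁ (hT : Triangle.mk f g h ∈ distTriang T) : h ≫ f⟦(1 : ℤ)⟧' = 0 :=
  comp_distTriang_mor_zero₃₁ _ hT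

lemma lift₂ (hT : Triangle.mk f g h ∈ distTriang T) (x : W ⟶ B) (hx : x ≫ g = 0) :
    ∃ y : W ⟶ A, x = y ≫ f :=
  Triangle.coyoneda_exact₂ _ hT x hx

lemma desc₂ (hT : Triangle.mk f g h ∈ distTriang T) (x : B ⟶ W) (hx : f ≫ x = 0) :
    ∃ y : D ⟶ W, x = g ≫ y :=
  Triangle.yoneda_exact₂ _ hT x hx

lemma lift₃ (hT : Triangle.mk f g h ∈ distTriang T) (x : W ⟶ D) (hx : x ≫ h = 0) :
    ∃ y : W ⟶ B, x = y ≫ g :=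
  Triangle.coyoneda_exact₃ _ hT x hx

lemma desc₃ (hT : Triangle.mk f g h ∈ distTriang T) (x : D ⟶ W) (hx : g ≫ x = 0) :
    ∃ y : A⟦(1 : ℤ)⟧ ⟶ W, x = h ≫ y :=
  Triangle.yoneda_exact₃ _ hT x hx

lemma isIso₁_iff (hT : Triangle.mk f g h ∈ distTriang T) : IsIso f ↔ IsZero D :=
  (Triangle.isZero₃_iff_isIso₁ _ hT).symm

lemma isIso₂_iff (hT : Triangle.mk f g h ∈ distTriang T) : IsIso g ↔ IsZero A :=
  (Triangle.isZero₁_iff_isIso₂ _ hT).symm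

lemma isIso₃_iff (hT : Triangle.mk f g h ∈ distTriang T) : IsIso h ↔ IsZero B :=
  (Triangle.isZero₂_iff_isIso₃ _ hT).symm

lemma isZero₂ (hT : Triangle.mk f g h ∈ distTriang T) (hA : IsZero A) (hD : IsZero D) :
    IsZero B :=
  Triangle.isZero₂_of_isZero₁₃ _ hT hA hD

lemma epi₂ (hT : Triangle.mk f g h ∈ distTriang T) (h0 : h = 0) : Epi g :=
  Triangle.epi₂ _ hT h0

/-- If the first morphism of a distinguished triangle is a split monomorphism, the second one
has a section. -/
lemma exists_section (hT : Triangle.mk f g h ∈ distTriang T) (ρ : B ⟶ A) (hρ : f ≫ ρ = 𝟙 A) :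
    ∃ σ : D ⟶ B, g ≫ σ = 𝟙 B - ρ ≫ f ∧ σ ≫ g = 𝟙 D ∧ σ ≫ ρ = 0 := by
  -- The complementary idempotent kills `f`, so it descends to `D`; the descended map is the
  -- section.
  obtain ⟨σ, hσ⟩ := desc₂ hT (𝟙 B - ρ ≫ f) (by
    rw [Preadditive.comp_sub, Category.comp_id, reassoc_of% hρ, sub_self])
  have h0 : h = 0 := by
    have h1 := zero₃₁ hT
    have : f⟦(1 : ℤ)⟧' ≫ ρ⟦(1 : ℤ)⟧' = 𝟙 _ := by
      rw [← Functor.map_comp, hρ, CategoryTheory.Functor.map_id]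
    rw [← Category.comp_id h, ← this, reassoc_of% h1, zero_comp]
  have := epi₂ hT h0
  have hfg := zero₁₂ hT
  refine ⟨σ, hσ.symm, ?_, ?_⟩
  · rw [← cancel_epi g, ← Category.assoc, ← hσ, Preadditive.sub_comp, Category.assoc, hfg,
      comp_zero, sub_zero, Category.id_comp, Category.comp_id]
  · rw [← cancel_epi g, ← Category.assoc, ← hσ, Preadditive.sub_comp, Category.assoc, hρ,
      Category.comp_id, Category.id_comp, sub_self, comp_zero]

/-- Two distinguished triangles with isomorphic first morphisms have isomorphic cones. -/
lemma cone_iso {A' B' D' : T} {f' : A' ⟶ B'} {g' : B' ⟶ D'} {h' : D' ⟶ A'⟦(1 : ℤ)⟧}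
    (hT : Triangle.mk f g h ∈ distTriang T) (hT' : Triangle.mk f' g' h' ∈ distTriang T)
    (e₁ : A ≅ A') (e₂ : B ≅ B') (w : f ≫ e₂.hom = e₁.hom ≫ f') : Nonempty (D ≅ D') :=
  ⟨Triangle.π₃.mapIso (isoTriangleOfIso₁₂ _ _ hT hT' e₁ e₂ w)⟩

end DistTriang

end DistTriang

/-! ### Short exact sequences in abelian categories -/

section Abelian

variable {C : Type*} [Category C] [Abelian C]

lemma lift_comp_eq {X Y Z A : C} (f : A ⟶ X) (g : A ⟶ Y) (r : X ⊞ Y ⟶ Z) :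
    biprod.lift f g ≫ r = f ≫ biprod.inl ≫ r + g ≫ biprod.inr ≫ r := by
  rw [biprod.lift_eq]
  simp

lemma comp_desc_eq {X Y Z A : C} (r : A ⟶ X ⊞ Y) (f : X ⟶ Z) (g : Y ⟶ Z) :
    r ≫ biprod.desc f g = (r ≫ biprod.fst) ≫ f + (r ≫ biprod.snd) ≫ g := by
  rw [biprod.desc_eq]
  simp

lemma shortExact_cokernel {X Y : C} (f : X ⟶ Y) [Mono f] :
    (ShortComplex.mk f (cokernel.π f) (cokernel.condition f)).ShortExact where
  exact := ShortComplex.exact_of_g_is_cokernel _ (cokernelIsCokernel f)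

lemma shortExact_kernel {X Y : C} (f : X ⟶ Y) [Epi f] :
    (ShortComplex.mk (kernel.ι f) f (kernel.condition f)).ShortExact where
  exact := ShortComplex.exact_of_f_is_kernel _ (kernelIsKernel f)

lemma shortExact_biprod (X Y : C) :
    (ShortComplex.mk (biprod.inl : X ⟶ X ⊞ Y) biprod.snd biprod.inl_snd).ShortExact :=
  (ShortComplex.Splitting.ofHasBinaryBiproduct X Y).shortExact

lemma shortExact_biprod' (X Y : C) :
    (ShortComplex.mk (biprod.inr : Y ⟶ X ⊞ Y) biprod.fst biprod.inr_fst).ShortExact := by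
  have h : (ShortComplex.mk (biprod.inr : Y ⟶ X ⊞ Y) biprod.fst biprod.inr_fst).Splitting :=
    { r := biprod.snd
      s := biprod.inl
      id := by rw [add_comm]; exact biprod.total }
  exact h.shortExact

/-- The pushforward of a short exact sequence. -/
lemma exists_pushforward {X₁ X₂ X₃ L : C} {f : X₁ ⟶ X₂} {g : X₂ ⟶ X₃} {w : f ≫ g = 0}
    (hS : (ShortComplex.mk f g w).ShortExact) (a : X₁ ⟶ L) :
    ∃ (N : C) (i : L ⟶ N) (p : N ⟶ X₃) (k : X₂ ⟶ N) (wN : i ≫ p = 0)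
      (wa : biprod.lift f (-a) ≫ biprod.desc k i = 0),
      (ShortComplex.mk i p wN).ShortExact ∧
      (ShortComplex.mk (biprod.lift f (-a)) (biprod.desc k i) wa).ShortExact ∧ k ≫ p = g := by
  have : Mono f := hS.mono_f
  have : Epi g := hS.epi_g
  have hm : Mono (biprod.lift f (-a)) := mono_of_mono_fac (biprod.lift_fst f (-a))
  -- The sign in `(f, -a)` turns the cokernel relation into commutativity of the pushout square.
  let q := cokernel.π (biprod.lift f (-a))
  have hq : f ≫ biprod.inl ≫ q = a ≫ biprod.inr ≫ q := by
    have h : biprod.lift f (-a) ≫ q = 0 := cokernel.condition _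
    rwa [lift_comp_eq, Preadditive.neg_comp, ← sub_eq_add_neg, sub_eq_zero] at h
  have hd : biprod.desc (biprod.inl ≫ q) (biprod.inr ≫ q) = q := by ext <;> simp
  have hp0 : biprod.lift f (-a) ≫ biprod.desc g 0 = 0 := by simp [w]
  let p := cokernel.desc (biprod.lift f (-a)) (biprod.desc g 0) hp0
  have hqp : q ≫ p = biprod.desc g 0 := cokernel.π_desc _ _ _
  have hkp : (biprod.inl ≫ q) ≫ p = g := by rw [Category.assoc, hqp, biprod.inl_desc]
  have hip : (biprod.inr ≫ q) ≫ p = 0 := by rw [Category.assoc, hqp, biprod.inr_desc]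
  refine ⟨cokernel (biprod.lift f (-a)), biprod.inr ≫ q, p, biprod.inl ≫ q, hip, ?_, ?_, ?_, hkp⟩
  · rw [hd]; exact cokernel.condition _
  · have hep : Epi p := epi_of_epi_fac hkp
    refine { exact := ?_, mono_f := ?_, epi_g := hep }
    · rw [ShortComplex.exact_iff_exact_up_to_refinements]
      intro A x hx
      dsimp at x hx
      obtain ⟨A', π, _, y, hy⟩ := surjective_up_to_refinements_of_epi q x
      have h1 : (y ≫ biprod.fst) ≫ g = 0 := by
        have h2 : y ≫ q ≫ p = 0 := by rw [← reassoc_of% hy, hx, comp_zero]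
        rw [hqp] at h2
        rw [Category.assoc, ← h2]
        congr 1
        ext <;> simp
      obtain ⟨A'', π', _, z, hz⟩ := hS.exact.exact_up_to_refinements (y ≫ biprod.fst) h1
      dsimp at z hz
      refine ⟨A'', π' ≫ π, inferInstance, π' ≫ y ≫ biprod.snd + z ≫ a, ?_⟩
      dsimp
      have ht : y ≫ q = (y ≫ biprod.fst) ≫ biprod.inl ≫ q + (y ≫ biprod.snd) ≫ biprod.inr ≫ q := by
        have h2 := (biprod.total (X := X₂) (Y := L)) =≫ q
        rw [Preadditive.add_comp, Category.id_comp] at h2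
        rw [← h2]
        simp
      rw [Category.assoc, hy, Preadditive.add_comp, Category.assoc z a, ← hq, ← reassoc_of% hz, ht]
      simp [add_comm]
    · rw [Preadditive.mono_iff_cancel_zero]
      intro A x hx
      dsimp at x hx
      obtain ⟨A', π, _, z, hz⟩ := (shortExact_cokernel (biprod.lift f (-a))).exact.exact_up_to_refinements
        (x ≫ biprod.inr) (by simpa using hx)
      dsimp at z hz
      have h1 := hz =≫ biprod.fst
      simp only [Category.assoc, biprod.inr_fst, comp_zero, biprod.lift_fst] at h1
      have h2 : z = 0 := zero_of_comp_mono f h1.symm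
      have h3 := hz =≫ biprod.snd
      simp only [Category.assoc, biprod.inr_snd, Category.comp_id, h2, zero_comp] at h3
      exact zero_of_epi_comp π h3
  · have h := shortExact_cokernel (biprod.lift f (-a))
    convert h

end Abelian

/-! ### Functors sending short exact sequences to triangles -/

section Roofs

variable {C : Type*} [Category C] [Abelian C]
  {T : Type*} [Category T] [Preadditive T] [HasZeroObject T] [HasShift T ℤ]
  [∀ n : ℤ, (shiftFunctor T n).Additive] [Pretriangulated T]

/-- The functor `Φ` sends short exact sequences to distinguished triangles, and there are enough
objects which are killed by `Φ`. -/
structure ExactWithAcyclics (Φ : C ⥤ T) : Prop where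
  exact {X₁ X₂ X₃ : C} {f : X₁ ⟶ X₂} {g : X₂ ⟶ X₃} {w : f ≫ g = 0}
    (hS : (ShortComplex.mk f g w).ShortExact) :
    ∃ h, Triangle.mk (Φ.map f) (Φ.map g) h ∈ distTriang T
  exists_epi (K : C) : ∃ (J : C) (p : J ⟶ K), Epi p ∧ IsZero (Φ.obj J)
  exists_mono (K : C) : ∃ (J : C) (i : K ⟶ J), Mono i ∧ IsZero (Φ.obj J)

/-- A morphism `Φ K ⟶ Φ L` of the form `Φ(s)⁻¹ Φ(f)`. -/
def IsRoof (Φ : C ⥤ T) {K L : C} (g : Φ.obj K ⟶ Φ.obj L) : Prop :=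
  ∃ (K' : C) (s : K' ⟶ K) (f : K' ⟶ L), IsIso (Φ.map s) ∧ Φ.map s ≫ g = Φ.map f

/-- Two morphisms whose difference factors through an object killed by `Φ`. -/
def StablyEq (Φ : C ⥤ T) {K L : C} (a b : K ⟶ L) : Prop :=
  ∃ (J : C) (i : K ⟶ J) (j : J ⟶ L), IsZero (Φ.obj J) ∧ a = b + i ≫ j

section

open CategoryTheory.Pretriangulated.Opposite

/-- The conditions are self-dual. This yields the second Ore square from the first, and later the
injective case from the projective one. -/
lemma ExactWithAcyclics.op {Φ : C ⥤ T} (hΦ : ExactWithAcyclics Φ) : ExactWithAcyclics Φ.op where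
  exact {X₁ X₂ X₃ f g w} hS := by
    obtain ⟨h, hT⟩ := hΦ.exact hS.unop
    exact ⟨_, op_distinguished _ hT⟩
  exists_epi K := by
    obtain ⟨J, i, _, hJ⟩ := hΦ.exists_mono K.unop
    exact ⟨Opposite.op J, i.op, inferInstance, hJ.op⟩
  exists_mono K := by
    obtain ⟨J, i, _, hJ⟩ := hΦ.exists_epi K.unop
    exact ⟨Opposite.op J, i.op, inferInstance, hJ.op⟩

end

variable {Φ : C ⥤ T} [Φ.Additive]

lemma StablyEq.map_eq {K L : C} {a b : K ⟶ L} (h : StablyEq Φ a b) : Φ.map a = Φ.map b := by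
  obtain ⟨J, i, j, hJ, rfl⟩ := h
  rw [Φ.map_add, Φ.map_comp, hJ.eq_of_tgt (Φ.map i) 0, zero_comp, add_zero]

namespace ExactWithAcyclics

lemma isIso_fst (hΦ : ExactWithAcyclics Φ) {J : C} (K : C) (hJ : IsZero (Φ.obj J)) :
    IsIso (Φ.map (biprod.fst : K ⊞ J ⟶ K)) := by
  obtain ⟨h, hT⟩ := hΦ.exact (shortExact_biprod' K J)
  exact (DistTriang.isIso₂_iff hT).2 hJ

lemma isIso_inl (hΦ : ExactWithAcyclics Φ) {J : C} (K : C) (hJ : IsZero (Φ.obj J)) :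
    IsIso (Φ.map (biprod.inl : K ⟶ K ⊞ J)) := by
  obtain ⟨h, hT⟩ := hΦ.exact (shortExact_biprod K J)
  exact (DistTriang.isIso₁_iff hT).2 hJ

/-- An Ore condition up to maps through acyclics. Adding an embedding of `K'` into an acyclic `J`
makes `s` a monomorphism without changing its cone; pushing out along `f` then keeps the cone zero.
The square commutes except for the component through `J`. -/
lemma exists_square (hΦ : ExactWithAcyclics Φ) {K' K L : C} (s : K' ⟶ K) (f : K' ⟶ L)
    (hs : IsIso (Φ.map s)) :
    ∃ (N : C) (t : L ⟶ N) (f' : K ⟶ N), IsIso (Φ.map t) ∧ StablyEq Φ (s ≫ f') (f ≫ t) := by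
  obtain ⟨J, i₀, hi₀, hJ⟩ := hΦ.exists_mono K'
  have hm : Mono (biprod.lift s i₀) := mono_of_mono_fac (biprod.lift_snd s i₀)
  obtain ⟨N, i, p, k, wN, wa, hN, -, -⟩ := exists_pushforward
    (shortExact_cokernel (biprod.lift s i₀)) f
  have hfst := hΦ.isIso_fst K hJ
  have hm' : IsIso (Φ.map (biprod.lift s i₀)) := by
    have : Φ.map (biprod.lift s i₀) = Φ.map s ≫ inv (Φ.map (biprod.fst : K ⊞ J ⟶ K)) := by
      rw [IsIso.eq_comp_inv, ← Φ.map_comp, biprod.lift_fst]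
    rw [this]
    infer_instance
  obtain ⟨_, hT⟩ := hΦ.exact (shortExact_cokernel (biprod.lift s i₀))
  obtain ⟨_, hT'⟩ := hΦ.exact hN
  refine ⟨N, i, biprod.inl ≫ k, (DistTriang.isIso₁_iff hT').2 ((DistTriang.isIso₁_iff hT).1 hm'),
    J, -i₀, biprod.inr ≫ k, hJ, ?_⟩
  have h1 : biprod.lift s i₀ ≫ k = f ≫ i := by
    have h2 : biprod.lift (biprod.lift s i₀) (-f) ≫ biprod.desc k i =
        biprod.lift s i₀ ≫ k - f ≫ i := by
      rw [biprod.lift_desc, Preadditive.neg_comp, sub_eq_add_neg]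
    rwa [h2, sub_eq_zero] at wa
  rw [← h1, lift_comp_eq, Preadditive.neg_comp]
  abel

open CategoryTheory.Pretriangulated.Opposite in
lemma exists_square' (hΦ : ExactWithAcyclics Φ) {K L L' : C} (s : L' ⟶ L) (f : K ⟶ L)
    (hs : IsIso (Φ.map s)) :
    ∃ (N : C) (t : N ⟶ K) (f' : N ⟶ L'), IsIso (Φ.map t) ∧ StablyEq Φ (f' ≫ s) (t ≫ f) := by
  have hs' : IsIso (Φ.op.map s.op) := inferInstanceAs (IsIso (Φ.map s).op)
  obtain ⟨N, t, f', ht, J, i, j, hJ, hij⟩ := hΦ.op.exists_square s.op f.op hs'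
  have ht' : IsIso (Φ.map t.unop) := inferInstanceAs (IsIso (Φ.op.map t).unop)
  exact ⟨N.unop, t.unop, f'.unop, ht', J.unop, j.unop, i.unop, hJ.unop, congrArg Quiver.Hom.unop hij⟩

/-- The two Ore squares turn left fractions into right fractions and back; `Φ` does not see the
error through an acyclic. -/
lemma isRoof_iff (hΦ : ExactWithAcyclics Φ) {K L : C} (g : Φ.obj K ⟶ Φ.obj L) :
    IsRoof Φ g ↔
      ∃ (L' : C) (s : L ⟶ L') (f : K ⟶ L'), IsIso (Φ.map s) ∧ g ≫ Φ.map s = Φ.map f := by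
  constructor
  · rintro ⟨K', s, f, hs, hf⟩
    obtain ⟨N, t, f', ht, h⟩ := hΦ.exists_square s f hs
    refine ⟨N, t, f', ht, ?_⟩
    have := h.map_eq
    rw [Φ.map_comp, Φ.map_comp, ← hf, Category.assoc, cancel_epi] at this
    exact this.symm
  · rintro ⟨L', s, f, hs, hf⟩
    obtain ⟨N, t, f', ht, h⟩ := hΦ.exists_square' s f hs
    refine ⟨N, t, f', ht, ?_⟩
    have := h.map_eq
    rw [Φ.map_comp, Φ.map_comp, ← hf, ← Category.assoc, cancel_mono] at this
    exact this.symm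

/-- Opposite categories exchange left and right fractions, which `isRoof_iff` identifies. The
dévissage for injectives relies on this. -/
lemma isRoof_op_iff (hΦ : ExactWithAcyclics Φ) {K L : C} (g : Φ.obj K ⟶ Φ.obj L) :
    IsRoof Φ.op (K := Opposite.op L) (L := Opposite.op K) g.op ↔ IsRoof Φ g := by
  rw [hΦ.isRoof_iff]
  constructor
  · rintro ⟨K', s, f, hs, h⟩
    exact ⟨K'.unop, s.unop, f.unop, inferInstanceAs (IsIso (Φ.op.map s).unop),
      congrArg Quiver.Hom.unop h⟩
  · rintro ⟨K', s, f, hs, h⟩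
    exact ⟨Opposite.op K', s.op, f.op, inferInstanceAs (IsIso (Φ.map s).op),
      congrArg Quiver.Hom.op h⟩

end ExactWithAcyclics

lemma isRoof_map {K L : C} (f : K ⟶ L) : IsRoof Φ (Φ.map f) :=
  ⟨K, 𝟙 K, f, inferInstance, by simp⟩

lemma isRoof_of_isIso {K L : C} (s : K ⟶ L) (hs : IsIso (Φ.map s)) :
    IsRoof Φ (inv (Φ.map s)) :=
  ⟨K, s, 𝟙 K, hs, by simp⟩

namespace ExactWithAcyclics

lemma isRoof_comp (hΦ : ExactWithAcyclics Φ) {K L M : C} {g : Φ.obj K ⟶ Φ.obj L}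
    {h : Φ.obj L ⟶ Φ.obj M} (hg : IsRoof Φ g) (hh : IsRoof Φ h) : IsRoof Φ (g ≫ h) := by
  obtain ⟨K₁, s₁, f₁, hs₁, hf₁⟩ := hg
  obtain ⟨L₂, s₂, f₂, hs₂, hf₂⟩ := hh
  obtain ⟨N, t, f', ht, h'⟩ := hΦ.exists_square' s₂ f₁ hs₂
  have := h'.map_eq
  refine ⟨N, t ≫ s₁, f' ≫ f₂, by rw [Φ.map_comp]; infer_instance, ?_⟩
  rw [Φ.map_comp, Φ.map_comp] at this
  rw [Φ.map_comp, Φ.map_comp, ← hf₂, reassoc_of% this, ← reassoc_of% hf₁, Category.assoc]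

/-- If all morphisms from `Φ K` to `Φ L'` are roofs and `L'` is connected with `L` by a morphism
which `Φ` inverts, the same holds for `L`. -/
lemma isRoof_of_source (hΦ : ExactWithAcyclics Φ) {K K' L : C} (s : K ⟶ K') (hs : IsIso (Φ.map s))
    (h : ∀ g : Φ.obj K' ⟶ Φ.obj L, IsRoof Φ g) (g : Φ.obj K ⟶ Φ.obj L) : IsRoof Φ g := by
  have := hΦ.isRoof_comp (isRoof_map s) (h (inv (Φ.map s) ≫ g))
  rwa [IsIso.hom_inv_id_assoc] at this

/-- Dévissage in the first variable: the second condition concerns all extensions of `X₃`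
by objects with the same image as `L`. -/
lemma isRoof_devissage (hΦ : ExactWithAcyclics Φ) {X₁ X₂ X₃ L : C} {f : X₁ ⟶ X₂} {g : X₂ ⟶ X₃}
    {w : f ≫ g = 0} (hS : (ShortComplex.mk f g w).ShortExact)
    (h₁ : ∀ φ : Φ.obj X₁ ⟶ Φ.obj L, IsRoof Φ φ)
    (h₃ : ∀ ⦃L₁ N : C⦄ (i : L₁ ⟶ N) (p : N ⟶ X₃) (w : i ≫ p = 0),
      (ShortComplex.mk i p w).ShortExact → Nonempty (Φ.obj L₁ ≅ Φ.obj L) →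
        ∀ φ : Φ.obj X₃ ⟶ Φ.obj N, IsRoof Φ φ)
    (φ : Φ.obj X₂ ⟶ Φ.obj L) : IsRoof Φ φ := by
  -- With the restriction of `φ` to `X₁` written as a right fraction with numerator `a`, the
  -- sequence can be pushed out along `a`, and `φ` extends to a retraction `ρ` of `Φ.map i`. It then
  -- suffices to show that `ρ` is a roof.
  obtain ⟨L₁, s, a, hs, ha⟩ := (hΦ.isRoof_iff _).1 (h₁ (Φ.map f ≫ φ))
  obtain ⟨N, i, p, k, wN, wa, hN, ha', hk⟩ := exists_pushforward hS a
  obtain ⟨δ, hT⟩ := hΦ.exact hN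
  obtain ⟨δ', hT'⟩ := hΦ.exact ha'
  obtain ⟨ρ, hρ⟩ := DistTriang.desc₂ hT'
      (Φ.map (biprod.fst : X₂ ⊞ L₁ ⟶ X₂) ≫ φ ≫ Φ.map s + Φ.map biprod.snd) (by
    rw [Preadditive.comp_add, ← Φ.map_comp, ← Φ.map_comp_assoc, biprod.lift_fst, biprod.lift_snd,
      Φ.map_neg, ← ha]
    simp)
  have hiρ : Φ.map i ≫ ρ = 𝟙 _ := by
    have := Φ.map biprod.inr ≫= hρ
    rw [← Φ.map_comp_assoc, biprod.inr_desc, Preadditive.comp_add, ← Φ.map_comp_assoc,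
      biprod.inr_fst, Φ.map_zero, zero_comp, zero_add, ← Φ.map_comp, biprod.inr_snd,
      Φ.map_id] at this
    exact this.symm
  have hkρ : Φ.map k ≫ ρ = φ ≫ Φ.map s := by
    have := Φ.map biprod.inl ≫= hρ
    rw [← Φ.map_comp_assoc, biprod.inl_desc, Preadditive.comp_add, ← Φ.map_comp_assoc,
      biprod.inl_fst, Φ.map_id, Category.id_comp, ← Φ.map_comp, biprod.inl_snd,
      Φ.map_zero, add_zero] at this
    exact this.symm
  -- The retraction splits the triangle. Its section starts at `Φ X₃`, so the second hypothesis
  -- writes it as a roof with numerator `e`; then `(i, e)` is inverted by `Φ` and exhibits `ρ` as a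
  -- fraction of the first projection.
  obtain ⟨σ, hσ₁, hσ₂, hσ₃⟩ := DistTriang.exists_section hT ρ hiρ
  obtain ⟨X₃', r, e, hr, he⟩ := h₃ i p wN hN ⟨(asIso (Φ.map s)).symm⟩ σ
  have hρ' : IsRoof Φ ρ := by
    refine ⟨L₁ ⊞ X₃', biprod.desc i e, biprod.fst, ?_, ?_⟩
    · refine ⟨ρ ≫ Φ.map biprod.inl + Φ.map p ≫ inv (Φ.map r) ≫ Φ.map biprod.inr, ?_, ?_⟩
      · have h1 : Φ.map i ≫ Φ.map p = 0 := by rw [← Φ.map_comp, wN, Φ.map_zero]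
        have h2 : Φ.map (biprod.desc i e) = Φ.map biprod.fst ≫ Φ.map i +
            Φ.map biprod.snd ≫ Φ.map e := by
          rw [← Φ.map_comp, ← Φ.map_comp, ← Φ.map_add, biprod.desc_eq]
        rw [h2, ← he, Preadditive.add_comp, Preadditive.comp_add, Preadditive.comp_add]
        simp only [Category.assoc, reassoc_of% hiρ, reassoc_of% h1, reassoc_of% hσ₂,
          reassoc_of% hσ₃, zero_comp, comp_zero, IsIso.hom_inv_id_assoc, add_zero, zero_add]
        rw [← Φ.map_comp, ← Φ.map_comp, ← Φ.map_add, biprod.total, Φ.map_id]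
      · rw [Preadditive.add_comp, Category.assoc, ← Φ.map_comp, biprod.inl_desc, Category.assoc,
          Category.assoc, ← Φ.map_comp, biprod.inr_desc, ← he, IsIso.inv_hom_id_assoc, hσ₁]
        abel
    · rw [biprod.desc_eq, Φ.map_add, Φ.map_comp, Φ.map_comp, ← he, Preadditive.add_comp]
      simp only [Category.assoc, hiρ, hσ₃, comp_zero, add_zero, Category.comp_id]
  have := hΦ.isRoof_comp (hΦ.isRoof_comp (isRoof_map k) hρ') (isRoof_of_isIso s hs)
  rwa [hkρ, Category.assoc, IsIso.hom_inv_id, Category.comp_id] at this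

/-- If all morphisms are roofs, a morphism that `Φ` kills becomes stably zero after composition
with a morphism that `Φ` inverts. -/
lemma exists_stablyEq_zero (hΦ : ExactWithAcyclics Φ)
    (hroof : ∀ ⦃K L : C⦄ (g : Φ.obj K ⟶ Φ.obj L), IsRoof Φ g) {K L : C} (a : K ⟶ L)
    (ha : Φ.map a = 0) : ∃ (K' : C) (e : K' ⟶ K), IsIso (Φ.map e) ∧ StablyEq Φ (e ≫ a) 0 := by
  obtain ⟨J, p, hp, hJ⟩ := hΦ.exists_epi L
  have : Epi (biprod.desc a p) := epi_of_epi_fac (biprod.inr_desc a p)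
  obtain ⟨δ, hT⟩ := hΦ.exact (shortExact_kernel (biprod.desc a p))
  -- As `Φ` kills `a`, the image of the inclusion of `K` lifts to the kernel of `(a, p)`. The
  -- numerator of a roof for this lift is a morphism of `C` into that kernel, so its two components
  -- express `e ≫ a` through `J`.
  obtain ⟨y, hy⟩ := DistTriang.lift₂ hT (Φ.map (biprod.inl : K ⟶ K ⊞ J)) (by
    rw [← Φ.map_comp, biprod.inl_desc, ha])
  obtain ⟨K', s, f, hs, hf⟩ := hroof y
  let ι := kernel.ι (biprod.desc a p)
  refine ⟨K', f ≫ ι ≫ biprod.fst, ?_, J, -(f ≫ ι ≫ biprod.snd), p, hJ, ?_⟩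
  · have : Φ.map (f ≫ ι ≫ biprod.fst) = Φ.map s := by
      rw [Φ.map_comp, ← hf, Category.assoc, Φ.map_comp ι, ← reassoc_of% hy, ← Φ.map_comp,
        biprod.inl_fst, Φ.map_id, Category.comp_id]
    rwa [this]
  · have h : ι ≫ biprod.desc a p = 0 := kernel.condition _
    rw [comp_desc_eq] at h
    have h' := f ≫= h
    rw [comp_zero, Preadditive.comp_add] at h'
    rw [zero_add, Preadditive.neg_comp, eq_neg_iff_add_eq_zero]
    simpa using h'

end ExactWithAcyclics

/-! ### Fullness and faithfulness of functors on a localisation. -/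

section Localization

variable {W : MorphismProperty C} (hW : ∀ ⦃K L : C⦄ (f : K ⟶ L), W f ↔ IsIso (Φ.map f))

include hW

/-- The graph `(1, i)` and the inclusion are both sections of the projection `K ⊞ J ⟶ K`, which the
localisation inverts, so they become equal. -/
lemma StablyEq.Q_map_eq (hΦ : ExactWithAcyclics Φ) {K L : C} {a b : K ⟶ L}
    (h : StablyEq Φ a b) : W.Q.map a = W.Q.map b := by
  obtain ⟨J, i, j, hJ, rfl⟩ := h
  have hfst : IsIso (W.Q.map (biprod.fst : K ⊞ J ⟶ K)) :=
    W.Q_inverts _ ((hW _).2 (hΦ.isIso_fst K hJ))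
  have h1 : W.Q.map (biprod.lift (𝟙 K) i) = W.Q.map biprod.inl := by
    rw [← cancel_mono (W.Q.map (biprod.fst : K ⊞ J ⟶ K)), ← Functor.map_comp, ← Functor.map_comp,
      biprod.lift_fst, biprod.inl_fst]
  have h2 := h1 =≫ W.Q.map (biprod.desc b j)
  rwa [← Functor.map_comp, ← Functor.map_comp, biprod.lift_desc, biprod.inl_desc,
    Category.id_comp] at h2

/-- Ore squares commute only up to maps through acyclics, but `Q` does not see the difference.
Fractions are therefore closed under composition and contain the generators of the localisation. -/
lemma exists_roof_Q (hΦ : ExactWithAcyclics Φ) {K L : C} (x : W.Q.obj K ⟶ W.Q.obj L) :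
    ∃ (K' : C) (s : K' ⟶ K) (f : K' ⟶ L), IsIso (Φ.map s) ∧ W.Q.map s ≫ x = W.Q.map f := by
  let good {K L : C} (x : W.Q.obj K ⟶ W.Q.obj L) : Prop :=
    ∃ (K' : C) (s : K' ⟶ K) (f : K' ⟶ L), IsIso (Φ.map s) ∧ W.Q.map s ≫ x = W.Q.map f
  have hcomp {K L M : C} (x : W.Q.obj K ⟶ W.Q.obj L) (y : W.Q.obj L ⟶ W.Q.obj M) (hx : good x)
      (hy : good y) : good (x ≫ y) := by
    obtain ⟨K₁, s₁, f₁, hs₁, hf₁⟩ := hx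
    obtain ⟨L₂, s₂, f₂, hs₂, hf₂⟩ := hy
    obtain ⟨N, t, f', ht, h'⟩ := hΦ.exists_square' s₂ f₁ hs₂
    refine ⟨N, t ≫ s₁, f' ≫ f₂, by rw [Φ.map_comp]; infer_instance, ?_⟩
    have h1 := h'.Q_map_eq hW hΦ
    rw [Functor.map_comp, Functor.map_comp] at h1
    rw [Functor.map_comp, Functor.map_comp, ← hf₂, reassoc_of% h1, ← reassoc_of% hf₁,
      Category.assoc]
  have hmap {K L : C} (f : K ⟶ L) : good (W.Q.map f) :=
    ⟨K, 𝟙 K, f, by rw [Φ.map_id]; infer_instance, by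
      rw [CategoryTheory.Functor.map_id, Category.id_comp]⟩
  let P : MorphismProperty W.Localization := fun X Y x =>
    good (K := (Localization.Construction.objEquiv W).symm X)
      (L := (Localization.Construction.objEquiv W).symm Y) x
  have hP : P.IsStableUnderComposition := ⟨fun x y hx hy => hcomp x y hx hy⟩
  have h := Localization.Construction.morphismProperty_eq_top P (fun K L f => hmap f)
    (fun K L s hs => ⟨K, s, 𝟙 K, (hW s).1 hs,
      (Localization.Construction.wIso s hs).hom_inv_id.trans
        (CategoryTheory.Functor.map_id _ _).symm⟩)
  have : P x := by rw [h]; trivial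
  exact this

variable {R : W.Localization ⥤ T} (e : W.Q ⋙ R ≅ Φ)

include e

lemma localization_full (hroof : ∀ ⦃K L : C⦄ (g : Φ.obj K ⟶ Φ.obj L), IsRoof Φ g) :
    R.Full := by
  refine ⟨fun {X Y} g => ?_⟩
  obtain ⟨K, rfl⟩ := (Localization.Construction.objEquiv W).surjective X
  obtain ⟨L, rfl⟩ := (Localization.Construction.objEquiv W).surjective Y
  change R.obj (W.Q.obj K) ⟶ R.obj (W.Q.obj L) at g
  obtain ⟨K', s, f, hs, hf⟩ := hroof (e.inv.app K ≫ g ≫ e.hom.app L)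
  have hs' : IsIso (W.Q.map s) := W.Q_inverts _ ((hW _).2 hs)
  have h1 : R.map (W.Q.map s) ≫ g = R.map (W.Q.map f) := by
    have h2 := e.hom.naturality s
    have h3 := e.hom.naturality f
    dsimp only [Functor.comp_map] at h2 h3
    rw [← cancel_mono (e.hom.app L)]
    refine Eq.trans ?_ h3.symm
    rw [← hf]
    erw [← reassoc_of% h2]
    simp
  have h4 : R.map (inv (W.Q.map s) ≫ W.Q.map f) = g := by
    rw [Functor.map_comp, ← h1, Functor.map_inv, IsIso.inv_hom_id_assoc]
  exact ⟨_, h4⟩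

/-- Over a common denominator, equality after `R` says that `Φ` kills the difference of the
numerators. The roof hypothesis is used here as well: it makes that difference stably zero after an
inverted morphism, hence zero under `Q`. -/
lemma localization_faithful (hΦ : ExactWithAcyclics Φ)
    (hroof : ∀ ⦃K L : C⦄ (g : Φ.obj K ⟶ Φ.obj L), IsRoof Φ g) : R.Faithful := by
  refine ⟨fun {X Y} x y hxy => ?_⟩
  obtain ⟨K, rfl⟩ := (Localization.Construction.objEquiv W).surjective X
  obtain ⟨L, rfl⟩ := (Localization.Construction.objEquiv W).surjective Y
  change (W.Q.obj K ⟶ W.Q.obj L) at x y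
  replace hxy : R.map (X := W.Q.obj K) (Y := W.Q.obj L) x = R.map y := hxy
  obtain ⟨K₁, s₁, f₁, hs₁, hf₁⟩ := exists_roof_Q hW hΦ x
  obtain ⟨K₂, s₂, f₂, hs₂, hf₂⟩ := exists_roof_Q hW hΦ y
  obtain ⟨N, t, t', ht, h⟩ := hΦ.exists_square' s₂ s₁ hs₂
  have h1 := h.Q_map_eq hW hΦ
  rw [Functor.map_comp, Functor.map_comp] at h1
  have h2 : W.Q.map t ≫ W.Q.map f₁ = W.Q.map t ≫ W.Q.map s₁ ≫ x := by rw [hf₁]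
  have h3 : W.Q.map t' ≫ W.Q.map f₂ = W.Q.map t ≫ W.Q.map s₁ ≫ y := by
    rw [← hf₂, ← Category.assoc, h1, Category.assoc]
  have h4 : R.map (W.Q.map (t ≫ f₁)) = R.map (W.Q.map (t' ≫ f₂)) := by
    rw [W.Q.map_comp, W.Q.map_comp, h2, h3, R.map_comp, R.map_comp, R.map_comp, R.map_comp, hxy]
  have h5 : Φ.map (t ≫ f₁ - t' ≫ f₂) = 0 := by
    rw [Φ.map_sub, sub_eq_zero, ← cancel_epi (e.hom.app N)]
    exact (e.hom.naturality _).symm.trans ((congrArg (· ≫ e.hom.app L) h4).trans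
      (e.hom.naturality _))
  obtain ⟨N', c, hc, J, i, j, hJ, hij⟩ := hΦ.exists_stablyEq_zero hroof _ h5
  have h6 : W.Q.map (c ≫ t ≫ f₁) = W.Q.map (c ≫ t' ≫ f₂) := by
    refine StablyEq.Q_map_eq hW hΦ ⟨J, i, j, hJ, ?_⟩
    rw [zero_add, Preadditive.comp_sub, sub_eq_iff_eq_add] at hij
    rw [hij, add_comm]
  have hc' : IsIso (W.Q.map c) := W.Q_inverts _ ((hW _).2 hc)
  have ht' : IsIso (W.Q.map t) := W.Q_inverts _ ((hW _).2 ht)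
  have hs' : IsIso (W.Q.map s₁) := W.Q_inverts _ ((hW _).2 hs₁)
  rw [Functor.map_comp, Functor.map_comp, Functor.map_comp, Functor.map_comp, h2, h3, cancel_epi,
    cancel_epi, cancel_epi] at h6
  exact h6

end Localization

end Roofs

/-! ### Dévissage of morphisms along a t-structure -/

section Slices

variable {C : Type*} [Category C] [Abelian C]
  {T : Type*} [Category T] [Preadditive T] [HasZeroObject T] [HasShift T ℤ]
  [∀ n : ℤ, (shiftFunctor T n).Additive] [Pretriangulated T]

/-- Conditions on a functor `Φ` from complexes to a triangulated category, and on the aisles `le n`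
and coaisles `ge n` of a t-structure, which ensure that all morphisms between objects `Φ K` are
roofs. -/
structure ProjectiveSlices (Φ : C ⥤ T) (le ge : ℤ → ObjectProperty T) : Prop where
  le_iso (n : ℤ) : (le n).IsClosedUnderIsomorphisms
  ge_iso (n : ℤ) : (ge n).IsClosedUnderIsomorphisms
  ge_mono {m n : ℤ} (h : m ≤ n) : ge n ≤ ge m
  ge_ext (n : ℤ) {A B D : T} {f : A ⟶ B} {g : B ⟶ D} {h : D ⟶ A⟦(1 : ℤ)⟧}
    (hT : Triangle.mk f g h ∈ distTriang T) (hA : ge n A) (hD : ge n D) : ge n B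
  hom_zero (n : ℤ) {A B : T} (f : A ⟶ B) (hA : le n A) (hB : ge (n + 1) B) : f = 0
  bounded (K : C) : ∃ a b : ℤ, ge a (Φ.obj K) ∧ le b (Φ.obj K)
  truncation (K : C) (n : ℤ) : ∃ (K' K'' : C) (f : K' ⟶ K) (g : K ⟶ K'') (w : f ≫ g = 0),
    (ShortComplex.mk f g w).ShortExact ∧ le n (Φ.obj K') ∧ ge (n + 1) (Φ.obj K'') ∧
    (∀ a, ge a (Φ.obj K) → ge a (Φ.obj K')) ∧ (∀ b, le b (Φ.obj K) → le b (Φ.obj K''))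
  isRoof (n : ℤ) {K L : C} (g : Φ.obj K ⟶ Φ.obj L) (hK : le n (Φ.obj K)) (hL : ge n (Φ.obj L)) :
    IsRoof Φ g
  exists_top (n : ℤ) (K : C) (hK : le n (Φ.obj K)) :
    ∃ (K₁ K' K'' : C) (s : K' ⟶ K) (f : K₁ ⟶ K') (g : K' ⟶ K'') (w : f ≫ g = 0),
      IsIso (Φ.map s) ∧ (ShortComplex.mk f g w).ShortExact ∧ ge n (Φ.obj K₁) ∧
      le (n - 1) (Φ.obj K'')
  exists_projective (n : ℤ) (K : C) (hl : le n (Φ.obj K)) (hg : ge n (Φ.obj K)) :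
    ∃ (P : C) (Z : T) (u : Φ.obj P ⟶ Φ.obj K) (v : Φ.obj K ⟶ Z) (h : Z ⟶ (Φ.obj P)⟦(1 : ℤ)⟧),
      Triangle.mk u v h ∈ distTriang T ∧ le n (Φ.obj P) ∧ ge (n - 1) Z ∧ le (n - 1) Z ∧
      ∀ (L : C) (f : Φ.obj P ⟶ Φ.obj L), le (n - 1) (Φ.obj L) → f = 0

namespace ProjectiveSlices

variable {Φ : C ⥤ T} [Φ.Additive] {le ge : ℤ → ObjectProperty T}
  (hs : ProjectiveSlices Φ le ge) (hΦ : ExactWithAcyclics Φ)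

include hs hΦ

/-- The aisle condition on `P` moves the target into `le n`. By projectivity only its top term in
degree `n` matters, and morphisms from `le n` to `ge n` are roofs by assumption. -/
lemma isRoof_of_projective (n : ℤ) {P L : C} (hP : le n (Φ.obj P))
    (hP' : ∀ (L : C) (f : Φ.obj P ⟶ Φ.obj L), le (n - 1) (Φ.obj L) → f = 0)
    (g : Φ.obj P ⟶ Φ.obj L) : IsRoof Φ g := by
  obtain ⟨L', L'', f, k, w, hS, hL', hL'', -, -⟩ := hs.truncation L n
  obtain ⟨δ, hT⟩ := hΦ.exact hS
  obtain ⟨y, rfl⟩ := DistTriang.lift₂ hT g (hs.hom_zero n _ hP hL'')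
  refine hΦ.isRoof_comp ?_ (isRoof_map f)
  obtain ⟨K₁, K', K'', s, f', k', w', hs', hS', hK₁, hK''⟩ := hs.exists_top n L' hL'
  obtain ⟨δ', hT'⟩ := hΦ.exact hS'
  obtain ⟨z, hz⟩ := DistTriang.lift₂ hT' (y ≫ inv (Φ.map s)) (hP' _ _ hK'')
  have h := hΦ.isRoof_comp (hΦ.isRoof_comp (hs.isRoof n z hP hK₁) (isRoof_map f')) (isRoof_map s)
  rwa [← hz, Category.assoc, IsIso.inv_hom_id, Category.comp_id] at h

/-- Induction on how far below `n` the target reaches. A projective presentation replaces `K` by the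
projective, which is settled, and by a cone one degree lower. -/
lemma isRoof_of_slice (d : ℕ) : ∀ (n : ℤ) {K L : C} (g : Φ.obj K ⟶ Φ.obj L), le n (Φ.obj K) →
    ge n (Φ.obj K) → ge (n - d) (Φ.obj L) → IsRoof Φ g := by
  induction d with
  | zero =>
    intro n K L g hK _ hL
    exact hs.isRoof n g hK (by simpa using hL)
  | succ d ih =>
    intro n K L g hl hg hL
    obtain ⟨P, Z, u, v, h, hT, hP, hZ, hZ', hP'⟩ := hs.exists_projective n K hl hg
    obtain ⟨P₁, r, f, hr, hf⟩ := hs.isRoof n u hP hg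
    -- The presentation exists only in `T`. Its roof numerator `f`, made a monomorphism by an
    -- acyclic summand, gives an actual short exact sequence in `C` with the same cone.
    obtain ⟨J, i, hi, hJ⟩ := hΦ.exists_mono P₁
    have : Mono (biprod.lift f i) := mono_of_mono_fac (biprod.lift_snd f i)
    have hS := shortExact_cokernel (biprod.lift f i)
    obtain ⟨δ, hTS⟩ := hΦ.exact hS
    have hinl := hΦ.isIso_inl K hJ
    have hfst := hΦ.isIso_fst K hJ
    obtain ⟨e⟩ := DistTriang.cone_iso hTS hT (asIso (Φ.map r))
      (asIso (Φ.map (biprod.fst : K ⊞ J ⟶ K))) (by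
        simp only [asIso_hom]
        rw [← Φ.map_comp, biprod.lift_fst, hf])
    have := hs.le_iso
    have := hs.ge_iso
    refine hΦ.isRoof_of_source biprod.inl hinl ?_ g
    refine hΦ.isRoof_devissage hS (fun φ => ?_) (fun L₁ N i' p w' hN ⟨e'⟩ φ => ?_)
    · exact hΦ.isRoof_of_source r hr
        (fun g => hs.isRoof_of_projective hΦ n hP hP' g) φ
    · obtain ⟨δ', hN'⟩ := hΦ.exact hN
      have hB := (ge (n - 1)).prop_of_iso e.symm hZ
      -- The cokernel sits in degree `n - 1`, while `N`, an extension of it by an object with the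
      -- image of `L`, still has lower bound `n - (d + 1)`: the gap has dropped by one.
      refine ih (n - 1) φ ((le _).prop_of_iso e.symm hZ') hB (hs.ge_ext _ hN' ?_ ?_)
      · refine (ge _).prop_of_iso e'.symm ?_
        convert hL using 1
        push_cast
        ring
      · exact hs.ge_mono (by lia) _ hB

lemma isRoof_of_amplitude (d : ℕ) : ∀ (n : ℤ) {K L : C} (g : Φ.obj K ⟶ Φ.obj L), le n (Φ.obj K) →
    ge (n - d) (Φ.obj K) → IsRoof Φ g := by
  have key (n : ℤ) {K L : C} (g : Φ.obj K ⟶ Φ.obj L) (hl : le n (Φ.obj K))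
      (hg : ge n (Φ.obj K)) : IsRoof Φ g := by
    obtain ⟨a, b, ha, hb⟩ := hs.bounded L
    exact hs.isRoof_of_slice hΦ (n - a).toNat n g hl hg (hs.ge_mono (by lia) _ ha)
  induction d with
  | zero =>
    intro n K L g hl hg
    exact key n g hl (by simpa using hg)
  | succ d ih =>
    intro n K L g hl hg
    obtain ⟨K', K'', f, k, w, hS, hK', hK'', h', h''⟩ := hs.truncation K (n - 1)
    refine hΦ.isRoof_devissage hS (fun φ => ?_) (fun L₁ N i' p w' hN _ φ => ?_) g
    · refine ih (n - 1) φ hK' (h' _ ?_)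
      convert hg using 1
      push_cast
      ring
    · exact key n φ (h'' _ hl) (by simpa using hK'')

theorem isRoof_of_all {K L : C} (g : Φ.obj K ⟶ Φ.obj L) : IsRoof Φ g := by
  obtain ⟨a, b, ha, hb⟩ := hs.bounded K
  exact hs.isRoof_of_amplitude hΦ (b - a).toNat b g hb (hs.ge_mono (by lia) _ ha)

end ProjectiveSlices

end Slices

/-! ### Bounded complexes -/

section Bounded

variable {A : Type*} [Category A] [Abelian A]

/-- Limits are degreewise, and a finite diagram has common bounds. Together with the dual this makes
bounded complexes an abelian category with exact inclusion. -/
instance isBoundedComplex_closedUnderLimits (J : Type) [SmallCategory J] [FinCategory J] :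
    (isBoundedComplex A).IsClosedUnderLimitsOfShape J where
  limitsOfShape_le := by
    rintro K ⟨p⟩
    choose a b ha hb using p.prop_diag_obj
    obtain ⟨m, hm⟩ := (Finset.univ.image a).bddBelow
    obtain ⟨n, hn⟩ := (Finset.univ.image b).bddAbove
    have key (i : ℤ) (h : ∀ j, IsZero ((p.diag.obj j).X i)) : IsZero (K.X i) := by
      rw [IsZero.iff_id_eq_zero]
      exact (isLimitOfPreserves (HomologicalComplex.eval _ _ i) p.isLimit).hom_ext
        (fun j => (h j).eq_of_tgt _ _)
    refine ⟨m, n, ?_, ?_⟩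
    · rw [CochainComplex.isStrictlyGE_iff]
      exact fun i hi => key i (fun j => (p.diag.obj j).isZero_of_isStrictlyGE (a j) i
        (lt_of_lt_of_le hi (hm (Finset.mem_coe.2 (Finset.mem_image_of_mem a (Finset.mem_univ j))))))
    · rw [CochainComplex.isStrictlyLE_iff]
      exact fun i hi => key i (fun j => (p.diag.obj j).isZero_of_isStrictlyLE (b j) i
        (lt_of_le_of_lt (hn (Finset.mem_coe.2 (Finset.mem_image_of_mem b (Finset.mem_univ j)))) hi))

instance isBoundedComplex_closedUnderColimits (J : Type) [SmallCategory J] [FinCategory J] :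
    (isBoundedComplex A).IsClosedUnderColimitsOfShape J where
  colimitsOfShape_le := by
    rintro K ⟨p⟩
    choose a b ha hb using p.prop_diag_obj
    obtain ⟨m, hm⟩ := (Finset.univ.image a).bddBelow
    obtain ⟨n, hn⟩ := (Finset.univ.image b).bddAbove
    have key (i : ℤ) (h : ∀ j, IsZero ((p.diag.obj j).X i)) : IsZero (K.X i) := by
      rw [IsZero.iff_id_eq_zero]
      exact (isColimitOfPreserves (HomologicalComplex.eval _ _ i) p.isColimit).hom_ext
        (fun j => (h j).eq_of_src _ _)
    refine ⟨m, n, ?_, ?_⟩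
    · rw [CochainComplex.isStrictlyGE_iff]
      exact fun i hi => key i (fun j => (p.diag.obj j).isZero_of_isStrictlyGE (a j) i
        (lt_of_lt_of_le hi (hm (Finset.mem_coe.2 (Finset.mem_image_of_mem a (Finset.mem_univ j))))))
    · rw [CochainComplex.isStrictlyLE_iff]
      exact fun i hi => key i (fun j => (p.diag.obj j).isZero_of_isStrictlyLE (b j) i
        (lt_of_le_of_lt (hn (Finset.mem_coe.2 (Finset.mem_image_of_mem b (Finset.mem_univ j)))) hi))

instance : HasFiniteLimits (BoundedComplex A) where out J _ _ := by infer_instance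
instance : HasFiniteColimits (BoundedComplex A) where out J _ _ := by infer_instance
instance : PreservesFiniteLimits (isBoundedComplex A).ι where preservesFiniteLimits J _ _ := by infer_instance
instance : PreservesFiniteColimits (isBoundedComplex A).ι where preservesFiniteColimits J _ _ := by infer_instance

instance : (isBoundedComplex A).IsClosedUnderKernels where
  kernels_le := by
    rintro _ ⟨f, k, hk, hX, hY⟩
    exact (isBoundedComplex A).prop_of_isLimit hk (by rintro (_ | _); exacts [hX, hY])

instance : (isBoundedComplex A).IsClosedUnderCokernels where
  cokernels_le := by
    rintro _ ⟨f, k, hk, hX, hY⟩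
    exact (isBoundedComplex A).prop_of_isColimit hk (by rintro (_ | _); exacts [hX, hY])

instance : (isBoundedComplex A).IsClosedUnderFiniteProducts where
  isClosedUnderLimitsOfShape J _ := by
    have := Fintype.ofFinite J
    classical
    exact isBoundedComplex_closedUnderLimits (Discrete J)

instance : Abelian (BoundedComplex A) where

namespace BoundedComplex

lemma shortExact_iff {K₁ K₂ K₃ : BoundedComplex A} {f : K₁ ⟶ K₂} {g : K₂ ⟶ K₃} {w : f ≫ g = 0}
    {w' : f.hom ≫ g.hom = 0} :
    (ShortComplex.mk f.hom g.hom w').ShortExact ↔ (ShortComplex.mk f g w).ShortExact :=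
  ShortExact.shortExact_map_iff (S := ShortComplex.mk f g w) (isBoundedComplex A).ι

/-- The contractible complex whose `n`-th term is `Y n ⊞ Y (n + 1)`. -/
noncomputable def contractible (Y : ℤ → A) : CochainComplex A ℤ :=
  CochainComplex.of (fun n => Y n ⊞ Y (n + 1)) (fun _ => biprod.snd ≫ biprod.inl) (by simp)

lemma contractible_d (Y : ℤ → A) (n : ℤ) :
    (contractible Y).d n (n + 1) = biprod.snd ≫ biprod.inl :=
  CochainComplex.of_d (fun n => Y n ⊞ Y (n + 1)) (fun _ => biprod.snd ≫ biprod.inl) n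

lemma contractible_acyclic (Y : ℤ → A) : (contractible Y).Acyclic := by
  intro n
  obtain ⟨m, rfl⟩ : ∃ m, n = m + 1 := ⟨n - 1, by ring⟩
  rw [HomologicalComplex.exactAt_iff' _ m (m + 1) (m + 1 + 1) (by simp) (by simp),
    ShortComplex.exact_iff_exact_up_to_refinements]
  intro B x hx
  have key (x : B ⟶ Y (m + 1) ⊞ Y (m + 1 + 1)) (hx : x ≫ biprod.snd ≫
      (biprod.inl : Y (m + 1 + 1) ⟶ _ ⊞ Y (m + 1 + 1 + 1)) = 0) :
      𝟙 B ≫ x = (x ≫ biprod.fst ≫ (biprod.inr : _ ⟶ Y m ⊞ _)) ≫ biprod.snd ≫ biprod.inl := by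
    have h1 : x ≫ biprod.snd = 0 := zero_of_comp_mono
      (biprod.inl : Y (m + 1 + 1) ⟶ _ ⊞ Y (m + 1 + 1 + 1)) (by rw [Category.assoc, hx])
    have h2 := x ≫= biprod.total
    rw [Preadditive.comp_add, reassoc_of% h1, zero_comp, add_zero, Category.comp_id] at h2
    simp [h2]
  exact ⟨B, 𝟙 B, inferInstance, _, (key x ((congrArg (fun k => x ≫ k)
    (contractible_d Y (m + 1)).symm).trans hx)).trans
      (congrArg (fun k => _ ≫ k) (contractible_d Y m).symm)⟩

lemma contractible_bounded (Y : ℤ → A) (a b : ℤ) (ha : ∀ n < a, IsZero (Y n))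
    (hb : ∀ n, b < n → IsZero (Y n)) : isBoundedComplex A (contractible Y) := by
  refine ⟨a - 1, b, ?_, ?_⟩
  · rw [CochainComplex.isStrictlyGE_iff]
    exact fun i hi => (biprod_isZero_iff _ _).2 ⟨ha _ (by lia), ha _ (by lia)⟩
  · rw [CochainComplex.isStrictlyLE_iff]
    exact fun i hi => (biprod_isZero_iff _ _).2 ⟨hb _ (by lia), hb _ (by lia)⟩

/-- The embedding `(1, d)` into a contractible complex built from the terms of `K`, which is bounded
because `K` is. -/
lemma exists_mono_acyclic (K : BoundedComplex A) :
    ∃ (J : BoundedComplex A) (i : K ⟶ J), Mono i ∧ J.obj.Acyclic := by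
  obtain ⟨a, b, _, _⟩ := K.property
  let i : K.obj ⟶ contractible K.obj.X :=
    { f n := biprod.lift (𝟙 _) (K.obj.d n (n + 1))
      comm' := by
        rintro n _ rfl
        have h : biprod.lift (𝟙 (K.obj.X n)) (K.obj.d n (n + 1)) ≫ biprod.snd ≫ biprod.inl =
            K.obj.d n (n + 1) ≫ biprod.lift (𝟙 _) (K.obj.d (n + 1) (n + 1 + 1)) := by
          ext <;> simp
        exact (congrArg (fun k => _ ≫ k) (contractible_d _ _)).trans h }
  have hi : Mono i := by
    have (n : ℤ) : Mono (i.f n) := mono_of_mono_fac (biprod.lift_fst _ _)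
    exact HomologicalComplex.mono_of_mono_f _ this
  refine ⟨⟨contractible K.obj.X, contractible_bounded _ a b
    (fun n hn => K.obj.isZero_of_isStrictlyGE a n) (fun n hn => K.obj.isZero_of_isStrictlyLE b n)⟩,
    ObjectProperty.homMk i, (isBoundedComplex A).ι.mono_of_mono_map hi, contractible_acyclic _⟩

lemma exists_epi_acyclic (K : BoundedComplex A) :
    ∃ (J : BoundedComplex A) (p : J ⟶ K), Epi p ∧ J.obj.Acyclic := by
  obtain ⟨a, b, _, _⟩ := K.property
  -- The index shift puts `K.obj.X n` into the second summand in degree `n`, so that `(d, 1)` is an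
  -- epimorphism in every degree.
  let Y : ℤ → A := fun n => K.obj.X (n - 1)
  let p : contractible Y ⟶ K.obj :=
    { f n := biprod.desc (K.obj.d (n - 1) n) (K.obj.XIsoOfEq (by ring : n + 1 - 1 = n)).hom
      comm' := by
        rintro n _ rfl
        have h : biprod.desc (K.obj.d (n - 1) n)
            (K.obj.XIsoOfEq (by ring : n + 1 - 1 = n)).hom ≫
            K.obj.d n (n + 1) = (biprod.snd ≫ biprod.inl) ≫
              biprod.desc (K.obj.d (n + 1 - 1) (n + 1))
                (K.obj.XIsoOfEq (by ring : n + 1 + 1 - 1 = n + 1)).hom := by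
          ext <;> simp
        exact h.trans (congrArg (fun k => k ≫ biprod.desc (K.obj.d (n + 1 - 1) (n + 1)) _)
          (contractible_d Y n)).symm }
  have hp : Epi p := by
    have (n : ℤ) : Epi (p.f n) := epi_of_epi_fac (biprod.inr_desc _ _)
    exact HomologicalComplex.epi_of_epi_f _ this
  refine ⟨⟨contractible Y, contractible_bounded _ (a + 1) (b + 1)
    (fun n hn => K.obj.isZero_of_isStrictlyGE a _)
    (fun n hn => K.obj.isZero_of_isStrictlyLE b _)⟩,
    ObjectProperty.homMk p, (isBoundedComplex A).ι.epi_of_epi_map hp, contractible_acyclic _⟩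

end BoundedComplex

lemma quasiIso_of_acyclic_X₁ {ι : Type*} {c : ComplexShape ι}
    {S : ShortComplex (HomologicalComplex A c)} (hS : S.ShortExact) (h : S.X₁.Acyclic) :
    QuasiIso S.g := by
  refine ⟨fun i => ?_⟩
  rw [quasiIsoAt_iff_isIso_homologyMap]
  have h1 : Mono (HomologicalComplex.homologyMap S.g i) :=
    (hS.homology_exact₂ i).mono_g ((h i).isZero_homology.eq_of_src _ _)
  have h2 : Epi (HomologicalComplex.homologyMap S.g i) := by
    by_cases hi : ∃ j, c.Rel i j
    · obtain ⟨j, hj⟩ := hi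
      exact (hS.homology_exact₃ i j hj).epi_f ((h j).isZero_homology.eq_of_tgt _ _)
    · have := hS.epi_g
      exact HomologicalComplex.epi_homologyMap_of_epi_of_not_rel _ _ (by simpa using hi)
  exact isIso_of_mono_of_epi _

lemma quasiIso_of_acyclic_X₃ {S : ShortComplex (CochainComplex A ℤ)} (hS : S.ShortExact)
    (h : S.X₃.Acyclic) : QuasiIso S.f := by
  refine ⟨fun i => ?_⟩
  rw [quasiIsoAt_iff_isIso_homologyMap]
  have h1 : Mono (HomologicalComplex.homologyMap S.f i) :=
    (hS.homology_exact₁ (i - 1) i (by simp)).mono_g ((h _).isZero_homology.eq_of_src _ _)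
  have h2 : Epi (HomologicalComplex.homologyMap S.f i) :=
    (hS.homology_exact₂ i).epi_f ((h i).isZero_homology.eq_of_tgt _ _)
  exact isIso_of_mono_of_epi _

lemma isIso_πTruncGE_f {ι ι' : Type*} {c : ComplexShape ι} {c' : ComplexShape ι'}
    (K : HomologicalComplex A c') (e : c.Embedding c') [e.IsTruncGE] {i : ι} {i' : ι'}
    (hi : e.f i = i') (h : ¬ e.BoundaryGE i) : IsIso ((K.πTruncGE e).f i') := by
  exact (e.isIso_liftExtend_f_iff (K.restrictionToTruncGE' e) _ hi).2
    (K.isIso_restrictionToTruncGE' e i h)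

lemma isIso_ιTruncLE_f (K : CochainComplex A ℤ) {n i : ℤ} (hi : i < n) :
    IsIso ((K.ιTruncLE n).f i) := by
  have h : IsIso ((K.op.πTruncGE (ComplexShape.embeddingUpIntLE n).op).f i) := by
    -- The embedding sends `k` to `n - k`; since `i < n`, the index used is not the boundary index
    -- `0`.
    refine isIso_πTruncGE_f _ (ComplexShape.embeddingUpIntLE n).op (i := (n - i).natAbs) ?_ ?_
    · change n - ((n - i).natAbs : ℤ) = i
      lia
    · rw [ComplexShape.Embedding.op_boundaryGE_iff, ComplexShape.boundaryLE_embeddingUpIntLE_iff,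
        Int.natAbs_eq_zero]
      lia
  exact inferInstanceAs (IsIso ((K.op.πTruncGE (ComplexShape.embeddingUpIntLE n).op).f i).unop)

namespace BoundedComplex

/-- The canonical truncation in degrees `≤ n`. -/
noncomputable def truncLE (K : BoundedComplex A) (n : ℤ) : BoundedComplex A where
  obj := K.obj.truncLE n
  property := by
    obtain ⟨a, b, _, _⟩ := K.property
    exact ⟨a, n, inferInstance, inferInstance⟩

/-- The canonical truncation in degrees `≥ n`. -/
noncomputable def truncGE (K : BoundedComplex A) (n : ℤ) : BoundedComplex A where
  obj := K.obj.truncGE n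
  property := by
    obtain ⟨a, b, _, _⟩ := K.property
    exact ⟨n, b, inferInstance, inferInstance⟩

/-- The quotient of `K` by its canonical truncation in degrees `≤ n`. -/
noncomputable def quotTruncLE (K : BoundedComplex A) (n : ℤ) : BoundedComplex A where
  obj := (K.obj.shortComplexTruncLE n).X₃
  property := (isBoundedComplex A).prop_cokernel (K.obj.ιTruncLE n) (K.truncLE n).property
    K.property

/-- The inclusion of the canonical truncation. -/
noncomputable def ιLE (K : BoundedComplex A) (n : ℤ) : K.truncLE n ⟶ K :=
  ObjectProperty.homMk (K.obj.ιTruncLE n)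

/-- The projection to the canonical truncation. -/
noncomputable def πGE (K : BoundedComplex A) (n : ℤ) : K ⟶ K.truncGE n :=
  ObjectProperty.homMk (K.obj.πTruncGE n)

/-- The projection to the quotient by the canonical truncation. -/
noncomputable def πQuot (K : BoundedComplex A) (n : ℤ) : K ⟶ K.quotTruncLE n :=
  ObjectProperty.homMk (K.obj.shortComplexTruncLE n).g

/-- The quasi-isomorphism from the quotient by the canonical truncation in degrees `≤ n` to the
canonical truncation in degrees `≥ n + 1`. -/
noncomputable def quotToGE (K : BoundedComplex A) (n : ℤ) : K.quotTruncLE n ⟶ K.truncGE (n + 1) :=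
  ObjectProperty.homMk (K.obj.shortComplexTruncLEX₃ToTruncGE n (n + 1))

lemma πQuot_quotToGE (K : BoundedComplex A) (n : ℤ) : K.πQuot n ≫ K.quotToGE n = K.πGE (n + 1) := by
  ext1
  exact K.obj.g_shortComplexTruncLEX₃ToTruncGE n (n + 1) rfl

lemma quasiIso_quotToGE (K : BoundedComplex A) (n : ℤ) : QuasiIso (K.quotToGE n).hom :=
  inferInstanceAs (QuasiIso (HomologicalComplex.shortComplexTruncLEX₃ToTruncGE K.obj
    (ComplexShape.Embedding.embeddingUpInt_areComplementary n (n + 1) rfl)))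

lemma ιLE_πQuot (K : BoundedComplex A) (n : ℤ) : K.ιLE n ≫ K.πQuot n = 0 := by
  ext1
  exact (K.obj.shortComplexTruncLE n).zero

lemma shortExact_truncLE (K : BoundedComplex A) (n : ℤ) :
    (ShortComplex.mk (K.ιLE n) (K.πQuot n) (K.ιLE_πQuot n)).ShortExact :=
  shortExact_iff.1 (K.obj.shortComplexTruncLE_shortExact n)

/-- The property of being concentrated in degree `n`. -/
def IsConcentrated (K : BoundedComplex A) (n : ℤ) : Prop :=
  K.obj.IsStrictlyGE n ∧ K.obj.IsStrictlyLE n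

lemma isZero_of_isZero_X (K : BoundedComplex A) (h : ∀ i, IsZero (K.obj.X i)) : IsZero K := by
  rw [IsZero.iff_id_eq_zero]
  ext i
  exact (h i).eq_of_src _ _

lemma isZero_X {K : BoundedComplex A} (h : IsZero K) (i : ℤ) : IsZero (K.obj.X i) :=
  ((isBoundedComplex A).ι ⋙ HomologicalComplex.eval A _ i).map_isZero h

/-- A bounded complex vanishing above degree `n` has a subcomplex concentrated in degree `n` whose
quotient vanishes above degree `n - 1`. -/
lemma exists_sub_top (K : BoundedComplex A) (n : ℤ) (hK : K.obj.IsStrictlyLE n) :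
    ∃ (K₁ K₂ : BoundedComplex A) (f : K₁ ⟶ K) (g : K ⟶ K₂) (w : f ≫ g = 0),
      (ShortComplex.mk f g w).ShortExact ∧ K₁.IsConcentrated n ∧ K₂.obj.IsStrictlyLE (n - 1) ∧
      ∀ a, K.obj.IsStrictlyGE a → K₂.obj.IsStrictlyGE a := by
  let S : BoundedComplex A := ⟨(HomologicalComplex.single A (ComplexShape.up ℤ) n).obj (K.obj.X n),
    ⟨n, n, inferInstance, inferInstance⟩⟩
  let f' : S.obj ⟶ K.obj := HomologicalComplex.mkHomFromSingle (𝟙 _)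
    (fun k hk => (K.obj.isZero_of_isStrictlyLE n k (by
      have : n + 1 = k := hk
      lia)).eq_of_tgt _ _)
  have hf' : f'.f n = _ := HomologicalComplex.mkHomFromSingle_f _ _
  let f : S ⟶ K := ObjectProperty.homMk f'
  have hf : IsIso (f.hom.f n) := by
    change IsIso (f'.f n)
    rw [hf']
    infer_instance
  have hm : Mono f := by
    have (i : ℤ) : Mono (f.hom.f i) := by
      by_cases hi : i = n
      · subst hi; infer_instance
      · have h0 : IsZero (S.obj.X i) := HomologicalComplex.isZero_single_obj_X _ _ _ _ hi
        exact ⟨fun _ _ _ => h0.eq_of_tgt _ _⟩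
    exact (isBoundedComplex A).ι.mono_of_mono_map (HomologicalComplex.mono_of_mono_f f.hom this)
  have hS := shortExact_cokernel f
  have hSi (i : ℤ) := hS.map_of_exact ((isBoundedComplex A).ι ⋙ HomologicalComplex.eval A _ i)
  refine ⟨S, cokernel f, f, cokernel.π f, _, hS, ⟨inferInstance, inferInstance⟩, ?_, ?_⟩
  · rw [CochainComplex.isStrictlyLE_iff]
    intro i hi
    have : Epi ((cokernel.π f).hom.f i) := (hSi i).epi_g
    by_cases hin : i = n
    · subst hin
      rw [IsZero.iff_id_eq_zero, ← cancel_epi ((cokernel.π f).hom.f i), comp_zero,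
        Category.comp_id, ← cancel_epi (f.hom.f i), comp_zero]
      exact ((ShortComplex.mk f (cokernel.π f) (cokernel.condition f)).map
        ((isBoundedComplex A).ι ⋙ HomologicalComplex.eval A _ i)).zero
    · exact IsZero.of_epi ((cokernel.π f).hom.f i) (K.obj.isZero_of_isStrictlyLE n i (by lia))
  · intro a ha
    rw [CochainComplex.isStrictlyGE_iff]
    intro i hi
    have : Epi ((cokernel.π f).hom.f i) := (hSi i).epi_g
    exact IsZero.of_epi ((cokernel.π f).hom.f i) (K.obj.isZero_of_isStrictlyGE a i hi)

/-- A bounded complex vanishing below degree `n` has a quotient concentrated in degree `n` such that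
the kernel vanishes below degree `n + 1`. -/
lemma exists_quot_bottom (K : BoundedComplex A) (n : ℤ) (hK : K.obj.IsStrictlyGE n) :
    ∃ (K₁ K₂ : BoundedComplex A) (f : K₁ ⟶ K) (g : K ⟶ K₂) (w : f ≫ g = 0),
      (ShortComplex.mk f g w).ShortExact ∧ K₂.IsConcentrated n ∧
      K₁.obj.IsStrictlyGE (n + 1) ∧ ∀ b, K.obj.IsStrictlyLE b → K₁.obj.IsStrictlyLE b := by
  let S : BoundedComplex A := ⟨(HomologicalComplex.single A (ComplexShape.up ℤ) n).obj (K.obj.X n),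
    ⟨n, n, inferInstance, inferInstance⟩⟩
  let f' : K.obj ⟶ S.obj := HomologicalComplex.mkHomToSingle (𝟙 _)
    (fun k hk => (K.obj.isZero_of_isStrictlyGE n k (by
      have : k + 1 = n := hk
      lia)).eq_of_src _ _)
  have hf' : f'.f n = _ := HomologicalComplex.mkHomToSingle_f _ _
  let f : K ⟶ S := ObjectProperty.homMk f'
  have hf : IsIso (f.hom.f n) := by
    change IsIso (f'.f n)
    rw [hf']
    infer_instance
  have hm : Epi f := by
    have (i : ℤ) : Epi (f.hom.f i) := by
      by_cases hi : i = n
      · subst hi; infer_instance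
      · have h0 : IsZero (S.obj.X i) := HomologicalComplex.isZero_single_obj_X _ _ _ _ hi
        exact ⟨fun _ _ _ => h0.eq_of_src _ _⟩
    exact (isBoundedComplex A).ι.epi_of_epi_map (HomologicalComplex.epi_of_epi_f f.hom this)
  have hS := shortExact_kernel f
  have hSi (i : ℤ) := hS.map_of_exact ((isBoundedComplex A).ι ⋙ HomologicalComplex.eval A _ i)
  refine ⟨kernel f, S, kernel.ι f, f, _, hS, ⟨inferInstance, inferInstance⟩, ?_, ?_⟩
  · rw [CochainComplex.isStrictlyGE_iff]
    intro i hi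
    have : Mono ((kernel.ι f).hom.f i) := (hSi i).mono_f
    by_cases hin : i = n
    · subst hin
      rw [IsZero.iff_id_eq_zero, ← cancel_mono ((kernel.ι f).hom.f i), zero_comp,
        Category.id_comp, ← cancel_mono (f.hom.f i), zero_comp]
      exact ((ShortComplex.mk (kernel.ι f) f (kernel.condition f)).map
        ((isBoundedComplex A).ι ⋙ HomologicalComplex.eval A _ i)).zero
    · exact IsZero.of_mono ((kernel.ι f).hom.f i) (K.obj.isZero_of_isStrictlyGE n i (by lia))
  · intro a ha
    rw [CochainComplex.isStrictlyLE_iff]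
    intro i hi
    have : Mono ((kernel.ι f).hom.f i) := (hSi i).mono_f
    exact IsZero.of_mono ((kernel.ι f).hom.f i) (K.obj.isZero_of_isStrictlyLE a i hi)

end BoundedComplex

end Bounded

/-! ### Functors on bounded complexes which realise the heart of a t-structure -/

section TStructureTriangles

variable {T : Type*} [Category T] [Preadditive T] [HasZeroObject T] [HasShift T ℤ]
  [∀ n : ℤ, (shiftFunctor T n).Additive] [Pretriangulated T] (t : TStructure T)
  {A B D : T} {f : A ⟶ B} {g : B ⟶ D} {h : D ⟶ A⟦(1 : ℤ)⟧}

namespace DistTriang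

lemma isLE₃ (hT : Triangle.mk f g h ∈ distTriang T) (n : ℤ) (hA : t.IsLE A (n + 1))
    (hB : t.IsLE B n) : t.IsLE D n :=
  t.isLE₂ _ (rot_of_distTriang _ hT) n hB (t.isLE_shift A (n + 1) 1 n)

lemma isGE₃ (hT : Triangle.mk f g h ∈ distTriang T) (n : ℤ) (hA : t.IsGE A (n + 1))
    (hB : t.IsGE B n) : t.IsGE D n :=
  t.isGE₂ _ (rot_of_distTriang _ hT) n hB (t.isGE_shift A (n + 1) 1 n)

lemma isGE₁ (hT : Triangle.mk f g h ∈ distTriang T) (n : ℤ) (hB : t.IsGE B n)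
    (hD : t.IsGE D (n - 1)) : t.IsGE A n :=
  t.isGE₂ _ (inv_rot_of_distTriang _ hT) n (t.isGE_shift D (n - 1) (-1) n) hB

lemma isLE₁ (hT : Triangle.mk f g h ∈ distTriang T) (n : ℤ) (hB : t.IsLE B n)
    (hD : t.IsLE D (n - 1)) : t.IsLE A n :=
  t.isLE₂ _ (inv_rot_of_distTriang _ hT) n (t.isLE_shift D (n - 1) (-1) n) hB

end DistTriang

end TStructureTriangles

lemma quasiIso_of_acyclic {C ι : Type*} [Category C] [Abelian C] {c : ComplexShape ι}
    {K L : HomologicalComplex C c} (hK : K.Acyclic) (hL : L.Acyclic) (f : K ⟶ L) : QuasiIso f :=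
  ⟨fun i => (quasiIsoAt_iff_exactAt f i (hK i)).2 (hL i)⟩

section RealisesHeart

variable {A : Type*} [Category A] [Abelian A]
  {T : Type*} [Category T] [Preadditive T] [HasZeroObject T] [HasShift T ℤ]
  [∀ n : ℤ, (shiftFunctor T n).Additive] [Pretriangulated T]

/-- The conditions on a functor from bounded complexes to a triangulated category with a t-structure
which make it behave like a realisation functor. -/
structure RealisesHeart (t : TStructure T) (Φ : BoundedComplex A ⥤ T) : Prop where
  exact {X₁ X₂ X₃ : BoundedComplex A} {f : X₁ ⟶ X₂} {g : X₂ ⟶ X₃} {w : f ≫ g = 0}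
    (hS : (ShortComplex.mk f g w).ShortExact) :
    ∃ h, Triangle.mk (Φ.map f) (Φ.map g) h ∈ distTriang T
  isZero_of_isIso_d (K : BoundedComplex A) (n : ℤ) (hg : K.obj.IsStrictlyGE n)
    (hl : K.obj.IsStrictlyLE (n + 1)) (hd : IsIso (K.obj.d n (n + 1))) : IsZero (Φ.obj K)
  isLE_of_isConcentrated {K : BoundedComplex A} {n : ℤ} (hK : K.IsConcentrated n) :
    t.IsLE (Φ.obj K) n
  isGE_of_isConcentrated {K : BoundedComplex A} {n : ℤ} (hK : K.IsConcentrated n) :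
    t.IsGE (Φ.obj K) n
  bijective {K L : BoundedComplex A} {n : ℤ} (hK : K.IsConcentrated n) (hL : L.IsConcentrated n) :
    Function.Bijective (fun f : K ⟶ L => Φ.map f)
  exists_iso (n : ℤ) (Y : T) (hl : t.IsLE Y n) (hg : t.IsGE Y n) :
    ∃ K : BoundedComplex A, K.IsConcentrated n ∧ Nonempty (Φ.obj K ≅ Y)

namespace RealisesHeart

open BoundedComplex

variable {t : TStructure T} {Φ : BoundedComplex A ⥤ T} [Φ.Additive] (hΦ : RealisesHeart t Φ)

include hΦ

lemma isZero_of_isZero_X (K : BoundedComplex A) (h : ∀ i, IsZero (K.obj.X i)) :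
    IsZero (Φ.obj K) :=
  Φ.map_isZero (K.isZero_of_isZero_X h)

/-- Induction on the length. Canonical truncation just below the top degree leaves an acyclic
quotient with two terms, whose differential is then invertible, and such complexes die by
assumption. -/
lemma isZero_of_acyclic_aux (d : ℕ) : ∀ (a : ℤ) (K : BoundedComplex A), K.obj.IsStrictlyGE a →
    K.obj.IsStrictlyLE (a + d - 1) → K.obj.Acyclic → IsZero (Φ.obj K) := by
  induction d with
  | zero =>
    intro a K hg hl _
    refine hΦ.isZero_of_isZero_X K (fun i => ?_)
    by_cases hi : i < a
    · exact K.obj.isZero_of_isStrictlyGE a i hi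
    · exact K.obj.isZero_of_isStrictlyLE (a + (0 : ℕ) - 1) i (by push_cast; lia)
  | succ d ih =>
    intro a K hg hl hK
    let b := a + d - 1
    have hb : K.obj.IsStrictlyLE (b + 1) := by
      convert hl using 1
      push_cast
      lia
    have hS := K.shortExact_truncLE b
    obtain ⟨δ, hT⟩ := hΦ.exact hS
    have h1 : (K.truncLE b).obj.Acyclic := hK.truncLE _
    have h2 : (K.quotTruncLE b).obj.Acyclic := 
      (K.obj.shortComplexTruncLE_shortExact b).acyclic_X₃
        (quasiIso_of_acyclic h1 hK (K.ιLE b).hom)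
    have hgi (i : ℤ) : Epi ((K.πQuot b).hom.f i) :=
      (hS.map_of_exact ((isBoundedComplex A).ι ⋙ HomologicalComplex.eval A _ i)).epi_g
    have hwi (i : ℤ) : (K.ιLE b).hom.f i ≫ (K.πQuot b).hom.f i = 0 :=
      ((ShortComplex.mk _ _ (K.ιLE_πQuot b)).map
        ((isBoundedComplex A).ι ⋙ HomologicalComplex.eval A _ i)).zero
    have hGE : (K.quotTruncLE b).obj.IsStrictlyGE b := by
      rw [CochainComplex.isStrictlyGE_iff]
      intro i hi
      have : IsIso ((K.ιLE b).hom.f i) := isIso_ιTruncLE_f K.obj hi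
      rw [IsZero.iff_id_eq_zero, ← cancel_epi ((K.πQuot b).hom.f i), comp_zero, Category.comp_id,
        ← cancel_epi ((K.ιLE b).hom.f i), comp_zero, hwi]
    have hLE : (K.quotTruncLE b).obj.IsStrictlyLE (b + 1) := by
      rw [CochainComplex.isStrictlyLE_iff]
      intro i hi
      exact IsZero.of_epi ((K.πQuot b).hom.f i) (K.obj.isZero_of_isStrictlyLE (b + 1) i hi)
    have hd : IsIso ((K.quotTruncLE b).obj.d b (b + 1)) := by
      have hm := (HomologicalComplex.exactAt_iff' _ (b - 1) b (b + 1) (by simp) (by simp)).1 (h2 b)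
      have he := (HomologicalComplex.exactAt_iff' _ b (b + 1) (b + 1 + 1) (by simp) (by simp)).1
        (h2 (b + 1))
      have : Mono ((K.quotTruncLE b).obj.d b (b + 1)) :=
        hm.mono_g ((CochainComplex.isZero_of_isStrictlyGE _ b (b - 1) (by lia)).eq_of_src _ _)
      have : Epi ((K.quotTruncLE b).obj.d b (b + 1)) :=
        he.epi_f ((CochainComplex.isZero_of_isStrictlyLE _ (b + 1) (b + 1 + 1) (by lia)).eq_of_tgt _ _)
      exact isIso_of_mono_of_epi _
    refine DistTriang.isZero₂ hT (ih a _ ?_ ?_ h1) (hΦ.isZero_of_isIso_d _ b hGE hLE hd)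
    · exact inferInstanceAs ((K.obj.truncLE b).IsStrictlyGE a)
    · exact inferInstanceAs ((K.obj.truncLE b).IsStrictlyLE b)

lemma isZero_of_acyclic (K : BoundedComplex A) (hK : K.obj.Acyclic) : IsZero (Φ.obj K) := by
  obtain ⟨a, b, ha, hb⟩ := K.property
  exact hΦ.isZero_of_acyclic_aux (b + 1 - a).toNat a K ha
    (K.obj.isStrictlyLE_of_le b (a + (b + 1 - a).toNat - 1) (by lia)) hK

lemma exactWithAcyclics : ExactWithAcyclics Φ where
  exact := hΦ.exact
  exists_epi K := by
    obtain ⟨J, p, hp, hJ⟩ := K.exists_epi_acyclic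
    exact ⟨J, p, hp, hΦ.isZero_of_acyclic J hJ⟩
  exists_mono K := by
    obtain ⟨J, i, hi, hJ⟩ := K.exists_mono_acyclic
    exact ⟨J, i, hi, hΦ.isZero_of_acyclic J hJ⟩

/-- Peel off the top term by brutal truncation. Here `d` counts the degrees in which `K` may be
non-zero, so the induction starts at the zero complex. -/
lemma amplitude_aux (d : ℕ) : ∀ (b : ℤ) (K : BoundedComplex A), K.obj.IsStrictlyLE b →
    K.obj.IsStrictlyGE (b + 1 - d) → t.IsLE (Φ.obj K) b ∧ t.IsGE (Φ.obj K) (b + 1 - d) := by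
  induction d with
  | zero =>
    intro b K hl hg
    have h0 : IsZero (Φ.obj K) := by
      refine hΦ.isZero_of_isZero_X K (fun i => ?_)
      by_cases hi : b < i
      · exact K.obj.isZero_of_isStrictlyLE b i hi
      · exact K.obj.isZero_of_isStrictlyGE (b + 1 - (0 : ℕ)) i (by push_cast; lia)
    exact ⟨t.isLE_of_isZero h0 _, t.isGE_of_isZero h0 _⟩
  | succ d ih =>
    intro b K hl hg
    obtain ⟨K₁, K₂, f, g, w, hS, h₁, h₂, h₃⟩ := K.exists_sub_top b hl
    obtain ⟨δ, hT⟩ := hΦ.exact hS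
    have hg' := h₃ _ hg
    obtain ⟨h₄, h₅⟩ := ih (b - 1) K₂ h₂ (by convert hg' using 1; push_cast; ring)
    have h₆ := hΦ.isGE_of_isConcentrated h₁
    constructor
    · exact t.isLE₂ _ hT b (hΦ.isLE_of_isConcentrated h₁) (t.isLE_of_le (Φ.obj K₂) (b - 1) b)
    · have e : b + 1 - ((d + 1 : ℕ) : ℤ) = b - 1 + 1 - d := by push_cast; ring
      rw [e]
      exact t.isGE₂ _ hT _ (t.isGE_of_ge (Φ.obj K₁) _ b (by lia)) h₅

lemma isLE (K : BoundedComplex A) (b : ℤ) (hb : K.obj.IsStrictlyLE b) : t.IsLE (Φ.obj K) b := by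
  obtain ⟨a, -, ha, -⟩ := K.property
  exact (hΦ.amplitude_aux (b + 1 - a).toNat b K hb (K.obj.isStrictlyGE_of_ge (b + 1 - (b + 1 - a).toNat) a (by lia))).1

lemma isGE (K : BoundedComplex A) (a : ℤ) (ha : K.obj.IsStrictlyGE a) : t.IsGE (Φ.obj K) a := by
  obtain ⟨-, b, -, hb⟩ := K.property
  -- Raising the upper bound to at least `a - 1` keeps the length non-negative, so `toNat` loses
  -- nothing.
  have := (hΦ.amplitude_aux (max b (a - 1) + 1 - a).toNat (max b (a - 1)) K
    (K.obj.isStrictlyLE_of_le b (max b (a - 1)) (by lia)) (K.obj.isStrictlyGE_of_ge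
      (max b (a - 1) + 1 - (max b (a - 1) + 1 - a).toNat) a (by lia))).2
  rwa [show max b (a - 1) + 1 - (max b (a - 1) + 1 - a).toNat = a by lia] at this

/-- An acyclic summand makes `f` an epimorphism without affecting either condition. Comparing
quasi-isomorphisms with morphisms inverted by `Φ` thus reduces to comparing acyclic complexes with
objects killed by `Φ`. -/
lemma isZero_kernel_of_isIso {K L J : BoundedComplex A} (f : K ⟶ L) (p : J ⟶ L)
    (hJ : J.obj.Acyclic) [Epi (biprod.desc f p)] :
    (IsIso (Φ.map f) ↔ IsZero (Φ.obj (kernel (biprod.desc f p)))) ∧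
      (QuasiIso f.hom ↔ (kernel (biprod.desc f p)).obj.Acyclic) := by
  have hS := shortExact_kernel (biprod.desc f p)
  obtain ⟨δ, hT⟩ := hΦ.exact hS
  have hinl := hΦ.exactWithAcyclics.isIso_inl K (hΦ.isZero_of_acyclic J hJ)
  have hf : Φ.map f = Φ.map biprod.inl ≫ Φ.map (biprod.desc f p) := by
    rw [← Φ.map_comp, biprod.inl_desc]
  have hinl' : QuasiIso (biprod.inl : K ⟶ K ⊞ J).hom :=
    quasiIso_of_acyclic_X₃ ((shortExact_biprod K J).map_of_exact (isBoundedComplex A).ι) hJ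
  have hf' : f.hom = (biprod.inl : K ⟶ K ⊞ J).hom ≫ (biprod.desc f p).hom := by
    rw [← ObjectProperty.FullSubcategory.comp_hom, biprod.inl_desc]
  have hS' := hS.map_of_exact (isBoundedComplex A).ι
  constructor
  · rw [hf, ← DistTriang.isIso₂_iff hT]
    exact ⟨fun _ => IsIso.of_isIso_comp_left (Φ.map biprod.inl) _, fun _ => inferInstance⟩
  · rw [hf', quasiIso_iff_comp_left]
    exact ⟨fun h => hS'.acyclic_X₁ h, fun h => quasiIso_of_acyclic_X₁ hS' h⟩

end RealisesHeart

end RealisesHeart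

/-! ### Truncations of complexes versus truncations in the triangulated category. -/

section RealisesHeart

variable {A : Type*} [Category A] [Abelian A]
  {T : Type*} [Category T] [Preadditive T] [HasZeroObject T] [HasShift T ℤ]
  [∀ n : ℤ, (shiftFunctor T n).Additive] [Pretriangulated T]

namespace RealisesHeart

open BoundedComplex

variable {t : TStructure T} {Φ : BoundedComplex A ⥤ T} [Φ.Additive] (hΦ : RealisesHeart t Φ)

include hΦ

lemma isIso_of_quasiIso {K L : BoundedComplex A} (f : K ⟶ L) (hf : QuasiIso f.hom) :
    IsIso (Φ.map f) := by
  obtain ⟨J, p, hp, hJ⟩ := L.exists_epi_acyclic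
  have : Epi (biprod.desc f p) := epi_of_epi_fac (biprod.inr_desc f p)
  obtain ⟨h₁, h₂⟩ := hΦ.isZero_kernel_of_isIso f p hJ
  exact h₁.2 (hΦ.isZero_of_acyclic _ (h₂.1 hf))

/-- The quotient by the canonical truncation is quasi-isomorphic to the opposite truncation. The
outcome is a truncation triangle for `t`, so amplitude conditions on `Φ K` can be met by truncating
`K` itself. -/
lemma exists_truncation_triangle (K : BoundedComplex A) (n : ℤ) :
    ∃ h, Triangle.mk (Φ.map (K.ιLE n)) (Φ.map (K.πGE (n + 1))) h ∈ distTriang T := by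
  obtain ⟨δ, hT⟩ := hΦ.exact (K.shortExact_truncLE n)
  have := hΦ.isIso_of_quasiIso _ (K.quasiIso_quotToGE n)
  refine ⟨inv (Φ.map (K.quotToGE n)) ≫ δ, distTriang_of_iso hT (Iso.refl _) (Iso.refl _)
    (asIso (Φ.map (K.quotToGE n))).symm (by simp) ?_ (by simp)⟩
  simp [← K.πQuot_quotToGE n]

lemma isLE_truncLE (K : BoundedComplex A) (n : ℤ) : t.IsLE (Φ.obj (K.truncLE n)) n :=
  hΦ.isLE _ n (inferInstanceAs ((K.obj.truncLE n).IsStrictlyLE n))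

lemma isGE_truncGE (K : BoundedComplex A) (n : ℤ) : t.IsGE (Φ.obj (K.truncGE n)) n :=
  hΦ.isGE _ n (inferInstanceAs ((K.obj.truncGE n).IsStrictlyGE n))

lemma isIso_map_ιLE (K : BoundedComplex A) (n : ℤ) (hK : t.IsLE (Φ.obj K) n) :
    IsIso (Φ.map (K.ιLE n)) := by
  obtain ⟨δ, hT⟩ := hΦ.exists_truncation_triangle K n
  rw [DistTriang.isIso₁_iff hT]
  have := hΦ.isLE_truncLE K n
  have := DistTriang.isLE₃ t hT n (t.isLE_of_le _ n (n + 1)) hK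
  have := hΦ.isGE_truncGE K (n + 1)
  exact t.isZero _ n (n + 1) (by lia)

lemma isIso_map_πGE (K : BoundedComplex A) (n : ℤ) (hK : t.IsGE (Φ.obj K) (n + 1)) :
    IsIso (Φ.map (K.πGE (n + 1))) := by
  obtain ⟨δ, hT⟩ := hΦ.exists_truncation_triangle K n
  rw [DistTriang.isIso₂_iff hT]
  have := hΦ.isGE_truncGE K (n + 1)
  have := DistTriang.isGE₁ t hT (n + 1) hK (t.isGE_of_ge _ _ (n + 1) (by lia))
  have := hΦ.isLE_truncLE K n
  exact t.isZero _ n (n + 1) (by lia)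

lemma isZero_truncLE (K : BoundedComplex A) (n : ℤ) (hK : IsZero (Φ.obj K)) :
    IsZero (Φ.obj (K.truncLE n)) := by
  have := hΦ.isIso_map_ιLE K n (t.isLE_of_isZero hK n)
  exact hK.of_iso (asIso (Φ.map (K.ιLE n)))

lemma isZero_truncGE (K : BoundedComplex A) (n : ℤ) (hK : IsZero (Φ.obj K)) :
    IsZero (Φ.obj (K.truncGE n)) := by
  obtain ⟨n, rfl⟩ : ∃ m, n = m + 1 := ⟨n - 1, by ring⟩
  have := hΦ.isIso_map_πGE K n (t.isGE_of_isZero hK _)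
  exact hK.of_iso (asIso (Φ.map (K.πGE (n + 1)))).symm

omit hΦ [Pretriangulated T] [Φ.Additive] in
lemma isConcentrated_truncGE_truncLE (K : BoundedComplex A) (n : ℤ) :
    ((K.truncLE n).truncGE n).IsConcentrated n := by
  have : (K.truncLE n).obj.IsStrictlyLE n := inferInstanceAs ((K.obj.truncLE n).IsStrictlyLE n)
  exact ⟨inferInstanceAs (((K.truncLE n).obj.truncGE n).IsStrictlyGE n),
    inferInstanceAs (((K.truncLE n).obj.truncGE n).IsStrictlyLE n)⟩

omit hΦ [Pretriangulated T] [Φ.Additive] in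
lemma isConcentrated_truncLE_truncGE (K : BoundedComplex A) (n : ℤ) :
    ((K.truncGE n).truncLE n).IsConcentrated n := by
  have : (K.truncGE n).obj.IsStrictlyGE n := inferInstanceAs ((K.obj.truncGE n).IsStrictlyGE n)
  exact ⟨inferInstanceAs (((K.truncGE n).obj.truncLE n).IsStrictlyGE n),
    inferInstanceAs (((K.truncGE n).obj.truncLE n).IsStrictlyLE n)⟩

/-- Truncating on both sides of degree `n` preserves the vanishing under `Φ` and leaves a
concentrated complex carrying the cohomology in degree `n`. Since `Φ` is faithful on such complexes,
this complex is zero. -/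
lemma acyclic_of_isZero (K : BoundedComplex A) (hK : IsZero (Φ.obj K)) : K.obj.Acyclic := by
  intro n
  let L := (K.truncLE n).truncGE n
  have hL : IsZero (Φ.obj L) := hΦ.isZero_truncGE _ _ (hΦ.isZero_truncLE _ _ hK)
  have hc := isConcentrated_truncGE_truncLE K n
  have hL' : IsZero L := by
    rw [IsZero.iff_id_eq_zero]
    exact (hΦ.bijective hc hc).1 (hL.eq_of_src _ _)
  have h₁ := K.obj.quasiIsoAt_ιTruncLE n n le_rfl
  have h₂ := (K.obj.truncLE n).quasiIsoAt_πTruncGE n n le_rfl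
  rw [← exactAt_iff_of_quasiIsoAt (K.obj.ιTruncLE n) n,
    exactAt_iff_of_quasiIsoAt ((K.obj.truncLE n).πTruncGE n) n]
  exact ShortComplex.exact_of_isZero_X₂ _ (isZero_X hL' n)

lemma boundedQuasiIso_iff {K L : BoundedComplex A} (f : K ⟶ L) :
    boundedQuasiIso A f ↔ IsIso (Φ.map f) := by
  refine ⟨hΦ.isIso_of_quasiIso f, fun hf => ?_⟩
  obtain ⟨J, p, hp, hJ⟩ := L.exists_epi_acyclic
  have : Epi (biprod.desc f p) := epi_of_epi_fac (biprod.inr_desc f p)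
  obtain ⟨h₁, h₂⟩ := hΦ.isZero_kernel_of_isIso f p hJ
  exact h₂.2 (hΦ.acyclic_of_isZero _ (h₁.1 hf))

/-- Up to morphisms inverted by `Φ`, the source lives in degrees `≤ n` and the target in degrees `≥
n`. The morphism then passes through the degree `n` cohomology of both, where `Φ` is full. -/
lemma isRoof_of_isLE_of_isGE (n : ℤ) {K L : BoundedComplex A} (g : Φ.obj K ⟶ Φ.obj L)
    (hK : t.IsLE (Φ.obj K) n) (hL : t.IsGE (Φ.obj L) n) : IsRoof Φ g := by
  obtain ⟨n, rfl⟩ : ∃ m, n = m + 1 := ⟨n - 1, by ring⟩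
  have hs := hΦ.isIso_map_ιLE K (n + 1) hK
  have hπ := hΦ.isIso_map_πGE L n hL
  obtain ⟨δ, hT⟩ := hΦ.exists_truncation_triangle (K.truncLE (n + 1)) n
  obtain ⟨δ', hT'⟩ := hΦ.exists_truncation_triangle (L.truncGE (n + 1)) (n + 1)
  have h₁ := hΦ.isLE_truncLE (K.truncLE (n + 1)) n
  have h₂ := hΦ.isGE_truncGE L (n + 1)
  obtain ⟨g₁, hg₁⟩ := DistTriang.desc₂ hT (Φ.map (K.ιLE (n + 1)) ≫ g ≫ Φ.map (L.πGE (n + 1)))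
    (t.zero_of_isLE_of_isGE _ n (n + 1) (by lia) h₁ h₂)
  have hc := isConcentrated_truncGE_truncLE K (n + 1)
  have hc' := isConcentrated_truncLE_truncGE L (n + 1)
  obtain ⟨g₂, rfl⟩ := DistTriang.lift₂ hT' g₁ (t.zero_of_isLE_of_isGE _ (n + 1) (n + 1 + 1) (by lia)
    (hΦ.isLE_of_isConcentrated hc) (hΦ.isGE_truncGE _ _))
  obtain ⟨f, rfl⟩ := (hΦ.bijective hc hc').2 g₂
  have h := hΦ.exactWithAcyclics.isRoof_comp (isRoof_of_isIso _ hs)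
    (hΦ.exactWithAcyclics.isRoof_comp
      (isRoof_map ((K.truncLE (n + 1)).πGE (n + 1) ≫ f ≫ (L.truncGE (n + 1)).ιLE (n + 1)))
      (isRoof_of_isIso _ hπ))
  convert h using 1
  rw [IsIso.eq_inv_comp, ← cancel_mono (Φ.map (L.πGE (n + 1)))]
  simpa using hg₁

lemma bounded (K : BoundedComplex A) : ∃ a b : ℤ, t.ge a (Φ.obj K) ∧ t.le b (Φ.obj K) := by
  obtain ⟨a, b, ha, hb⟩ := K.property
  exact ⟨a, b, (hΦ.isGE K a ha).ge, (hΦ.isLE K b hb).le⟩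

lemma exists_truncation (K : BoundedComplex A) (n : ℤ) :
    ∃ (K' K'' : BoundedComplex A) (f : K' ⟶ K) (g : K ⟶ K'') (w : f ≫ g = 0),
      (ShortComplex.mk f g w).ShortExact ∧ t.le n (Φ.obj K') ∧ t.ge (n + 1) (Φ.obj K'') ∧
      (∀ a, t.ge a (Φ.obj K) → t.ge a (Φ.obj K')) ∧
      (∀ b, t.le b (Φ.obj K) → t.le b (Φ.obj K'')) := by
  have hS := K.shortExact_truncLE n
  obtain ⟨δ, hT⟩ := hΦ.exact hS
  have h₁ := hΦ.isLE_truncLE K n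
  have h₂ : t.IsGE (Φ.obj (K.quotTruncLE n)) (n + 1) := by
    have := hΦ.isIso_of_quasiIso _ (K.quasiIso_quotToGE n)
    have := hΦ.isGE_truncGE K (n + 1)
    exact t.isGE_of_iso (asIso (Φ.map (K.quotToGE n))).symm _
  -- The quotient is only known to lie in `≥ n + 1`, which bounds the subobject below by `a` as long
  -- as `a ≤ n + 2`. From `n + 2` on the subobject is zero and the condition is empty; the bound `n
  -- - 1` in `hle` plays the same role.
  have hge (a : ℤ) (ha : a ≤ n + 2) (hK : t.IsGE (Φ.obj K) a) :
      t.IsGE (Φ.obj (K.truncLE n)) a :=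
    DistTriang.isGE₁ t hT a hK (t.isGE_of_ge _ (a - 1) (n + 1) (by lia))
  have hle (b : ℤ) (hb : n - 1 ≤ b) (hK : t.IsLE (Φ.obj K) b) :
      t.IsLE (Φ.obj (K.quotTruncLE n)) b :=
    DistTriang.isLE₃ t hT b (t.isLE_of_le _ n (b + 1) (by lia)) hK
  refine ⟨_, _, _, _, _, hS, h₁.le, h₂.ge, fun a ha => ?_, fun b hb => ?_⟩
  · replace ha : t.IsGE _ a := ⟨ha⟩
    by_cases h : a ≤ n + 2
    · exact (hge a h ha).ge
    · have := hge (n + 2) le_rfl (t.isGE_of_ge _ _ a (by lia))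
      exact (t.isGE_of_isZero (t.isZero _ n (n + 2) (by lia)) a).ge
  · replace hb : t.IsLE _ b := ⟨hb⟩
    by_cases h : n - 1 ≤ b
    · exact (hle b h hb).le
    · have := hle (n - 1) le_rfl (t.isLE_of_le _ b (n - 1) (by lia))
      exact (t.isLE_of_isZero (t.isZero _ (n - 1) (n + 1) (by lia)) b).le

/-- There are enough projectives in the heart, and they are projective with respect to the
ambient category. -/
lemma isRoof_of_enough_projectives
    (hP : ∀ (n : ℤ) (Y : T), t.IsLE Y n → t.IsGE Y n → ∃ (P Z : T) (u : P ⟶ Y) (v : Y ⟶ Z)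
      (h : Z ⟶ P⟦(1 : ℤ)⟧), Triangle.mk u v h ∈ distTriang T ∧ t.IsLE P n ∧ t.IsGE P n ∧
        t.IsGE Z (n - 1) ∧ t.IsLE Z (n - 1) ∧
        ∀ (L : T) (f : P ⟶ L), t.IsLE L (n - 1) → f = 0) ⦃K L : BoundedComplex A⦄
    (g : Φ.obj K ⟶ Φ.obj L) : IsRoof Φ g := by
  refine ProjectiveSlices.isRoof_of_all (le := t.le) (ge := t.ge) ?_ hΦ.exactWithAcyclics g
  exact
    { le_iso := inferInstance
      ge_iso := inferInstance
      ge_mono := fun h => t.ge_antitone h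
      ge_ext := fun n _ _ _ _ _ _ hT hA hD => (t.isGE₂ _ hT n ⟨hA⟩ ⟨hD⟩).ge
      hom_zero := fun n _ _ f hA hB => t.zero_of_isLE_of_isGE f n (n + 1) (by lia) ⟨hA⟩ ⟨hB⟩
      bounded := hΦ.bounded
      truncation := hΦ.exists_truncation
      isRoof := fun n _ _ g hK hL => hΦ.isRoof_of_isLE_of_isGE n g ⟨hK⟩ ⟨hL⟩
      exists_top := fun n K hK => by
        obtain ⟨K₁, K₂, f, g, w, hS, h₁, h₂, -⟩ := (K.truncLE n).exists_sub_top n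
          (inferInstanceAs ((K.obj.truncLE n).IsStrictlyLE n))
        exact ⟨_, _, _, K.ιLE n, f, g, w, hΦ.isIso_map_ιLE K n ⟨hK⟩, hS,
          (hΦ.isGE_of_isConcentrated h₁).ge, (hΦ.isLE _ _ h₂).le⟩
      exists_projective := fun n K hl hg => by
        obtain ⟨P, Z, u, v, h, hT, h₁, h₂, h₃, h₄, h₅⟩ := hP n _ ⟨hl⟩ ⟨hg⟩
        obtain ⟨P', -, ⟨e⟩⟩ := hΦ.exists_iso n P h₁ h₂
        refine ⟨P', Z, e.hom ≫ u, v, h ≫ e.inv⟦(1 : ℤ)⟧',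
          distTriang_of_iso hT e (Iso.refl _) (Iso.refl _) (by simp) (by simp)
            (by simp [← Functor.map_comp]), (t.isLE_of_iso e.symm n).le, h₃.ge, h₄.le,
          fun L f hL => ?_⟩
        rw [← cancel_epi e.inv, h₅ _ (e.inv ≫ f) ⟨hL⟩, comp_zero] }

open CategoryTheory.Pretriangulated.Opposite in
-- Injectives are projectives for `Φ.op`, with aisle and coaisle exchanged and all degrees negated.
lemma isRoof_of_enough_injectives
    (hI : ∀ (n : ℤ) (Y : T), t.IsLE Y n → t.IsGE Y n → ∃ (Z I : T) (u : Z ⟶ Y) (v : Y ⟶ I)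
      (h : I ⟶ Z⟦(1 : ℤ)⟧), Triangle.mk u v h ∈ distTriang T ∧ t.IsLE I n ∧ t.IsGE I n ∧
        t.IsGE Z (n + 1) ∧ t.IsLE Z (n + 1) ∧
        ∀ (L : T) (f : L ⟶ I), t.IsGE L (n + 1) → f = 0) ⦃K L : BoundedComplex A⦄
    (g : Φ.obj K ⟶ Φ.obj L) : IsRoof Φ g := by
  rw [← hΦ.exactWithAcyclics.isRoof_op_iff]
  refine ProjectiveSlices.isRoof_of_all (Φ := Φ.op) (le := fun n => (t.ge (-n)).op)
    (ge := fun n => (t.le (-n)).op) ?_ hΦ.exactWithAcyclics.op g.op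
  exact
    { le_iso := fun n => inferInstance
      ge_iso := fun n => inferInstance
      ge_mono := fun h _ hA => t.le_monotone (by lia) _ hA
      ge_ext := fun n _ _ _ _ _ _ hT hA hD =>
        (t.isLE₂ _ (unop_distinguished _ hT) (-n) ⟨hD⟩ ⟨hA⟩).le
      hom_zero := fun n _ _ f hA hB => Quiver.Hom.unop_inj
        (t.zero_of_isLE_of_isGE f.unop (-(n + 1)) (-n) (by lia) ⟨hB⟩ ⟨hA⟩)
      bounded := fun K => by
        obtain ⟨a, b, ha, hb⟩ := hΦ.bounded K.unop
        refine ⟨-b, -a, ?_, ?_⟩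
        · change t.le (- -b) _
          rwa [neg_neg]
        · change t.ge (- -a) _
          rwa [neg_neg]
      truncation := fun K n => by
        -- The cut between `n` and `n + 1` becomes, after negation, the cut between `-(n + 1)` and
        -- `-n`.
        obtain ⟨K', K'', f, g, w, hS, h₁, h₂, h₃, h₄⟩ := hΦ.exists_truncation K.unop (-(n + 1))
        refine ⟨_, _, g.op, f.op, congrArg Quiver.Hom.op w, hS.op, ?_, h₁,
          fun a => h₄ (-a), fun b => h₃ (-b)⟩
        change t.ge (-n) _
        rwa [show -(n + 1) + 1 = -n by ring] at h₂
      isRoof := fun n K L g hK hL => (hΦ.exactWithAcyclics.isRoof_op_iff g.unop).2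
        (hΦ.isRoof_of_isLE_of_isGE (-n) g.unop ⟨hL⟩ ⟨hK⟩)
      exists_top := fun n K hK => by
        obtain ⟨m, hm⟩ : ∃ m, -n = m + 1 := ⟨-n - 1, by ring⟩
        obtain ⟨K₁, K₂, f, g, w, hS, h₁, h₂, -⟩ := (K.unop.truncGE (-n)).exists_quot_bottom (-n)
          (inferInstanceAs ((K.unop.obj.truncGE (-n)).IsStrictlyGE (-n)))
        refine ⟨_, _, _, (K.unop.πGE (-n)).op, g.op, f.op, congrArg Quiver.Hom.op w, ?_, hS.op,
          (hΦ.isLE_of_isConcentrated h₁).le, ?_⟩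
        · have : IsIso (Φ.map (K.unop.πGE (-n))) := by
            replace hK : t.IsGE (Φ.obj K.unop) (-n) := ⟨hK⟩
            rw [hm] at hK ⊢
            exact hΦ.isIso_map_πGE _ _ hK
          exact inferInstanceAs (IsIso (Φ.map (K.unop.πGE (-n))).op)
        · have := (hΦ.isGE _ _ h₂).ge
          rwa [show -n + 1 = -(n - 1) by ring] at this
      exists_projective := fun n K hl hg => by
        obtain ⟨Z, I, u, v, h, hT, h₁, h₂, h₃, h₄, h₅⟩ := hI (-n) _ ⟨hg⟩ ⟨hl⟩
        obtain ⟨I', -, ⟨e⟩⟩ := hΦ.exists_iso (-n) I h₁ h₂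
        have hT' : Triangle.mk u (v ≫ e.inv) (e.hom ≫ h) ∈ distTriang T :=
          distTriang_of_iso hT (Iso.refl _) (Iso.refl _) e (by simp) (by simp) (by simp)
        rw [show -n + 1 = -(n - 1) by ring] at h₃ h₄ h₅
        refine ⟨Opposite.op I', Opposite.op Z, (v ≫ e.inv).op, u.op, _, op_distinguished _ hT',
          (t.isGE_of_iso e.symm (-n)).ge, h₄.le, h₃.ge, fun L f hL => Quiver.Hom.unop_inj ?_⟩
        change f.unop = 0
        rw [← cancel_mono e.hom, h₅ _ (f.unop ≫ e.hom) ⟨hL⟩, zero_comp] }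

end RealisesHeart

end RealisesHeart

/-! ### Existence of f-forgetful functors -/

section

variable {X : Type u} [Category.{v} X] [Preadditive X] [HasZeroObject X] [HasShift X ℤ]
  [∀ n : ℤ, (shiftFunctor X n).Additive] [Pretriangulated X]

lemma bijective_of_eq {α β : Type*} {f g : α → β} (h : Function.Bijective g)
    (e : ∀ x, f x = g x) : Function.Bijective f := by
  obtain rfl : f = g := funext e
  exact h

/-- In the long exact sequence of `Hom(Y, -)`, the group at `D` lies between the cokernel of `f` in
degree zero and the kernel of `f` one step later, and both vanish. -/
lemma DistTriang.hom_obj₃_eq_zero {A B D : X} {f : A ⟶ B} {g : B ⟶ D} {h : D ⟶ A⟦(1 : ℤ)⟧}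
    (hT : Triangle.mk f g h ∈ distTriang X) {Y : X}
    (hs : ∀ b : Y ⟶ B, ∃ a : Y ⟶ A, a ≫ f = b)
    (hi : ∀ a : Y⟦(-1 : ℤ)⟧ ⟶ A, a ≫ f = 0 → a = 0) (y : Y ⟶ D) : y = 0 := by
  have h0 : y ≫ h = 0 := by
    let e := shiftShiftNeg A (1 : ℤ)
    apply (shiftFunctor X (-1 : ℤ)).map_injective
    rw [Functor.map_zero, ← cancel_mono e.hom, zero_comp]
    apply hi
    have h1 : e.hom ≫ f = f⟦(1 : ℤ)⟧'⟦(-1 : ℤ)⟧' ≫ (shiftShiftNeg B (1 : ℤ)).hom :=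
      ((shiftFunctorCompIsoId X (1 : ℤ) (-1) (by simp)).hom.naturality f).symm
    have h2 : h ≫ f⟦(1 : ℤ)⟧' = 0 := DistTriang.zero₃₁ hT
    rw [Category.assoc, h1, ← Functor.map_comp_assoc, Category.assoc, h2, comp_zero,
      Functor.map_zero, zero_comp]
  obtain ⟨b, rfl⟩ := DistTriang.lift₃ hT y h0
  obtain ⟨a, rfl⟩ := hs b
  rw [Category.assoc, DistTriang.zero₁₂ hT, comp_zero]

namespace FCategory

variable (F : FCategory X)

lemma ge_antitone {m n : ℤ} (h : m ≤ n) : F.ge n ≤ F.ge m := by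
  obtain ⟨k, rfl⟩ := Int.le.dest h
  induction k with
  | zero => simp
  | succ k ih =>
    refine le_trans ?_ (ih (by lia))
    have := F.ge_succ_le (m + k)
    rwa [show m + ((k + 1 : ℕ) : ℤ) = m + k + 1 by push_cast; ring]

lemma le_monotone {m n : ℤ} (h : m ≤ n) : F.le m ≤ F.le n := by
  obtain ⟨k, rfl⟩ := Int.le.dest h
  induction k with
  | zero => simp
  | succ k ih =>
    refine le_trans (ih (by lia)) ?_
    have := F.le_le_succ (m + k)
    rwa [show m + ((k + 1 : ℕ) : ℤ) = m + k + 1 by push_cast; ring]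

instance ge_isTriangulated (n : ℤ) : (F.ge n).IsTriangulated where
  exists_zero := ⟨0, isZero_zero X, ((F.stable n).isLE_of_isZero (isZero_zero X) 0).le⟩
  isStableUnderShiftBy a := ⟨F.ge_shift n a⟩
  toIsTriangulatedClosed₂ := .mk'
    (fun S hS h₁ h₃ => ((F.stable n).isLE₂ S hS 0 ⟨h₁⟩ ⟨h₃⟩).le)

instance le_isTriangulated (n : ℤ) : (F.le n).IsTriangulated := by
  obtain ⟨n, rfl⟩ : ∃ m, n = m - 1 := ⟨n + 1, by ring⟩
  exact
    { exists_zero := ⟨0, isZero_zero X, ((F.stable n).isGE_of_isZero (isZero_zero X) 0).ge⟩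
      isStableUnderShiftBy := fun a => ⟨F.le_shift (n - 1) a⟩
      toIsTriangulatedClosed₂ := .mk'
        (fun S hS h₁ h₃ => ((F.stable n).isGE₂ S hS 0 ⟨h₁⟩ ⟨h₃⟩).ge) }

/-- The truncation triangle `σ_{≥ n + 1} A ⟶ A ⟶ σ_{≤ n} A`. -/
lemma σ_distinguished (n : ℤ) (A : X) :
    Triangle.mk ((F.σgeι (n + 1)).app A) ((F.σleπ n).app A) ((F.σδ n).app A) ∈ distTriang X :=
  (F.stable (n + 1)).triangleLTGE_distinguished 0 A

lemma exists_s (A : X) : ∃ A' : X, Nonempty (F.s.functor.obj A' ≅ A) :=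
  ⟨_, ⟨F.s.counitIso.app A⟩⟩

/-- This is `bijective_α_comp` for `sA` and `sB`, pulled back along the equivalence `s` by means of
`α_s`. -/
lemma bijective_α_comp_zero {A B : X} (hA : F.ge 0 A) (hB : F.le (-1) B) :
    Function.Bijective (fun f : F.s.functor.obj B ⟶ A => F.α.app B ≫ f) := by
  have hA' : F.ge 1 (F.s.functor.obj A) := by simpa using (F.ge_s 0 A).2 hA
  have hB' : F.le 0 (F.s.functor.obj B) := by simpa using (F.le_s (-1) B).2 hB
  have h := (F.bijective_α_comp hA' hB').comp (F.s.fullyFaithfulFunctor.map_bijective _ _)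
  refine (Function.Bijective.of_comp_iff' (F.s.fullyFaithfulFunctor.map_bijective B A) _).1 ?_
  exact bijective_of_eq h (fun f => by simp [F.α_s])

/-- The objects which receive no non-zero morphisms from `X(≤ n)` for some `n`. -/
def null : ObjectProperty X := fun B => ∃ n : ℤ, ∀ ⦃A : X⦄ (f : A ⟶ B), F.le n A → f = 0

instance null_isClosedUnderIsomorphisms : F.null.IsClosedUnderIsomorphisms where
  of_iso := by
    rintro B B' e ⟨n, hn⟩
    refine ⟨n, fun A f hA => ?_⟩
    rw [← cancel_mono e.inv, hn (f ≫ e.inv) hA, zero_comp]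

instance null_isTriangulated : F.null.IsTriangulated where
  exists_zero := ⟨0, isZero_zero X, 0, fun _ _ _ => (isZero_zero X).eq_of_tgt _ _⟩
  isStableUnderShiftBy a := by
    refine ⟨?_⟩
    rintro B ⟨n, hn⟩
    refine ⟨n, fun A f hA => ?_⟩
    apply (shiftFunctor X (-a)).map_injective
    rw [Functor.map_zero, ← cancel_mono (shiftShiftNeg B a).hom, zero_comp]
    exact hn _ (F.le_shift n (-a) A hA)
  toIsTriangulatedClosed₂ := .mk' (by
    rintro S hS ⟨m, hm⟩ ⟨n, hn⟩
    refine ⟨min m n, fun A f hA => ?_⟩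
    obtain ⟨y, rfl⟩ := Triangle.coyoneda_exact₂ S hS f
      (hn _ (F.le_monotone (min_le_right m n) _ hA))
    rw [hm y (F.le_monotone (min_le_left m n) _ hA), zero_comp])

lemma null_of_s {A : X} (h : F.null (F.s.functor.obj A)) : F.null A := by
  obtain ⟨n, hn⟩ := h
  refine ⟨n - 1, fun B f hB => F.s.functor.map_injective ?_⟩
  rw [Functor.map_zero]
  exact hn _ (by simpa using (F.le_s (n - 1) B).2 hB)

/-- For `A` in `X(≥ 1)`, `bijective_comp_α` says exactly that nothing in `X(≤ 0)` maps to the cone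
of `α`. In general `s` carries `A` upwards, turns `α_A` into `α_{sA}`, and reflects nullity. -/
lemma trW_null_α_aux (k : ℕ) : ∀ A : X, F.ge (1 - k) A → F.null.trW (F.α.app A) := by
  induction k with
  | zero =>
    intro A hA
    replace hA : F.ge 1 A := by simpa using hA
    obtain ⟨C, g, h, hT⟩ := distinguished_cocone_triangle (F.α.app A)
    refine ObjectProperty.trW.mk _ hT ⟨0, fun B f hB => ?_⟩
    refine DistTriang.hom_obj₃_eq_zero hT (F.bijective_comp_α hA hB).2 (fun a ha => ?_) f
    exact (F.bijective_comp_α hA (F.le_shift 0 (-1) B hB)).1 (ha.trans zero_comp.symm)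
  | succ k ih =>
    intro A hA
    obtain ⟨C, g, h, hT⟩ := distinguished_cocone_triangle (F.α.app A)
    refine ObjectProperty.trW.mk _ hT (F.null_of_s ?_)
    have h1 := ih (F.s.functor.obj A) (by
      have := (F.ge_s _ A).2 hA
      rwa [show 1 - ((k + 1 : ℕ) : ℤ) + 1 = 1 - k by push_cast; ring] at this)
    rw [F.α_s] at h1
    exact (F.null.trW_iff_of_distinguished _ (F.s.functor.map_distinguished _ hT)).1 h1

lemma trW_null_α (A : X) : F.null.trW (F.α.app A) := by
  obtain ⟨n, hn⟩ := F.exists_ge A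
  exact F.trW_null_α_aux (1 - n).toNat A (F.ge_antitone (by lia) _ hn)

/-- Composing `n` instances of `α` moves `A` to an `n`-fold inverse `s`-shift without changing the
morphisms to `X(≥ 0)`. Far enough down, the source has no morphisms to a given null object. -/
lemma exists_precomp_bijective [IsTriangulated X] (n : ℕ) {A : X} (hA : F.le 0 A) :
    ∃ (A' : X) (a : A' ⟶ A), F.le (-n) A' ∧ F.null.trW a ∧
      ∀ B : X, F.ge 0 B → Function.Bijective (fun f : A ⟶ B => a ≫ f) := by
  induction n with
  | zero =>
    refine ⟨A, 𝟙 A, by simpa using hA, F.null.trW.id_mem A, fun B _ => ?_⟩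
    exact bijective_of_eq Function.bijective_id (fun f => Category.id_comp f)
  | succ n ih =>
    obtain ⟨A', a, hA', ha, h⟩ := ih
    obtain ⟨A'', ⟨e⟩⟩ := F.exists_s A'
    have hA'' : F.le (-(n + 1 : ℕ)) A'' := by
      refine (F.le_s _ _).1 ((F.le _).prop_of_iso e.symm ?_)
      rwa [show -((n + 1 : ℕ) : ℤ) + 1 = -n by push_cast; ring]
    refine ⟨A'', F.α.app A'' ≫ e.hom ≫ a, hA'', ?_, fun B hB => ?_⟩
    · exact F.null.trW.comp_mem _ _ (F.trW_null_α _)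
        (F.null.trW.comp_mem _ _ (F.null.trW_of_isIso _) ha)
    · have h1 := (F.bijective_α_comp_zero hB (F.le_monotone (by push_cast; lia) _ hA'')).comp
        (((Iso.homCongr e.symm (Iso.refl B)).bijective).comp (h B hB))
      exact bijective_of_eq h1 (fun f => by simp [Iso.homCongr])

variable [IsTriangulated X]

instance isIso_Q_map_α (A : X) : IsIso (F.null.trW.Q.map (F.α.app A)) :=
  Localization.inverts F.null.trW.Q F.null.trW _ (F.trW_null_α A)

/-- A fraction involves a single null cone `C`. Replacing `A` by a lower `A'` that does not map to
`C` removes the fraction, and morphisms from `A'` to `B` are the same as those from `A`. -/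
lemma Q_map_bijective {A B : X} (hA : F.le 0 A) (hB : F.ge 0 B) :
    Function.Bijective (fun f : A ⟶ B => F.null.trW.Q.map f) := by
  have key (C : X) (hC : F.null C) : ∃ (A' : X) (a : A' ⟶ A),
      F.null.trW a ∧ (∀ f : A' ⟶ C, f = 0) ∧
      Function.Bijective (fun f : A ⟶ B => a ≫ f) := by
    obtain ⟨n, hn⟩ := hC
    obtain ⟨A', a, hA', ha, h⟩ := F.exists_precomp_bijective (-n).toNat hA
    exact ⟨A', a, ha, fun f => hn f (F.le_monotone (by lia) _ hA'),
      h B hB⟩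
  constructor
  · intro f g hfg
    obtain ⟨B', u, hu, huf⟩ := (MorphismProperty.map_eq_iff_postcomp F.null.trW.Q F.null.trW f g).1
      hfg
    rw [ObjectProperty.trW_iff'] at hu
    obtain ⟨C, c, d, hT, hC⟩ := hu
    obtain ⟨A', a, ha, h₁, h₃⟩ := key C hC
    apply h₃.1
    change a ≫ f = a ≫ g
    rw [← sub_eq_zero, ← Preadditive.comp_sub]
    -- `f - g` dies after `u`, so its restriction to `A'` passes through the null object completing
    -- `u` to a triangle, to which `A'` does not map.
    obtain ⟨y, hy⟩ := DistTriang.lift₂ hT (a ≫ (f - g)) (by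
      rw [Category.assoc, Preadditive.sub_comp, huf, sub_self, comp_zero])
    rw [hy, h₁ y, zero_comp]
  · intro φ
    obtain ⟨φ, rfl⟩ := Localization.exists_leftFraction F.null.trW.Q F.null.trW φ
    obtain ⟨C, c, d, hT, hC⟩ := φ.hs
    obtain ⟨A', a, ha, h₁, h₃⟩ := key C hC
    obtain ⟨y, hy⟩ := DistTriang.lift₂ hT (a ≫ φ.f) (h₁ _)
    obtain ⟨f, rfl⟩ := h₃.2 y
    refine ⟨f, ?_⟩
    have ha' := Localization.inverts F.null.trW.Q F.null.trW _ ha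
    have hs' := Localization.inverts F.null.trW.Q F.null.trW _ φ.hs
    dsimp only at hy ⊢
    rw [← cancel_mono (F.null.trW.Q.map φ.s), φ.map_comp_map_s, ← Functor.map_comp,
      ← cancel_epi (F.null.trW.Q.map a), ← Functor.map_comp, ← Functor.map_comp, hy,
      Category.assoc]

end FCategory

end

/-! ### The quotient by the null objects is equivalent to `T`. -/

section

variable {T : Type u} [Category.{v} T] [Preadditive T] [HasZeroObject T] [HasShift T ℤ]
  [∀ n : ℤ, (shiftFunctor T n).Additive] [Pretriangulated T]
  {X : Type u'} [Category.{v'} X] [Preadditive X] [HasZeroObject X] [HasShift X ℤ]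
  [∀ n : ℤ, (shiftFunctor X n).Additive] [Pretriangulated X]

namespace FCategory

variable {F : FCategory X}

/-- An induction principle for objects of an f-category. -/
lemma induction_pieces (P : X → Prop)
    (hpiece : ∀ (n : ℤ) (A : X), F.ge n A → F.le n A → P A)
    (hzero : ∀ A : X, IsZero A → P A)
    (hext : ∀ (n : ℤ) (A : X), P ((F.σge (n + 1)).obj A) → P ((F.σle n).obj A) → P A) (A : X) :
    P A := by
  have key (d : ℕ) : ∀ (a : ℤ) (A : X), F.ge a A → F.le (a + d - 1) A → P A := by
    induction d with
    | zero =>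
      intro a A hA hA'
      refine hzero A ((IsZero.iff_id_eq_zero A).2 (F.hom_eq_zero' (a - 1) _ ?_ ?_))
      · rwa [sub_add_cancel]
      · rwa [show a + ((0 : ℕ) : ℤ) - 1 = a - 1 by simp] at hA'
    | succ d ih =>
      intro a A hA hA'
      refine hext a A (ih (a + 1) _ (F.ge_σge _ _) ?_)
        (hpiece a _ (F.ge_σle a A hA) (F.le_σle a A))
      rw [show a + 1 + (d : ℤ) - 1 = a + d by ring]
      refine (F.le (a + d)).ext_of_isTriangulatedClosed₁ _ (F.σ_distinguished a A) ?_
        (F.le_monotone (by lia) _ (F.le_σle a A))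
      rwa [show a + ((d + 1 : ℕ) : ℤ) - 1 = a + d by push_cast; ring] at hA'
  obtain ⟨a, ha⟩ := F.exists_ge A
  obtain ⟨b, hb⟩ := F.exists_le A
  exact key (b + 1 - a).toNat a A ha (F.le_monotone (by lia) _ hb)

namespace Enhancement

variable (E : F.Enhancement T)

lemma mem_essImage_of_zero {A : X} (h₁ : F.ge 0 A) (h₂ : F.le 0 A) : E.θ.essImage A := by
  rw [E.essImage_eq]
  exact ⟨h₁, h₂⟩

variable [IsTriangulated X]

instance : (E.θ ⋙ F.null.trW.Q).Full where
  map_surjective {Y Z} g := by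
    obtain ⟨f, hf⟩ := (F.Q_map_bijective (E.le_zero_θ Y) (E.ge_zero_θ Z)).2 g
    obtain ⟨f, rfl⟩ := E.θ.map_surjective f
    exact ⟨f, hf⟩

instance : (E.θ ⋙ F.null.trW.Q).Faithful where
  map_injective {Y Z} _ _ h := E.θ.map_injective
    ((F.Q_map_bijective (E.le_zero_θ Y) (E.ge_zero_θ Z)).1 h)

/-- The quotient functor inverts `α`, hence identifies `A` with `sA`. Every piece can thus be moved
to filtration degree zero, where it comes from `θ`. -/
lemma Q_obj_mem_essImage_of_piece (n : ℤ) : ∀ A : X, F.ge n A → F.le n A →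
    (E.θ ⋙ F.null.trW.Q).essImage (F.null.trW.Q.obj A) := by
  let P : ObjectProperty _ := (E.θ ⋙ F.null.trW.Q).essImage
  have hs (A : X) : P (F.null.trW.Q.obj A) ↔ P (F.null.trW.Q.obj (F.s.functor.obj A)) :=
    P.prop_iff_of_iso (asIso (F.null.trW.Q.map (F.α.app A)))
  refine int_induct (p := fun n => ∀ A : X, F.ge n A → F.le n A → P (F.null.trW.Q.obj A)) ?_
    (fun n => ⟨fun h A hA hA' => ?_, fun h A hA hA' => ?_⟩) n
  · intro A hA hA'
    obtain ⟨Z, ⟨e⟩⟩ := E.mem_essImage_of_zero hA hA'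
    exact ⟨Z, ⟨F.null.trW.Q.mapIso e⟩⟩
  · obtain ⟨A', ⟨e⟩⟩ := F.exists_s A
    refine (P.prop_iff_of_iso (F.null.trW.Q.mapIso e)).1 ((hs A').1 (h A' ?_ ?_))
    · exact (F.ge_s n A').1 ((F.ge _).prop_of_iso e.symm hA)
    · exact (F.le_s n A').1 ((F.le _).prop_of_iso e.symm hA')
  · exact (hs A).2 (h _ ((F.ge_s n A).2 hA) ((F.le_s n A).2 hA'))

lemma Q_obj_mem_essImage (A : X) : (E.θ ⋙ F.null.trW.Q).essImage (F.null.trW.Q.obj A) := by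
  refine induction_pieces (F := F) (fun A => (E.θ ⋙ F.null.trW.Q).essImage (F.null.trW.Q.obj A))
    (fun n A hA hA' => E.Q_obj_mem_essImage_of_piece n A hA hA')
    (fun A hA => (E.θ ⋙ F.null.trW.Q).essImage.prop_of_isZero (F.null.trW.Q.map_isZero hA))
    (fun n A h₁ h₂ => ?_) A
  exact (E.θ ⋙ F.null.trW.Q).essImage.ext_of_isTriangulatedClosed₂ _
    (F.null.trW.Q.map_distinguished _ (F.σ_distinguished n A)) h₁ h₂

instance : (E.θ ⋙ F.null.trW.Q).EssSurj where
  mem_essImage Y := by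
    obtain ⟨A, rfl⟩ := (Localization.Construction.objEquiv F.null.trW).surjective Y
    exact E.Q_obj_mem_essImage A

instance : (E.θ ⋙ F.null.trW.Q).IsEquivalence where

end Enhancement

end FCategory

end

/-! ### Adjunctions and the f-forgetful functor. -/

section

variable {T : Type u} [Category.{v} T] [Preadditive T] [HasZeroObject T] [HasShift T ℤ]
  [∀ n : ℤ, (shiftFunctor T n).Additive] [Pretriangulated T]
  {X : Type u'} [Category.{v'} X] [Preadditive X] [HasZeroObject X] [HasShift X ℤ]
  [∀ n : ℤ, (shiftFunctor X n).Additive] [Pretriangulated X]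

namespace FCategory

namespace Enhancement

variable {F : FCategory X} (E : F.Enhancement T)

section

variable (ω : X ⥤ T) (e : E.θ ⋙ ω ≅ 𝟭 T)
  (hω : ∀ ⦃A B : X⦄, F.le 0 A → F.ge 0 B → Function.Bijective (fun f : A ⟶ B => ω.map f))

include hω in
lemma bijective_homEquivGE (Z : T) (A : (F.ge 0).FullSubcategory) :
    Function.Bijective (fun f : E.toGE.obj Z ⟶ A => e.inv.app Z ≫ ω.map f.hom) :=
  bijective_of_eq ((Iso.homCongr (e.app Z) (Iso.refl (ω.obj A.obj))).bijective.comp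
    ((hω (E.le_zero_θ Z) A.property).comp
      ((F.ge 0).fullyFaithfulι.map_bijective (E.toGE.obj Z) A))) (fun f => by
        dsimp [Iso.homCongr]
        rw [Category.comp_id]
        rfl)

include hω in
lemma bijective_homEquivLE (A : (F.le 0).FullSubcategory) (Z : T) :
    Function.Bijective (fun f : A ⟶ E.toLE.obj Z => ω.map f.hom ≫ e.hom.app Z) :=
  bijective_of_eq ((Iso.homCongr (Iso.refl (ω.obj A.obj)) (e.app Z)).bijective.comp
    ((hω A.property (E.ge_zero_θ Z)).comp
      ((F.le 0).fullyFaithfulι.map_bijective A (E.toLE.obj Z)))) (fun f => by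
        dsimp [Iso.homCongr]
        rw [Category.id_comp]
        rfl)

/-- The adjunction on `X(≥ 0)` of a functor which is bijective on morphisms from `X(≤ 0)`
to `X(≥ 0)`. -/
noncomputable def adjunctionGE : E.toGE ⊣ (F.ge 0).ι ⋙ ω :=
  Adjunction.mkOfHomEquiv
    { homEquiv := fun Z A => Equiv.ofBijective _ (E.bijective_homEquivGE ω e hω Z A)
      homEquiv_naturality_left_symm := fun {Z Z' A} f g => by
        rw [Equiv.symm_apply_eq]
        obtain ⟨g, rfl⟩ := (E.bijective_homEquivGE ω e hω Z' A).2 g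
        rw [Equiv.ofBijective_symm_apply_apply]
        have h := e.inv.naturality f
        refine ((Category.assoc _ _ _).symm.trans (congrArg (· ≫ ω.map g.hom) h)).trans ?_
        exact (Category.assoc _ _ _).trans (congrArg (e.inv.app Z ≫ ·) (ω.map_comp _ _).symm)
      homEquiv_naturality_right := fun {Z A A'} f g =>
        (congrArg (e.inv.app Z ≫ ·) (ω.map_comp f.hom g.hom)).trans (Category.assoc _ _ _).symm }

/-- The adjunction on `X(≤ 0)` of a functor which is bijective on morphisms from `X(≤ 0)`
to `X(≥ 0)`. -/
noncomputable def adjunctionLE : (F.le 0).ι ⋙ ω ⊣ E.toLE :=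
  Adjunction.mkOfHomEquiv
    { homEquiv := fun A Z => (Equiv.ofBijective _ (E.bijective_homEquivLE ω e hω A Z)).symm
      homEquiv_naturality_left_symm := fun {A A' Z} f g =>
        (congrArg (· ≫ e.hom.app Z) (ω.map_comp f.hom g.hom)).trans (Category.assoc _ _ _)
      homEquiv_naturality_right := fun {A Z Z'} f g => by
        rw [Equiv.symm_apply_eq]
        obtain ⟨f, rfl⟩ := (E.bijective_homEquivLE ω e hω A Z).2 f
        rw [Equiv.ofBijective_symm_apply_apply]
        have h := e.hom.naturality g
        refine ((Category.assoc _ _ _).trans (congrArg (ω.map f.hom ≫ ·) h.symm)).trans ?_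
        exact (Category.assoc _ _ _).symm.trans
          (congrArg (· ≫ e.hom.app Z') (ω.map_comp _ _).symm) }

end

section

variable [IsTriangulated X]

/-- The equivalence from `T` to the quotient of `X` by the null objects. -/
noncomputable def quotientEquivalence : T ≌ F.null.trW.Localization :=
  (E.θ ⋙ F.null.trW.Q).asEquivalence

noncomputable instance : E.quotientEquivalence.functor.CommShift ℤ :=
  inferInstanceAs ((E.θ ⋙ F.null.trW.Q).CommShift ℤ)

instance : E.quotientEquivalence.functor.IsTriangulated :=
  inferInstanceAs ((E.θ ⋙ F.null.trW.Q).IsTriangulated)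

noncomputable instance : E.quotientEquivalence.inverse.CommShift ℤ :=
  E.quotientEquivalence.commShiftInverse ℤ

instance : E.quotientEquivalence.CommShift ℤ := E.quotientEquivalence.commShift_of_functor ℤ

instance : E.quotientEquivalence.IsTriangulated := Equivalence.IsTriangulated.mk' _ inferInstance

end

/-- Take the quotient functor followed by the inverse of the equivalence induced by `θ`. Both
adjunctions follow formally from bijectivity on morphisms from `X(≤ 0)` to `X(≥ 0)`. -/
theorem nonempty_forgetful [IsTriangulated X] : Nonempty E.Forgetful := by
  let Ψ : T ≌ F.null.trW.Localization := E.quotientEquivalence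
  let ω : X ⥤ T := F.null.trW.Q ⋙ Ψ.inverse
  let e : E.θ ⋙ ω ≅ 𝟭 T := Ψ.unitIso.symm
  have hω ⦃A B : X⦄ (hA : F.le 0 A) (hB : F.ge 0 B) :
      Function.Bijective (fun f : A ⟶ B => ω.map f) :=
    (Ψ.symm.fullyFaithfulFunctor.map_bijective _ _).comp (F.Q_map_bijective hA hB)
  exact ⟨{
    ω := ω
    adj_ge := ⟨E.adjunctionGE ω e hω⟩
    adj_le := ⟨E.adjunctionLE ω e hω⟩
    isIso_map_α := fun A => inferInstanceAs
      (IsIso (Ψ.inverse.map (F.null.trW.Q.map (F.α.app A))))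
    bijective_map := hω }⟩

end Enhancement

end FCategory

end

/-! ### Truncations in f-categories -/

section

variable {X : Type u} [Category.{v} X] [Preadditive X] [HasZeroObject X] [HasShift X ℤ]
  [∀ n : ℤ, (shiftFunctor X n).Additive] [Pretriangulated X]

namespace FCategory

variable (F : FCategory X)

lemma isZero_of_ge_of_le {m n : ℤ} (h : m < n) {A : X} (h₁ : F.ge n A) (h₂ : F.le m A) :
    IsZero A :=
  (IsZero.iff_id_eq_zero A).2 (F.hom_eq_zero' m _ (F.ge_antitone (by lia) _ h₁) h₂)

lemma bijective_comp_σgeι {n : ℤ} {Y : X} (A : X) (hY : F.ge n Y) :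
    Function.Bijective (fun f : Y ⟶ (F.σge n).obj A => f ≫ (F.σgeι n).app A) := by
  have h : (F.stable n).IsLE Y (0 - 1) := ⟨hY⟩
  exact ⟨fun f g hfg => (F.stable n).to_truncLT_obj_ext hfg,
    fun f => ⟨(F.stable n).liftTruncLT f (0 - 1) 0 (by simp),
      (F.stable n).liftTruncLT_ι f (0 - 1) 0 (by simp)⟩⟩

lemma bijective_σleπ_comp {n : ℤ} (A : X) {Z : X} (hZ : F.le n Z) :
    Function.Bijective (fun f : (F.σle n).obj A ⟶ Z => (F.σleπ n).app A ≫ f) := by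
  have h : (F.stable (n + 1)).IsGE Z 0 := by
    refine ⟨?_⟩
    change F.le (n + 1 - 1) Z
    rwa [add_sub_cancel_right]
  exact ⟨fun f g hfg => (F.stable (n + 1)).from_truncGE_obj_ext hfg,
    fun f => ⟨(F.stable (n + 1)).descTruncGE f 0, (F.stable (n + 1)).π_descTruncGE f 0⟩⟩

lemma isIso_σgeι {n : ℤ} {A : X} (hA : F.ge n A) : IsIso ((F.σgeι n).app A) := by
  obtain ⟨n, rfl⟩ : ∃ m, n = m + 1 := ⟨n - 1, by ring⟩
  rw [DistTriang.isIso₁_iff (F.σ_distinguished n A)]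
  exact F.isZero_of_ge_of_le (by lia) ((F.ge (n + 1)).ext_of_isTriangulatedClosed₃ _
    (F.σ_distinguished n A) (F.ge_σge _ _) hA) (F.le_σle n A)

lemma isIso_σleπ {n : ℤ} {A : X} (hA : F.le n A) : IsIso ((F.σleπ n).app A) := by
  rw [DistTriang.isIso₂_iff (F.σ_distinguished n A)]
  exact F.isZero_of_ge_of_le (by lia) (F.ge_σge (n + 1) A)
    ((F.le n).ext_of_isTriangulatedClosed₁ _ (F.σ_distinguished n A) hA (F.le_σle n A))

lemma isZero_σge {n b : ℤ} {A : X} (hA : F.le b A) (h : b < n) : IsZero ((F.σge n).obj A) := by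
  rw [IsZero.iff_id_eq_zero]
  apply (F.bijective_comp_σgeι A (F.ge_σge n A)).1
  exact (F.hom_eq_zero' b _ (F.ge_antitone (by lia) _ (F.ge_σge n A)) hA).trans
    (F.hom_eq_zero' b _ (F.ge_antitone (by lia) _ (F.ge_σge n A)) hA).symm

lemma isZero_σle {n a : ℤ} {A : X} (hA : F.ge a A) (h : n < a) : IsZero ((F.σle n).obj A) := by
  rw [IsZero.iff_id_eq_zero]
  apply (F.bijective_σleπ_comp A (F.le_σle n A)).1
  exact (F.hom_eq_zero' n _ (F.ge_antitone (by lia) _ hA) (F.le_σle n A)).trans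
    (F.hom_eq_zero' n _ (F.ge_antitone (by lia) _ hA) (F.le_σle n A)).symm

lemma le_σge {n b : ℤ} {A : X} (hA : F.le b A) : F.le b ((F.σge n).obj A) := by
  obtain ⟨n, rfl⟩ : ∃ m, n = m + 1 := ⟨n - 1, by ring⟩
  by_cases h : b < n + 1
  · exact (F.le b).prop_of_isZero (F.isZero_σge hA h)
  · exact (F.le b).ext_of_isTriangulatedClosed₁ _ (F.σ_distinguished n A) hA
      (F.le_monotone (by lia) _ (F.le_σle n A))

lemma ge_piece (n : ℤ) (A : X) : F.ge n ((F.piece n).obj A) := F.ge_σle n _ (F.ge_σge n A)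

lemma le_piece (n : ℤ) (A : X) : F.le n ((F.piece n).obj A) := F.le_σle n _

lemma isZero_piece_of_ge {n a : ℤ} {A : X} (hA : F.ge a A) (h : n < a) :
    IsZero ((F.piece n).obj A) := by
  have := F.isIso_σgeι (F.ge_antitone h.le _ hA)
  exact F.isZero_σle ((F.ge a).prop_of_iso (asIso ((F.σgeι n).app A)).symm hA) h

lemma σle_map_isZero {n : ℤ} {A : X} (hA : IsZero A) : IsZero ((F.σle n).obj A) :=
  F.isZero_σle ((F.ge (n + 1)).prop_of_isZero hA) (by lia)

lemma isZero_piece_of_le {n b : ℤ} {A : X} (hA : F.le b A) (h : b < n) :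
    IsZero ((F.piece n).obj A) :=
  F.σle_map_isZero (F.isZero_σge hA h)

/-- An object of `X(≥ n) ∩ X(≤ n)` is its own `n`-th piece. -/
noncomputable def pieceIso {n : ℤ} {A : X} (h₁ : F.ge n A) (h₂ : F.le n A) :
    (F.piece n).obj A ≅ A :=
  haveI := F.isIso_σgeι h₁
  haveI := F.isIso_σleπ (F.le_σge (n := n) h₂)
  (asIso ((F.σleπ n).app ((F.σge n).obj A))).symm ≪≫ asIso ((F.σgeι n).app A)

/-- Expresses the connecting morphism through the truncation triangle of `A` itself instead of that
of `σ_{≥ n} A`, which is the form needed for gluing. -/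
lemma pieceδ_app (n : ℤ) (A : X) :
    (F.pieceδ n).app A = (F.σle n).map ((F.σgeι n).app A) ≫ (F.σδ n).app A ≫
      ((F.σleπ (n + 1)).app ((F.σge (n + 1)).obj A))⟦(1 : ℤ)⟧' := by
  have h := (F.σδ n).naturality ((F.σgeι n).app A)
  dsimp at h
  rw [reassoc_of% h]
  change _ ≫ (shiftFunctor X (1 : ℤ)).map (_ ≫ _) = _
  rw [Functor.map_comp]
  rfl

/-- The functor `σ_{≥ n}` with values in `X(≥ n)`. -/
noncomputable def toGE (n : ℤ) : X ⥤ (F.ge n).FullSubcategory :=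
  (F.ge n).lift (F.σge n) (F.ge_σge n)

/-- The functor `σ_{≤ n}` with values in `X(≤ n)`. -/
noncomputable def toLE (n : ℤ) : X ⥤ (F.le n).FullSubcategory :=
  (F.le n).lift (F.σle n) (F.le_σle n)

/-- The functor `σ_{≥ n}` is right adjoint to the inclusion. -/
noncomputable def adjunctionGE (n : ℤ) : (F.ge n).ι ⊣ F.toGE n :=
  Adjunction.mkOfHomEquiv
    { homEquiv := fun Y A => ((F.ge n).fullyFaithfulι.homEquiv (Y := (F.toGE n).obj A)).trans
        (Equiv.ofBijective _ (F.bijective_comp_σgeι A Y.property)) |>.symm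
      homEquiv_naturality_left_symm := fun f g => Category.assoc f.hom g.hom _
      homEquiv_naturality_right := fun {Y A A'} f g => by
        rw [Equiv.symm_apply_eq]
        obtain ⟨f, rfl⟩ := (((F.ge n).fullyFaithfulι.homEquiv (Y := (F.toGE n).obj A)).trans
          (Equiv.ofBijective _ (F.bijective_comp_σgeι A Y.property))).surjective f
        rw [Equiv.symm_apply_apply]
        exact (Category.assoc f.hom _ _).trans ((congrArg (f.hom ≫ ·)
          ((F.σgeι n).naturality g).symm).trans (Category.assoc _ _ _).symm) }

/-- The functor `σ_{≤ n}` is left adjoint to the inclusion. -/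
noncomputable def adjunctionLE (n : ℤ) : F.toLE n ⊣ (F.le n).ι :=
  Adjunction.mkOfHomEquiv
    { homEquiv := fun A Z => ((F.le n).fullyFaithfulι.homEquiv (X := (F.toLE n).obj A)).trans
        (Equiv.ofBijective _ (F.bijective_σleπ_comp A Z.property))
      homEquiv_naturality_right := fun f g => (Category.assoc _ f.hom g.hom).symm
      homEquiv_naturality_left_symm := fun {A A' Z} f g => by
        rw [Equiv.symm_apply_eq]
        obtain ⟨g, rfl⟩ := (((F.le n).fullyFaithfulι.homEquiv (X := (F.toLE n).obj A')).trans
          (Equiv.ofBijective _ (F.bijective_σleπ_comp A' Z.property))).surjective g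
        rw [Equiv.symm_apply_apply]
        exact (Category.assoc _ _ g.hom).symm.trans ((congrArg (· ≫ g.hom)
          ((F.σleπ n).naturality f)).trans (Category.assoc _ _ _)) }

section

variable {A B D : X} {f : A ⟶ B} {g : B ⟶ D} {h : D ⟶ A⟦(1 : ℤ)⟧}
  (hT : Triangle.mk f g h ∈ distTriang X)

include hT

/-- A truncation functor is adjoint to a triangulated inclusion, hence triangulated. Only the
existence of some third morphism is needed later. -/
lemma exists_σge_distinguished (n : ℤ) :
    ∃ h', Triangle.mk ((F.σge n).map f) ((F.σge n).map g) h' ∈ distTriang X := by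
  let _ : (F.toGE n).CommShift ℤ := (F.adjunctionGE n).rightAdjointCommShift ℤ
  have : (F.adjunctionGE n).CommShift ℤ := (F.adjunctionGE n).commShift_of_leftAdjoint ℤ
  have : (F.toGE n).IsTriangulated := (F.adjunctionGE n).isTriangulated_rightAdjoint
  exact ⟨_, (F.ge n).ι.map_distinguished _ ((F.toGE n).map_distinguished _ hT)⟩

lemma exists_σle_distinguished (n : ℤ) :
    ∃ h', Triangle.mk ((F.σle n).map f) ((F.σle n).map g) h' ∈ distTriang X := by
  let _ : (F.toLE n).CommShift ℤ := (F.adjunctionLE n).leftAdjointCommShift ℤ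
  have : (F.adjunctionLE n).CommShift ℤ := (F.adjunctionLE n).commShift_of_rightAdjoint ℤ
  have : (F.toLE n).IsTriangulated := (F.adjunctionLE n).isTriangulated_leftAdjoint
  exact ⟨_, (F.le n).ι.map_distinguished _ ((F.toLE n).map_distinguished _ hT)⟩

lemma exists_piece_distinguished (n : ℤ) :
    ∃ h', Triangle.mk ((F.piece n).map f) ((F.piece n).map g) h' ∈ distTriang X := by
  obtain ⟨h', hT'⟩ := F.exists_σge_distinguished hT n
  exact F.exists_σle_distinguished hT' n

end

lemma isIso_piece_map_σgeι {n i : ℤ} (h : n ≤ i) (A : X) :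
    IsIso ((F.piece i).map ((F.σgeι n).app A)) := by
  obtain ⟨n, rfl⟩ : ∃ m, n = m + 1 := ⟨n - 1, by ring⟩
  obtain ⟨δ, hT⟩ := F.exists_piece_distinguished (F.σ_distinguished n A) i
  exact (DistTriang.isIso₁_iff hT).2 (F.isZero_piece_of_le (F.le_σle n A) (by lia))

lemma isIso_piece_map_σleπ {n i : ℤ} (h : i ≤ n) (A : X) :
    IsIso ((F.piece i).map ((F.σleπ n).app A)) := by
  obtain ⟨δ, hT⟩ := F.exists_piece_distinguished (F.σ_distinguished n A) i
  exact (DistTriang.isIso₂_iff hT).2 (F.isZero_piece_of_ge (F.ge_σge (n + 1) A) (by lia))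

variable {F}

lemma piece_prop_σge (P : ObjectProperty X) [P.IsClosedUnderIsomorphisms]
    (hP : ∀ A : X, IsZero A → P A) {A : X} {i : ℤ} (hA : P ((F.piece i).obj A)) (n : ℤ) :
    P ((F.piece i).obj ((F.σge n).obj A)) := by
  by_cases h : n ≤ i
  · have := F.isIso_piece_map_σgeι h A
    exact P.prop_of_iso (asIso ((F.piece i).map ((F.σgeι n).app A))).symm hA
  · exact hP _ (F.isZero_piece_of_ge (F.ge_σge n A) (by lia))

lemma piece_prop_σle (P : ObjectProperty X) [P.IsClosedUnderIsomorphisms]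
    (hP : ∀ A : X, IsZero A → P A) {A : X} {i : ℤ} (hA : P ((F.piece i).obj A)) (n : ℤ) :
    P ((F.piece i).obj ((F.σle n).obj A)) := by
  by_cases h : i ≤ n
  · have := F.isIso_piece_map_σleπ h A
    exact P.prop_of_iso (asIso ((F.piece i).map ((F.σleπ n).app A))) hA
  · exact hP _ (F.isZero_piece_of_le (F.le_σle n A) (by lia))

/-- A property of objects which is closed under extensions holds if it holds for all pieces. -/
lemma prop_of_pieces (P : ObjectProperty X) [P.IsClosedUnderIsomorphisms]
    [P.IsTriangulatedClosed₂] (hP : ∀ A : X, IsZero A → P A) (A : X)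
    (hA : ∀ i, P ((F.piece i).obj A)) : P A := by
  refine F.induction_pieces (P := fun A => (∀ i, P ((F.piece i).obj A)) → P A)
    (fun n A h₁ h₂ h => P.prop_of_iso (F.pieceIso h₁ h₂) (h n)) (fun A hA _ => hP A hA)
    (fun n A h₁ h₂ h => ?_) A hA
  exact P.ext_of_isTriangulatedClosed₂ _ (F.σ_distinguished n A)
    (h₁ (fun i => piece_prop_σge P hP (h i) _)) (h₂ (fun i => piece_prop_σle P hP (h i) _))

lemma ge_of_isZero_piece (c : ℤ) (A : X) (hA : ∀ i < c, IsZero ((F.piece i).obj A)) :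
    F.ge c A :=
  prop_of_pieces (F.ge c) (fun _ => (F.ge c).prop_of_isZero) A (fun i => by
    by_cases h : i < c
    · exact (F.ge c).prop_of_isZero (hA i h)
    · exact F.ge_antitone (by lia) _ (F.ge_piece i A))

lemma le_of_isZero_piece (c : ℤ) (A : X) (hA : ∀ i, c < i → IsZero ((F.piece i).obj A)) :
    F.le c A :=
  prop_of_pieces (F.le c) (fun _ => (F.le c).prop_of_isZero) A (fun i => by
    by_cases h : c < i
    · exact (F.le c).prop_of_isZero (hA i h)
    · exact F.le_monotone (by lia) _ (F.le_piece i A))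

end FCategory

end

/-! ### Properties of f-forgetful functors -/

section

variable {T : Type u} [Category.{v} T] [Preadditive T] [HasZeroObject T] [HasShift T ℤ]
  [∀ n : ℤ, (shiftFunctor T n).Additive] [Pretriangulated T]
  {X : Type u'} [Category.{v'} X] [Preadditive X] [HasZeroObject X] [HasShift X ℤ]
  [∀ n : ℤ, (shiftFunctor X n).Additive] [Pretriangulated X]

namespace FCategory

namespace Enhancement

variable {F : FCategory X} {E : F.Enhancement T}

instance toGE_full : E.toGE.Full := inferInstanceAs ((F.ge 0).lift E.θ E.ge_zero_θ).Full

instance toGE_faithful : E.toGE.Faithful :=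
  inferInstanceAs ((F.ge 0).lift E.θ E.ge_zero_θ).Faithful

namespace Forgetful

variable (w : E.Forgetful)

instance (A : X) : IsIso (w.ω.map (F.α.app A)) := w.isIso_map_α A

/-- `θ` is a fully faithful left adjoint, so the unit is invertible. -/
lemma nonempty_θ_iso (Z : T) : Nonempty (w.ω.obj (E.θ.obj Z) ≅ Z) := by
  obtain ⟨adj⟩ := w.adj_ge
  exact ⟨(asIso (adj.unit.app Z)).symm⟩

lemma nonempty_powNat_iso (e : X ≌ X) (he : ∀ A, Nonempty (w.ω.obj (e.functor.obj A) ≅ w.ω.obj A))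
    (k : ℕ) : ∀ A : X, Nonempty (w.ω.obj ((e.powNat k).functor.obj A) ≅ w.ω.obj A) := by
  induction k with
  | zero => exact fun A => ⟨Iso.refl _⟩
  | succ k ih =>
    intro A
    cases k with
    | zero => exact he A
    | succ k => exact ⟨(ih (e.functor.obj A)).some ≪≫ (he A).some⟩

lemma nonempty_pow_iso (a : ℤ) (A : X) :
    Nonempty (w.ω.obj ((F.s.pow a).functor.obj A) ≅ w.ω.obj A) := by
  have hs (A : X) : Nonempty (w.ω.obj (F.s.functor.obj A) ≅ w.ω.obj A) :=
    ⟨(asIso (w.ω.map (F.α.app A))).symm⟩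
  cases a with
  | ofNat k => exact w.nonempty_powNat_iso F.s hs k A
  | negSucc k =>
    refine w.nonempty_powNat_iso F.s.symm (fun A => ?_) (k + 1) A
    exact ⟨(hs (F.s.inverse.obj A)).some.symm ≪≫ w.ω.mapIso (F.s.counitIso.app A)⟩

/-- `ω` undoes `θ` and, by `α`, ignores powers of `s`. This allows the induced t-structure to be
tested on `ω` of the pieces. -/
lemma nonempty_gr_iso (n : ℤ) (A : X) :
    Nonempty ((E.gr n).obj A ≅ w.ω.obj ((F.piece n).obj A)) := by
  let Y : E.θ.EssImageSubcategory := ⟨(F.s.pow (-n)).functor.obj ((F.piece n).obj A), by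
    rw [E.essImage_eq]
    exact F.piece_pow_mem n A⟩
  let e : E.θ.obj ((E.gr n).obj A) ≅ (F.s.pow (-n)).functor.obj ((F.piece n).obj A) :=
    E.θ.essImage.ι.mapIso (E.θ.toEssImage.asEquivalence.counitIso.app Y)
  exact ⟨(w.nonempty_θ_iso _).some.symm ≪≫ w.ω.mapIso e ≪≫ (w.nonempty_pow_iso _ _).some⟩

lemma exists_of_isConcentrated (n : ℤ) (Y : T) :
    ∃ A : X, F.ge n A ∧ F.le n A ∧ Nonempty (w.ω.obj A ≅ Y) := by
  refine ⟨(F.s.pow n).functor.obj (E.θ.obj Y), ?_, ?_,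
    ⟨(w.nonempty_pow_iso _ _).some ≪≫ (w.nonempty_θ_iso Y).some⟩⟩
  · simpa using F.ge_pow n 0 _ (E.ge_zero_θ Y)
  · simpa using F.le_pow n 0 _ (E.le_zero_θ Y)

lemma heartProp_iff (t : TStructure T) (A : X) :
    E.heartProp t A ↔ (∀ n, t.IsLE (w.ω.obj ((F.piece n).obj A)) n) ∧
      ∀ n, t.IsGE (w.ω.obj ((F.piece n).obj A)) n := by
  have e (n : ℤ) := (w.nonempty_gr_iso n A).some
  refine and_congr (forall_congr' fun n => ?_) (forall_congr' fun n => ?_)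
  · rw [(t.le n).prop_iff_of_iso (e n), t.le_iff_isLE]
  · rw [(t.ge n).prop_iff_of_iso (e n), t.ge_iff_isGE]

/-- By naturality of `α`, the two maps are conjugate through the isomorphisms `ω(α)`. This spreads
`bijective_map` from filtration degree zero to all degrees. -/
lemma bijective_map_iff_s (A B : X) :
    Function.Bijective (fun f : A ⟶ B => w.ω.map f) ↔
      Function.Bijective (fun f : F.s.functor.obj A ⟶ F.s.functor.obj B => w.ω.map f) := by
  have e : ((fun f : F.s.functor.obj A ⟶ F.s.functor.obj B => w.ω.map f) ∘
      fun f : A ⟶ B => F.s.functor.map f) =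
      (Iso.homCongr (asIso (w.ω.map (F.α.app A))) (asIso (w.ω.map (F.α.app B)))) ∘
        fun f : A ⟶ B => w.ω.map f := by
    funext f
    have h := F.α.naturality f
    dsimp at h
    change w.ω.map (F.s.functor.map f) =
      inv (w.ω.map (F.α.app A)) ≫ w.ω.map f ≫ w.ω.map (F.α.app B)
    rw [IsIso.eq_inv_comp, ← Functor.map_comp, ← Functor.map_comp, h]
  rw [← Function.Bijective.of_comp_iff _ (F.s.fullyFaithfulFunctor.map_bijective A B),
    ← Function.Bijective.of_comp_iff' (Iso.homCongr (asIso (w.ω.map (F.α.app A)))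
      (asIso (w.ω.map (F.α.app B)))).bijective, ← e]

lemma bijective_map_of_iso {A B A' B' : X} (a : A ≅ A') (b : B ≅ B')
    (h : Function.Bijective (fun f : A ⟶ B => w.ω.map f)) :
    Function.Bijective (fun f : A' ⟶ B' => w.ω.map f) := by
  have := (Iso.homCongr (w.ω.mapIso a) (w.ω.mapIso b)).bijective.comp
    (h.comp (Iso.homCongr a b).symm.bijective)
  exact bijective_of_eq this (fun f => by simp [Iso.homCongr, ← Functor.map_comp])

lemma bijective_map' (n : ℤ) : ∀ ⦃A B : X⦄, F.le n A → F.ge n B →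
    Function.Bijective (fun f : A ⟶ B => w.ω.map f) := by
  refine int_induct (p := fun n => ∀ ⦃A B : X⦄, F.le n A → F.ge n B →
    Function.Bijective (fun f : A ⟶ B => w.ω.map f)) w.bijective_map
    (fun n => ⟨fun h A B hA hB => ?_, fun h A B hA hB => ?_⟩) n
  · obtain ⟨A', ⟨a⟩⟩ := F.exists_s A
    obtain ⟨B', ⟨b⟩⟩ := F.exists_s B
    exact w.bijective_map_of_iso a b ((w.bijective_map_iff_s A' B').1
      (h ((F.le_s n A').1 ((F.le _).prop_of_iso a.symm hA))
        ((F.ge_s n B').1 ((F.ge _).prop_of_iso b.symm hB))))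
  · exact (w.bijective_map_iff_s A B).2 (h ((F.le_s n A).2 hA) ((F.ge_s n B).2 hB))

lemma isZero_of_isZero_ω {n : ℤ} {A : X} (h₁ : F.ge n A) (h₂ : F.le n A)
    (h : IsZero (w.ω.obj A)) : IsZero A := by
  rw [IsZero.iff_id_eq_zero]
  exact (w.bijective_map' n h₂ h₁).1 (h.eq_of_src _ _)

variable (t : TStructure T)

lemma isLE_ω (b : ℤ) (A : X) (hA : ∀ i, t.IsLE (w.ω.obj ((F.piece i).obj A)) b) :
    t.IsLE (w.ω.obj A) b := by
  let P : ObjectProperty X := (t.le b).inverseImage w.ω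
  have : P.IsTriangulatedClosed₂ := .mk' (fun S hS h₁ h₃ =>
    (t.isLE₂ _ (w.ω.map_distinguished _ hS) b ⟨h₁⟩ ⟨h₃⟩).le)
  exact ⟨prop_of_pieces P (fun A hA => (t.isLE_of_isZero (w.ω.map_isZero hA) b).le) A
    (fun i => (hA i).le)⟩

lemma isGE_ω (a : ℤ) (A : X) (hA : ∀ i, t.IsGE (w.ω.obj ((F.piece i).obj A)) a) :
    t.IsGE (w.ω.obj A) a := by
  let P : ObjectProperty X := (t.ge a).inverseImage w.ω
  have : P.IsTriangulatedClosed₂ := .mk' (fun S hS h₁ h₃ =>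
    (t.isGE₂ _ (w.ω.map_distinguished _ hS) a ⟨h₁⟩ ⟨h₃⟩).ge)
  exact ⟨prop_of_pieces P (fun A hA => (t.isGE_of_isZero (w.ω.map_isZero hA) a).ge) A
    (fun i => (hA i).ge)⟩

variable {t}

lemma isLE_ω_of_le {b : ℤ} {A : X} (hA : E.heartProp t A) (hb : F.le b A) :
    t.IsLE (w.ω.obj A) b := by
  refine w.isLE_ω t b A (fun i => ?_)
  by_cases h : b < i
  · exact t.isLE_of_isZero (w.ω.map_isZero (F.isZero_piece_of_le hb h)) b
  · have := ((w.heartProp_iff t A).1 hA).1 i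
    exact t.isLE_of_le _ i b

lemma isGE_ω_of_ge {a : ℤ} {A : X} (hA : E.heartProp t A) (ha : F.ge a A) :
    t.IsGE (w.ω.obj A) a := by
  refine w.isGE_ω t a A (fun i => ?_)
  by_cases h : i < a
  · exact t.isGE_of_isZero (w.ω.map_isZero (F.isZero_piece_of_ge ha h)) a
  · have := ((w.heartProp_iff t A).1 hA).2 i
    exact t.isGE_of_ge _ a i

include w in
lemma heartProp_σge {A : X} (hA : E.heartProp t A) (n : ℤ) : E.heartProp t ((F.σge n).obj A) := by
  rw [w.heartProp_iff] at hA ⊢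
  exact ⟨fun i => ⟨piece_prop_σge ((t.le i).inverseImage w.ω)
      (fun A hA => (t.isLE_of_isZero (w.ω.map_isZero hA) i).le) (hA.1 i).le n⟩,
    fun i => ⟨piece_prop_σge ((t.ge i).inverseImage w.ω)
      (fun A hA => (t.isGE_of_isZero (w.ω.map_isZero hA) i).ge) (hA.2 i).ge n⟩⟩

include w in
lemma heartProp_σle {A : X} (hA : E.heartProp t A) (n : ℤ) : E.heartProp t ((F.σle n).obj A) := by
  rw [w.heartProp_iff] at hA ⊢
  exact ⟨fun i => ⟨piece_prop_σle ((t.le i).inverseImage w.ω)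
      (fun A hA => (t.isLE_of_isZero (w.ω.map_isZero hA) i).le) (hA.1 i).le n⟩,
    fun i => ⟨piece_prop_σle ((t.ge i).inverseImage w.ω)
      (fun A hA => (t.isGE_of_isZero (w.ω.map_isZero hA) i).ge) (hA.2 i).ge n⟩⟩

lemma isLE_piece {A : X} (hA : E.heartProp t A) (n : ℤ) :
    t.IsLE (w.ω.obj ((F.piece n).obj A)) n := ((w.heartProp_iff t A).1 hA).1 n

lemma isGE_piece {A : X} (hA : E.heartProp t A) (n : ℤ) :
    t.IsGE (w.ω.obj ((F.piece n).obj A)) n := ((w.heartProp_iff t A).1 hA).2 n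

/-- An object of `X(≥ n) ∩ X(≤ n)` lies in the heart if its image is concentrated in degree `n`. -/
lemma heartProp_of_isConcentrated {n : ℤ} {A : X} (h₁ : F.ge n A) (h₂ : F.le n A)
    (h₃ : t.IsLE (w.ω.obj A) n) (h₄ : t.IsGE (w.ω.obj A) n) : E.heartProp t A := by
  rw [w.heartProp_iff]
  refine ⟨fun i => ?_, fun i => ?_⟩ <;> rcases lt_trichotomy i n with h | rfl | h
  · exact t.isLE_of_isZero (w.ω.map_isZero (F.isZero_piece_of_ge h₁ h)) i
  · exact t.isLE_of_iso (w.ω.mapIso (F.pieceIso h₁ h₂)).symm i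
  · exact t.isLE_of_isZero (w.ω.map_isZero (F.isZero_piece_of_le h₂ h)) i
  · exact t.isGE_of_isZero (w.ω.map_isZero (F.isZero_piece_of_ge h₁ h)) i
  · exact t.isGE_of_iso (w.ω.mapIso (F.pieceIso h₁ h₂)).symm i
  · exact t.isGE_of_isZero (w.ω.map_isZero (F.isZero_piece_of_le h₂ h)) i

end Forgetful

end Enhancement

end FCategory

end

/-! ### Cohomology of objects which are concentrated in one degree -/

section

variable {T : Type u} [Category.{v} T] [Preadditive T] [HasZeroObject T] [HasShift T ℤ]
  [∀ n : ℤ, (shiftFunctor T n).Additive] [Pretriangulated T] [IsTriangulated T]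
  (t : TStructure T)

/-- An object of the heart is its own zeroth cohomology. -/
noncomputable def tH0Iso (Y : T) [t.IsLE Y 0] [t.IsGE Y 0] : ((tH0 t).obj Y).obj ≅ Y :=
  haveI : IsIso ((t.truncLEι 0).app Y) := (t.isLE_iff_isIso_truncLEι_app 0 Y).1 inferInstance
  haveI : t.IsGE ((t.truncLE 0).obj Y) 0 := t.isGE_of_iso (show Y ≅ (t.truncLE 0).obj Y from (asIso ((t.truncLEι 0).app Y)).symm) 0
  haveI : IsIso ((t.truncGEπ 0).app ((t.truncLE 0).obj Y)) :=
    (t.isGE_iff_isIso_truncGEπ_app 0 _).1 inferInstance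
  (asIso ((t.truncGEπ 0).app ((t.truncLE 0).obj Y))).symm ≪≫ asIso ((t.truncLEι 0).app Y)

lemma tH0Iso_hom_naturality {Y Z : T} [t.IsLE Y 0] [t.IsGE Y 0] [t.IsLE Z 0] [t.IsGE Z 0]
    (f : Y ⟶ Z) : ((tH0 t).map f).hom ≫ (tH0Iso t Z).hom = (tH0Iso t Y).hom ≫ f := by
  have i₁ : IsIso ((t.truncLEι 0).app Y) := (t.isLE_iff_isIso_truncLEι_app 0 Y).1 inferInstance
  have i₂ : IsIso ((t.truncLEι 0).app Z) := (t.isLE_iff_isIso_truncLEι_app 0 Z).1 inferInstance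
  have : t.IsGE ((t.truncLE 0).obj Y) 0 := t.isGE_of_iso (show Y ≅ (t.truncLE 0).obj Y from (asIso ((t.truncLEι 0).app Y)).symm) 0
  have : t.IsGE ((t.truncLE 0).obj Z) 0 := t.isGE_of_iso (show Z ≅ (t.truncLE 0).obj Z from (asIso ((t.truncLEι 0).app Z)).symm) 0
  have i₃ : IsIso ((t.truncGEπ 0).app ((t.truncLE 0).obj Y)) :=
    (t.isGE_iff_isIso_truncGEπ_app 0 _).1 inferInstance
  have i₄ : IsIso ((t.truncGEπ 0).app ((t.truncLE 0).obj Z)) :=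
    (t.isGE_iff_isIso_truncGEπ_app 0 _).1 inferInstance
  have e₁ := (t.truncGEπ 0).naturality ((t.truncLE 0).map f)
  have e₂ := (t.truncLEι 0).naturality f
  dsimp at e₁ e₂
  change (t.truncGE 0).map ((t.truncLE 0).map f) ≫
      inv ((t.truncGEπ 0).app ((t.truncLE 0).obj Z)) ≫ _ =
    (inv ((t.truncGEπ 0).app ((t.truncLE 0).obj Y)) ≫ (t.truncLEι 0).app Y) ≫ f
  rw [← cancel_epi ((t.truncGEπ 0).app ((t.truncLE 0).obj Y)), ← reassoc_of% e₁,
    IsIso.hom_inv_id_assoc, Category.assoc, IsIso.hom_inv_id_assoc]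
  exact e₂

lemma bijective_tH0_map (Y Z : T) [t.IsLE Y 0] [t.IsGE Y 0] [t.IsLE Z 0] [t.IsGE Z 0] :
    Function.Bijective (fun f : Y ⟶ Z => (tH0 t).map f) := by
  have h : Function.Bijective (fun f : Y ⟶ Z => ((tH0 t).map f).hom) :=
    bijective_of_eq (Iso.homCongr (tH0Iso t Y) (tH0Iso t Z)).symm.bijective (fun f => by
      change _ = (tH0Iso t Y).hom ≫ f ≫ (tH0Iso t Z).inv
      rw [← Category.assoc, Iso.eq_comp_inv]
      exact tH0Iso_hom_naturality t f)
  exact (Function.Bijective.of_comp_iff' (t.heart.fullyFaithfulι.map_bijective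
    ((tH0 t).obj Y) ((tH0 t).obj Z)) _).1 h

lemma bijective_tH_map (n : ℤ) (Y Z : T) (hY : t.IsLE Y n) (hY' : t.IsGE Y n) (hZ : t.IsLE Z n)
    (hZ' : t.IsGE Z n) : Function.Bijective (fun f : Y ⟶ Z => (tH t n).map f) := by
  have := t.isLE_shift Y n n 0 (by lia)
  have := t.isGE_shift Y n n 0 (by lia)
  have := t.isLE_shift Z n n 0 (by lia)
  have := t.isGE_shift Z n n 0 (by lia)
  exact (bijective_tH0_map t (Y⟦n⟧) (Z⟦n⟧)).comp
    ((Functor.FullyFaithful.ofFullyFaithful (shiftFunctor T n)).map_bijective Y Z)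

lemma exists_tH_iso (n : ℤ) (H : HeartCat t) :
    ∃ Y : T, t.IsLE Y n ∧ t.IsGE Y n ∧ Nonempty ((tH t n).obj Y ≅ H) := by
  obtain ⟨h₁, h₂⟩ := (t.mem_heart_iff _).1 H.property
  let e : H.obj⟦-n⟧⟦n⟧ ≅ H.obj := shiftNegShift H.obj n
  have := t.isLE_of_iso e.symm 0
  have := t.isGE_of_iso e.symm 0
  exact ⟨H.obj⟦-n⟧, t.isLE_shift H.obj 0 (-n) n (by lia), t.isGE_shift H.obj 0 (-n) n (by lia),
    ⟨t.heart.fullyFaithfulι.preimageIso (tH0Iso t (H.obj⟦-n⟧⟦n⟧) ≪≫ e)⟩⟩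

lemma isZero_of_isZero_tH (n : ℤ) (Y : T) (hY : t.IsLE Y n) (hY' : t.IsGE Y n)
    (h : IsZero ((tH t n).obj Y)) : IsZero Y := by
  rw [IsZero.iff_id_eq_zero]
  exact (bijective_tH_map t n Y Y hY hY' hY hY').1 (h.eq_of_src _ _)

lemma isIso_of_isIso_tH_map (n : ℤ) {Y Z : T} (hY : t.IsLE Y n) (hY' : t.IsGE Y n)
    (hZ : t.IsLE Z n) (hZ' : t.IsGE Z n) (f : Y ⟶ Z) (hf : IsIso ((tH t n).map f)) : IsIso f := by
  obtain ⟨g, hg⟩ := (bijective_tH_map t n Z Y hZ hZ' hY hY').2 (inv ((tH t n).map f))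
  dsimp only at hg
  refine ⟨g, (bijective_tH_map t n Y Y hY hY' hY hY').1 ?_,
    (bijective_tH_map t n Z Z hZ hZ' hZ hZ').1 ?_⟩
  · dsimp only
    rw [Functor.map_comp, hg, IsIso.hom_inv_id, CategoryTheory.Functor.map_id]
  · dsimp only
    rw [Functor.map_comp, hg, IsIso.inv_hom_id, CategoryTheory.Functor.map_id]

end

/-! ### Vanishing of morphisms in the heart of the induced t-structure. -/

section

variable {T : Type u} [Category.{v} T] [Preadditive T] [HasZeroObject T] [HasShift T ℤ]
  [∀ n : ℤ, (shiftFunctor T n).Additive] [Pretriangulated T]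
  {X : Type u'} [Category.{v'} X] [Preadditive X] [HasZeroObject X] [HasShift X ℤ]
  [∀ n : ℤ, (shiftFunctor X n).Additive] [Pretriangulated X]

namespace FCategory

namespace Enhancement

namespace Forgetful

variable {F : FCategory X} {E : F.Enhancement T} (w : E.Forgetful) {t : TStructure T}

include w in
-- In the heart, filtration degree bounds cohomological degree: `ω` maps these morphisms injectively
-- to morphisms from `T^{≤ n}` to `T^{≥ n + 1}`.
lemma heart_hom_eq_zero {n : ℤ} {A B : X} (hA : E.heartProp t A) (hA' : F.le n A)
    (hB : E.heartProp t B) (hB' : F.ge (n + 1) B) (f : A ⟶ B) : f = 0 := by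
  apply (w.bijective_map' n hA' (F.ge_succ_le n _ hB')).1
  dsimp only
  rw [Functor.map_zero]
  exact t.zero_of_isLE_of_isGE _ n (n + 1) (by lia) (w.isLE_ω_of_le hA hA')
    (w.isGE_ω_of_ge hB hB')

include w in
/-- Vanishing of morphisms of degree `m` in the heart. -/
lemma heart_hom_shift_eq_zero {n : ℤ} {A C B : X} (hA : E.heartProp t A) (hA' : F.le n A)
    (hC : E.heartProp t C) (m : ℤ) (hC' : F.ge (n + m + 1) C) (hm : 0 ≤ m) (e : B ≅ C⟦m⟧)
    (f : A ⟶ B) : f = 0 := by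
  have hB : F.ge n B := (F.ge n).prop_of_iso e.symm
    (F.ge_shift n m C (F.ge_antitone (by lia) _ hC'))
  apply (w.bijective_map' n hA' hB).1
  dsimp only
  rw [Functor.map_zero]
  have h₁ := w.isGE_ω_of_ge hC hC'
  have h₂ := t.isGE_shift (w.ω.obj C) (n + m + 1) m (n + 1) (by lia)
  exact t.zero_of_isLE_of_isGE _ n (n + 1) (by lia) (w.isLE_ω_of_le hA hA')
    (t.isGE_of_iso (show (w.ω.obj C)⟦m⟧ ≅ w.ω.obj B from
      (w.ω.mapIso e ≪≫ (w.ω.commShiftIso m).app C).symm) (n + 1))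

include w in
/-- A morphism from `A` to a shift of `B` is determined by its composition with the projection of
`B` to its lowest piece. -/
lemma eq_zero_of_comp_σleπ_shift {n : ℤ} {A B : X} (hA : E.heartProp t A) (hA' : F.le n A)
    (hB : E.heartProp t B) (f : A ⟶ B⟦(1 : ℤ)⟧)
    (hf : f ≫ ((F.σleπ (n + 1)).app B)⟦(1 : ℤ)⟧' = 0) : f = 0 := by
  obtain ⟨y, rfl⟩ := Triangle.coyoneda_exact₂ _ (Triangle.shift_distinguished _
    (F.σ_distinguished (n + 1) B) 1) f (by
      change f ≫ (Int.negOnePow 1 • ((F.σleπ (n + 1)).app B)⟦(1 : ℤ)⟧') = 0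
      rw [Linear.comp_units_smul, hf, smul_zero])
  have : y = 0 := w.heart_hom_shift_eq_zero hA hA' (w.heartProp_σge hB (n + 1 + 1)) 1
    (F.ge_σge _ _) (by lia) (Iso.refl _) y
  exact (congrArg (· ≫ _) this).trans zero_comp

include w in
-- The degree two analogue: the first filtration step of `B` that cannot be seen from `A` moves up
-- by one. It is used for the obstruction to adding a new lowest piece.
lemma eq_zero_of_comp_σleπ_shift_shift {n : ℤ} {A B : X} (hA : E.heartProp t A) (hA' : F.le n A)
    (hB : E.heartProp t B) (f : A ⟶ B⟦(1 : ℤ)⟧⟦(1 : ℤ)⟧)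
    (hf : f ≫ ((F.σleπ (n + 1 + 1)).app B)⟦(1 : ℤ)⟧'⟦(1 : ℤ)⟧' = 0) : f = 0 := by
  obtain ⟨y, rfl⟩ := Triangle.coyoneda_exact₂ _ (Triangle.shift_distinguished _
    (Triangle.shift_distinguished _ (F.σ_distinguished (n + 1 + 1) B) 1) 1) f (by
      change f ≫ (Int.negOnePow 1 • (Int.negOnePow 1 •
        ((F.σleπ (n + 1 + 1)).app B)⟦(1 : ℤ)⟧')⟦(1 : ℤ)⟧') = 0
      rw [Functor.map_units_smul, smul_smul, Linear.comp_units_smul, hf, smul_zero])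
  have : y = 0 := w.heart_hom_shift_eq_zero hA hA' (w.heartProp_σge hB (n + 1 + 1 + 1)) 2
    (by rw [show n + 2 + 1 = n + 1 + 1 + 1 by ring]; exact F.ge_σge _ _) (by lia)
    ((shiftFunctorAdd' X (1 : ℤ) 1 2 (by lia)).symm.app _) y
  exact (congrArg (· ≫ _) this).trans zero_comp

end Forgetful

end Enhancement

end FCategory

end

/-! ### Objects of the heart and their pieces -/

section

variable {T : Type u} [Category.{v} T] [Preadditive T] [HasZeroObject T] [HasShift T ℤ]
  [∀ n : ℤ, (shiftFunctor T n).Additive] [Pretriangulated T]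
  {X : Type u'} [Category.{v'} X] [Preadditive X] [HasZeroObject X] [HasShift X ℤ]
  [∀ n : ℤ, (shiftFunctor X n).Additive] [Pretriangulated X]

namespace FCategory

section

variable (F : FCategory X)

lemma σge_map_σgeι (n : ℤ) (A : X) :
    (F.σge n).map ((F.σgeι n).app A) = (F.σgeι n).app ((F.σge n).obj A) :=
  (F.bijective_comp_σgeι A (F.ge_σge n _)).1 ((F.σgeι n).naturality ((F.σgeι n).app A))

lemma piece_map_σgeι (n : ℤ) (A : X) : (F.piece n).map ((F.σgeι n).app A) =
    (F.σle n).map ((F.σgeι n).app ((F.σge n).obj A)) :=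
  congrArg (F.σle n).map (F.σge_map_σgeι n A)

lemma isIso_σle_map_σgeι {n : ℤ} {A : X} (hA : F.ge n A) :
    IsIso ((F.σle n).map ((F.σgeι n).app A)) := by
  have := F.isIso_σgeι hA
  infer_instance

/-- A family of morphisms between the pieces of two objects which is compatible with the
connecting morphisms. -/
structure PieceHom (A B : X) where
  /-- The morphisms between the pieces. -/
  app (i : ℤ) : (F.piece i).obj A ⟶ (F.piece i).obj B
  comm (i : ℤ) : (F.pieceδ i).app A ≫ (app (i + 1))⟦(1 : ℤ)⟧' = app i ≫ (F.pieceδ i).app B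

variable {F}

open Classical in
/-- The restriction of a family of morphisms between pieces to the truncations `σ_{≥ n}`. -/
noncomputable def PieceHom.σge {A B : X} (ψ : F.PieceHom A B) (n : ℤ) :
    F.PieceHom ((F.σge n).obj A) ((F.σge n).obj B) where
  app i := if h : n ≤ i then
      (F.piece i).map ((F.σgeι n).app A) ≫ ψ.app i ≫
        (haveI := F.isIso_piece_map_σgeι h B
        inv ((F.piece i).map ((F.σgeι n).app B))) else 0
  comm i := by
    by_cases h : n ≤ i
    · rw [dif_pos h, dif_pos (show n ≤ i + 1 by lia)]
      have := F.isIso_piece_map_σgeι (show n ≤ i + 1 by lia) B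
      have := F.isIso_piece_map_σgeι h B
      have h₁ := (F.pieceδ i).naturality ((F.σgeι n).app A)
      have h₂ := (F.pieceδ i).naturality ((F.σgeι n).app B)
      dsimp at h₁ h₂
      rw [← cancel_mono (((F.piece (i + 1)).map ((F.σgeι n).app B))⟦(1 : ℤ)⟧')]
      simp only [Category.assoc, ← Functor.map_comp, IsIso.inv_hom_id, Category.comp_id]
      rw [← h₂, IsIso.inv_hom_id_assoc, ← ψ.comm, Functor.map_comp, ← reassoc_of% h₁]
    · exact (F.isZero_piece_of_ge (F.ge_σge n A) (by lia)).eq_of_src _ _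

lemma PieceHom.σge_app {A B : X} (ψ : F.PieceHom A B) {n i : ℤ} (h : n ≤ i) :
    (ψ.σge n).app i ≫ (F.piece i).map ((F.σgeι n).app B) =
      (F.piece i).map ((F.σgeι n).app A) ≫ ψ.app i := by
  have := F.isIso_piece_map_σgeι h B
  have e : (ψ.σge n).app i = (F.piece i).map ((F.σgeι n).app A) ≫ ψ.app i ≫
      inv ((F.piece i).map ((F.σgeι n).app B)) := dif_pos h
  rw [e, Category.assoc, Category.assoc, IsIso.inv_hom_id, Category.comp_id]

end

namespace Enhancement

namespace Forgetful

variable {F : FCategory X} {E : F.Enhancement T} (w : E.Forgetful) {t : TStructure T}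

include w

/-- If `f` vanishes on `σ_{≥ a + 1}` and on `σ_{≤ a}`, it factors as a morphism `σ_{≤ a} A ⟶ σ_{≥ a
+ 1} B`, and there are none in the heart. The first vanishing is the inductive one. -/
lemma eq_zero_of_piece_map_aux (d : ℕ) : ∀ (a : ℤ) (A B : X), E.heartProp t A → E.heartProp t B →
    F.ge a A → F.le (a + d - 1) A → F.ge a B → ∀ f : A ⟶ B,
      (∀ i, (F.piece i).map f = 0) → f = 0 := by
  induction d with
  | zero =>
    intro a A B _ _ hA hA' _ f _
    exact (F.isZero_of_ge_of_le (m := a - 1) (by lia) hA (by simpa using hA')).eq_of_src _ _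
  | succ d ih =>
    intro a A B hA hB hA₁ hA₂ hB₁ f hf
    have h₁ : (F.σge (a + 1)).map f = 0 := by
      refine ih (a + 1) _ _ (w.heartProp_σge hA _) (w.heartProp_σge hB _) (F.ge_σge _ _) ?_
        (F.ge_σge _ _) _ (fun i => ?_)
      · exact F.le_σge (by rwa [show a + 1 + (d : ℤ) - 1 = a + (d + 1 : ℕ) - 1 by push_cast; ring])
      · by_cases hi : a + 1 ≤ i
        · have := F.isIso_piece_map_σgeι hi B
          have e := (F.σgeι (a + 1)).naturality f
          dsimp at e
          rw [← cancel_mono ((F.piece i).map ((F.σgeι (a + 1)).app B)), ← Functor.map_comp, e,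
            Functor.map_comp, hf, comp_zero, zero_comp]
        · exact (F.isZero_piece_of_ge (F.ge_σge _ A) (by lia)).eq_of_src _ _
    have h₂ : (F.σle a).map f = 0 := by
      have := F.isIso_σle_map_σgeι hA₁
      have e := (F.σgeι a).naturality f
      dsimp at e
      have hf' : (F.σle a).map ((F.σge a).map f) = 0 := hf a
      rw [← cancel_epi ((F.σle a).map ((F.σgeι a).app A)), ← Functor.map_comp, ← e,
        Functor.map_comp, hf', comp_zero, zero_comp]
    have e₁ := (F.σgeι (a + 1)).naturality f
    have e₂ := (F.σleπ a).naturality f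
    dsimp at e₁ e₂
    rw [h₁, zero_comp] at e₁
    rw [h₂, comp_zero] at e₂
    obtain ⟨g, rfl⟩ := DistTriang.desc₂ (F.σ_distinguished a A) f e₁.symm
    have h₃ : g ≫ (F.σleπ a).app B = 0 :=
      (F.bijective_σleπ_comp A (F.le_σle a B)).1 (by
        dsimp only
        rw [comp_zero, ← Category.assoc, e₂])
    obtain ⟨k, rfl⟩ := DistTriang.lift₂ (F.σ_distinguished a B) g h₃
    have : k = 0 := w.heart_hom_eq_zero (w.heartProp_σle hA a) (F.le_σle a A)
      (w.heartProp_σge hB _) (F.ge_σge _ _) k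
    rw [this, zero_comp, comp_zero]

/-- A morphism in the heart which vanishes on all pieces vanishes. -/
lemma eq_zero_of_piece_map {A B : X} (hA : E.heartProp t A) (hB : E.heartProp t B) (f : A ⟶ B)
    (hf : ∀ i, (F.piece i).map f = 0) : f = 0 := by
  obtain ⟨a, ha⟩ := F.exists_ge A
  obtain ⟨a', ha'⟩ := F.exists_ge B
  obtain ⟨b, hb⟩ := F.exists_le A
  exact w.eq_zero_of_piece_map_aux (b + 1 - min a a').toNat (min a a') A B hA hB
    (F.ge_antitone (by lia) _ ha) (F.le_monotone (by lia) _ hb) (F.ge_antitone (by lia) _ ha') f hf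

/-- The inductively constructed morphism on `σ_{≥ a + 1}` and the given one on the lowest piece are
completed to a morphism of truncation triangles. -/
lemma exists_of_pieceHom_aux (d : ℕ) : ∀ (a : ℤ) (A B : X), E.heartProp t A → E.heartProp t B →
    F.ge a A → F.le (a + d - 1) A → F.ge a B → ∀ ψ : F.PieceHom A B,
      ∃ f : A ⟶ B, ∀ i, (F.piece i).map f = ψ.app i := by
  induction d with
  | zero =>
    intro a A B _ _ hA hA' _ ψ
    have h0 (i : ℤ) : IsZero ((F.piece i).obj A) := by
      by_cases h : i < a
      · exact F.isZero_piece_of_ge hA h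
      · exact F.isZero_piece_of_le hA' (by push_cast; lia)
    exact ⟨0, fun i => (h0 i).eq_of_src _ _⟩
  | succ d ih =>
    intro a A B hA hB hA₁ hA₂ hB₁ ψ
    obtain ⟨f', hf'⟩ := ih (a + 1) _ _ (w.heartProp_σge hA _) (w.heartProp_σge hB _) (F.ge_σge _ _)
      (F.le_σge (by rwa [show a + 1 + (d : ℤ) - 1 = a + (d + 1 : ℕ) - 1 by push_cast; ring]))
      (F.ge_σge _ _) (ψ.σge (a + 1))
    have i₁ := F.isIso_σle_map_σgeι hA₁
    have i₂ := F.isIso_σle_map_σgeι hB₁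
    -- Since nothing lies below `a`, `σ_{≤ a}` is the piece in degree `a`, up to the isomorphism
    -- induced by `σ_{≥ a} A ⟶ A`.
    let f'' : (F.σle a).obj A ⟶ (F.σle a).obj B :=
      inv ((F.σle a).map ((F.σgeι a).app A)) ≫ ψ.app a ≫ (F.σle a).map ((F.σgeι a).app B)
    have hf'' : (F.σle a).map ((F.σgeι a).app A) ≫ f'' =
        ψ.app a ≫ (F.σle a).map ((F.σgeι a).app B) := IsIso.hom_inv_id_assoc _ _
    have hσ : (F.σle (a + 1)).map f' = ψ.app (a + 1) := by
      have i₃ := F.isIso_σle_map_σgeι (F.ge_σge (a + 1) A)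
      have i₄ := F.isIso_σle_map_σgeι (F.ge_σge (a + 1) B)
      have e := (F.σgeι (a + 1)).naturality f'
      have e' := congrArg (F.σle (a + 1)).map e
      have e'' := ψ.σge_app (le_refl (a + 1))
      rw [F.piece_map_σgeι, F.piece_map_σgeι, ← hf'] at e''
      rw [Functor.map_comp, Functor.map_comp] at e'
      exact (cancel_epi ((F.σle (a + 1)).map ((F.σgeι (a + 1)).app ((F.σge (a + 1)).obj A)))).1
        (e'.symm.trans e'')
    -- A degree one morphism out of the lowest piece is detected on the next piece of its target,
    -- and there the square commutes by compatibility of `ψ` with the connecting morphisms.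
    have hcomm : (F.σδ a).app A ≫ f'⟦(1 : ℤ)⟧' = f'' ≫ (F.σδ a).app B := by
      rw [← sub_eq_zero]
      refine w.eq_zero_of_comp_σleπ_shift (w.heartProp_σle hA a) (F.le_σle a A)
        (w.heartProp_σge hB (a + 1)) _ ?_
      have e₁ := F.pieceδ_app a A
      have e₂ := F.pieceδ_app a B
      have e₃ : (F.pieceδ a).app A ≫ ((F.σle (a + 1)).map f')⟦(1 : ℤ)⟧' =
        ψ.app a ≫ (F.pieceδ a).app B := (congrArg (fun k => _ ≫ k⟦(1 : ℤ)⟧') hσ).trans (ψ.comm a)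
      have e₄ : f' ≫ (F.σleπ (a + 1)).app ((F.σge (a + 1)).obj B) =
        (F.σleπ (a + 1)).app ((F.σge (a + 1)).obj A) ≫ (F.σle (a + 1)).map f' :=
          (F.σleπ (a + 1)).naturality f'
      have aux {C₁ C₂ C₃ C₄ D₁ D₂ D₃ D₄ : X} (x : C₁ ⟶ C₂) (y : C₂ ⟶ C₃⟦(1 : ℤ)⟧) (z : C₃ ⟶ C₄)
          (x' : D₁ ⟶ D₂) (y' : D₂ ⟶ D₃⟦(1 : ℤ)⟧) (z' : D₃ ⟶ D₄) (k₁ : C₁ ⟶ D₁) (k₂ : C₂ ⟶ D₂)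
          (k₃ : C₃ ⟶ D₃) (k₄ : C₄ ⟶ D₄) (h₁ : x ≫ k₂ = k₁ ≫ x') (h₂ : k₃ ≫ z' = z ≫ k₄)
          (h₃ : (x ≫ y ≫ z⟦(1 : ℤ)⟧') ≫ k₄⟦(1 : ℤ)⟧' = k₁ ≫ x' ≫ y' ≫ z'⟦(1 : ℤ)⟧') [Epi x] :
          (y ≫ k₃⟦(1 : ℤ)⟧' - k₂ ≫ y') ≫ z'⟦(1 : ℤ)⟧' = 0 := by
        rw [← cancel_epi x, comp_zero, Preadditive.sub_comp, Preadditive.comp_sub, sub_eq_zero,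
          Category.assoc, Category.assoc, ← Functor.map_comp, h₂, Functor.map_comp,
          reassoc_of% h₁]
        simpa only [Category.assoc] using h₃
      rw [e₁, e₂] at e₃
      exact aux _ _ _ _ _ _ _ _ _ _ hf'' e₄ e₃
    obtain ⟨f, hf₁, hf₂⟩ : ∃ f : A ⟶ B,
        (F.σgeι (a + 1)).app A ≫ f = f' ≫ (F.σgeι (a + 1)).app B ∧
        (F.σleπ a).app A ≫ f'' = f ≫ (F.σleπ a).app B :=
      complete_distinguished_triangle_morphism₂ _ _ (F.σ_distinguished a A)
        (F.σ_distinguished a B) f' f'' hcomm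
    refine ⟨f, fun i => ?_⟩
    rcases lt_trichotomy i a with hi | rfl | hi
    · exact (F.isZero_piece_of_ge hA₁ hi).eq_of_src _ _
    · have e : (F.σle i).map f = f'' := (F.bijective_σleπ_comp A (F.le_σle i B)).1
        (((F.σleπ i).naturality f).symm.trans hf₂.symm)
      have e₁ := congrArg (F.σle i).map ((F.σgeι i).naturality f)
      rw [Functor.map_comp, Functor.map_comp] at e₁
      exact (cancel_mono ((F.σle i).map ((F.σgeι i).app B))).1
        (e₁.trans ((congrArg (_ ≫ ·) e).trans hf''))
    · have := F.isIso_piece_map_σgeι (show a + 1 ≤ i by lia) A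
      rw [← cancel_epi ((F.piece i).map ((F.σgeι (a + 1)).app A)), ← Functor.map_comp, hf₁,
        Functor.map_comp, hf', ψ.σge_app (by lia)]

/-- A family of morphisms between the pieces of two objects of the heart is induced by a morphism. -/
lemma exists_of_pieceHom {A B : X} (hA : E.heartProp t A) (hB : E.heartProp t B)
    (ψ : F.PieceHom A B) : ∃ f : A ⟶ B, ∀ i, (F.piece i).map f = ψ.app i := by
  obtain ⟨a, ha⟩ := F.exists_ge A
  obtain ⟨a', ha'⟩ := F.exists_ge B
  obtain ⟨b, hb⟩ := F.exists_le A
  exact w.exists_of_pieceHom_aux (b + 1 - min a a').toNat (min a a') A B hA hB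
    (F.ge_antitone (by lia) _ ha) (F.le_monotone (by lia) _ hb) (F.ge_antitone (by lia) _ ha') ψ

end Forgetful

end Enhancement

end FCategory

end

/-! ### Gluing objects of the heart from their pieces. -/

section

variable {T : Type u} [Category.{v} T] [Preadditive T] [HasZeroObject T] [HasShift T ℤ]
  [∀ n : ℤ, (shiftFunctor T n).Additive] [Pretriangulated T]
  {X : Type u'} [Category.{v'} X] [Preadditive X] [HasZeroObject X] [HasShift X ℤ]
  [∀ n : ℤ, (shiftFunctor X n).Additive] [Pretriangulated X]

lemma DistTriang.lift₃_shift {A B D : X} {f : A ⟶ B} {g : B ⟶ D} {h : D ⟶ A⟦(1 : ℤ)⟧}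
    (hT : Triangle.mk f g h ∈ distTriang X) {Y : X} (y : Y ⟶ D⟦(1 : ℤ)⟧)
    (hy : y ≫ h⟦(1 : ℤ)⟧' = 0) : ∃ b : Y ⟶ B⟦(1 : ℤ)⟧, b ≫ g⟦(1 : ℤ)⟧' = y := by
  obtain ⟨b, hb⟩ : ∃ b : Y ⟶ B⟦(1 : ℤ)⟧, y = b ≫ (-g⟦(1 : ℤ)⟧') :=
    Triangle.coyoneda_exact₃ _ (rot_of_distTriang _ (rot_of_distTriang _
      (rot_of_distTriang _ hT))) y ((Preadditive.comp_neg _ _).trans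
      ((congrArg Neg.neg hy).trans neg_zero))
  exact ⟨-b, by rw [hb, Preadditive.neg_comp, Preadditive.comp_neg]⟩

namespace FCategory

namespace Enhancement

namespace Forgetful

variable {F : FCategory X} {E : F.Enhancement T} (w : E.Forgetful) {t : TStructure T}

include w

/-- Adds a new lowest piece: `k` lifts to a degree one morphism `u : Y ⟶ A'⟦1⟧`, and the extension
classified by `u` has `Y` as its piece in degree `a`. -/
lemma exists_extension {a : ℤ} {A' Y : X} (hA' : E.heartProp t A') (hA'₁ : F.ge (a + 1) A')
    (hY : E.heartProp t Y) (hY₁ : F.ge a Y) (hY₂ : F.le a Y)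
    (k : Y ⟶ ((F.piece (a + 1)).obj A')⟦(1 : ℤ)⟧)
    (hk : k ≫ ((F.pieceδ (a + 1)).app A')⟦(1 : ℤ)⟧' = 0) :
    ∃ (A : X) (i : A' ⟶ A) (p : A ⟶ Y) (u : Y ⟶ A'⟦(1 : ℤ)⟧)
      (_ : Triangle.mk i p u ∈ distTriang X) (e : (F.piece a).obj A ⟶ Y) (_ : IsIso e),
      (F.pieceδ a).app A = e ≫ k ≫ ((F.piece (a + 1)).map i)⟦(1 : ℤ)⟧' := by
  have i₃ := F.isIso_σle_map_σgeι hA'₁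
  -- The obstruction to lifting `k` lies in the twice shifted `σ_{≥ a + 2} A'`, where only the piece
  -- in degree `a + 2` is seen from `Y`; on that piece it is the composition in `hk`.
  have hσ : k ≫ ((F.σle (a + 1)).map ((F.σgeι (a + 1)).app A'))⟦(1 : ℤ)⟧' ≫
      ((F.σδ (a + 1)).app A')⟦(1 : ℤ)⟧' = 0 := by
    refine w.eq_zero_of_comp_σleπ_shift_shift hY hY₂ (w.heartProp_σge hA' (a + 1 + 1)) _ ?_
    rw [F.pieceδ_app] at hk
    refine Eq.trans ?_ hk
    have aux {C₁ C₂ C₃ C₄ : X} (x : C₁ ⟶ C₂) (y : C₂ ⟶ C₃⟦(1 : ℤ)⟧) (z : C₃ ⟶ C₄)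
        (k : Y ⟶ C₁⟦(1 : ℤ)⟧) : (k ≫ x⟦(1 : ℤ)⟧' ≫ y⟦(1 : ℤ)⟧') ≫ z⟦(1 : ℤ)⟧'⟦(1 : ℤ)⟧' =
        k ≫ (x ≫ y ≫ z⟦(1 : ℤ)⟧')⟦(1 : ℤ)⟧' := by
      simp
    exact aux _ _ _ _
  obtain ⟨u, hu⟩ := DistTriang.lift₃_shift (F.σ_distinguished (a + 1) A')
    (k ≫ ((F.σle (a + 1)).map ((F.σgeι (a + 1)).app A'))⟦(1 : ℤ)⟧')
    ((Category.assoc _ _ _).trans hσ)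
  obtain ⟨A, i, p, hT⟩ := distinguished_cocone_triangle₂ u
  have hA₁ : F.ge a A := (F.ge a).ext_of_isTriangulatedClosed₂ _ hT (F.ge_succ_le a _ hA'₁) hY₁
  obtain ⟨j, hj⟩ := (F.bijective_comp_σgeι A hA'₁).2 i
  dsimp only at hj
  obtain ⟨c, hc₁, hc₂⟩ : ∃ c : Y ⟶ (F.σle a).obj A, p ≫ c = 𝟙 A ≫ (F.σleπ a).app A ∧
      u ≫ j⟦(1 : ℤ)⟧' = c ≫ (F.σδ a).app A :=
    complete_distinguished_triangle_morphism _ _ hT (F.σ_distinguished a A) j (𝟙 A)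
      ((Category.comp_id _).trans hj.symm)
  rw [Category.id_comp] at hc₁
  obtain ⟨q, hq⟩ := (F.bijective_σleπ_comp A hY₂).2 p
  dsimp only at hq
  have hqc : q ≫ c = 𝟙 _ := (F.bijective_σleπ_comp A (F.le_σle a A)).1 (by
    dsimp only
    rw [← Category.assoc, hq, hc₁, Category.comp_id])
  -- The difference vanishes on `p`, so it factors through `A'⟦1⟧`, which lies in `X(≥ a + 1)` and
  -- has no morphisms to `Y`.
  have hcq : c ≫ q = 𝟙 _ := by
    rw [← sub_eq_zero]
    obtain ⟨z, hz⟩ := DistTriang.desc₃ hT (c ≫ q - 𝟙 Y) (by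
      rw [Preadditive.comp_sub, ← Category.assoc, hc₁, hq, Category.comp_id, sub_self])
    rw [hz, F.hom_eq_zero' a z (F.ge_shift _ 1 _ hA'₁) hY₂, comp_zero]
  have i₁ := F.isIso_σle_map_σgeι hA₁
  have iq : IsIso q := ⟨c, hqc, hcq⟩
  refine ⟨A, i, p, u, hT, (F.σle a).map ((F.σgeι a).app A) ≫ q,
    inferInstanceAs (IsIso ((F.σle a).map ((F.σgeι a).app A) ≫ q)), ?_⟩
  have hpi : (F.piece (a + 1)).map i = (F.σle (a + 1)).map ((F.σgeι (a + 1)).app A') ≫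
      (F.σle (a + 1)).map j := by
    have e : (F.σge (a + 1)).map i = (F.σgeι (a + 1)).app A' ≫ j := by
      apply (F.bijective_comp_σgeι A (F.ge_σge (a + 1) A')).1
      dsimp only
      rw [Category.assoc, hj]
      exact (F.σgeι (a + 1)).naturality i
    exact (congrArg (F.σle (a + 1)).map e).trans (Functor.map_comp _ _ _)
  have e₄ : j ≫ (F.σleπ (a + 1)).app ((F.σge (a + 1)).obj A) =
    (F.σleπ (a + 1)).app A' ≫ (F.σle (a + 1)).map j := (F.σleπ (a + 1)).naturality j
  have hδ : (F.σδ a).app A = q ≫ u ≫ j⟦(1 : ℤ)⟧' := by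
    rw [hc₂, ← Category.assoc, hqc, Category.id_comp]
  rw [F.pieceδ_app, hpi, hδ]
  have aux {C₁ C₂ C₃ C₄ C₅ C₆ C₇ : X} (x : C₁ ⟶ C₂) (q : C₂ ⟶ Y) (u : Y ⟶ C₃⟦(1 : ℤ)⟧)
      (j : C₃ ⟶ C₄) (π : C₄ ⟶ C₅) (k : Y ⟶ C₆⟦(1 : ℤ)⟧) (s : C₆ ⟶ C₇) (j' : C₇ ⟶ C₅)
      (π' : C₃ ⟶ C₇) (h₁ : j ≫ π = π' ≫ j') (h₂ : u ≫ π'⟦(1 : ℤ)⟧' = k ≫ s⟦(1 : ℤ)⟧') :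
      x ≫ (q ≫ u ≫ j⟦(1 : ℤ)⟧') ≫ π⟦(1 : ℤ)⟧' = (x ≫ q) ≫ k ≫ (s ≫ j')⟦(1 : ℤ)⟧' := by
    simp only [Category.assoc, ← Functor.map_comp, h₁]
    simp only [Functor.map_comp, reassoc_of% h₂]
  exact aux _ _ _ _ _ _ _ _ _ e₄ hu

/-- The object is built from the top filtration degree downwards, with one extension per step; `hδ`
removes the obstruction each time. -/
lemma exists_of_pieces_aux (Y : ℤ → X) (hY : ∀ i, E.heartProp t (Y i)) (hY₁ : ∀ i, F.ge i (Y i))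
    (hY₂ : ∀ i, F.le i (Y i)) (δ : ∀ i, Y i ⟶ (Y (i + 1))⟦(1 : ℤ)⟧)
    (hδ : ∀ i, δ i ≫ (δ (i + 1))⟦(1 : ℤ)⟧' = 0) (d : ℕ) : ∀ a : ℤ,
    (∀ i, a + d ≤ i → IsZero (Y i)) → ∃ (A : X) (_ : E.heartProp t A) (_ : F.ge a A)
      (e : ∀ i, (F.piece i).obj A ⟶ Y i), ∀ i, a ≤ i → IsIso (e i) ∧
        (F.pieceδ i).app A ≫ (e (i + 1))⟦(1 : ℤ)⟧' = e i ≫ δ i := by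
  induction d with
  | zero =>
    intro a ha
    have h0 : IsZero (0 : X) := isZero_zero X
    have h0' (i : ℤ) : IsZero ((F.piece i).obj (0 : X)) :=
      F.isZero_piece_of_ge ((F.ge (i + 1)).prop_of_isZero h0) (by lia)
    refine ⟨0, w.heartProp_of_isConcentrated (n := 0) ((F.ge 0).prop_of_isZero h0)
      ((F.le 0).prop_of_isZero h0) (t.isLE_of_isZero (w.ω.map_isZero h0) 0)
      (t.isGE_of_isZero (w.ω.map_isZero h0) 0), (F.ge a).prop_of_isZero h0, fun _ => 0,
      fun i hi => ⟨?_, (h0' i).eq_of_src _ _⟩⟩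
    exact (h0' i).isIso (ha i (by simpa using hi)) _
  | succ d ih =>
    intro a ha
    obtain ⟨A', hA', hA'₁, e', he'⟩ := ih (a + 1) (fun i hi => ha i (by push_cast; lia))
    have i₁ := (he' (a + 1) le_rfl).1
    have i₂ := (he' (a + 1 + 1) (by lia)).1
    obtain ⟨A, i, p, u, hT, ea, hea, h⟩ := w.exists_extension hA' hA'₁ (hY a) (hY₁ a) (hY₂ a)
      (δ a ≫ (inv (e' (a + 1)))⟦(1 : ℤ)⟧') (by
        have h : inv (e' (a + 1)) ≫ (F.pieceδ (a + 1)).app A' =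
            δ (a + 1) ≫ (inv (e' (a + 1 + 1)))⟦(1 : ℤ)⟧' := by
          rw [IsIso.inv_comp_eq, ← Category.assoc, ← (he' (a + 1) le_rfl).2, Category.assoc,
            ← Functor.map_comp, IsIso.hom_inv_id, CategoryTheory.Functor.map_id]
          exact (Category.comp_id _).symm
        rw [Category.assoc, ← Functor.map_comp, h, Functor.map_comp, ← Category.assoc, hδ,
          zero_comp])
    have hA₁ : F.ge a A := (F.ge a).ext_of_isTriangulatedClosed₂ _ hT (F.ge_succ_le a _ hA'₁)
      (hY₁ a)
    have hi (m : ℤ) (hm : a + 1 ≤ m) : IsIso ((F.piece m).map i) := by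
      obtain ⟨_, hT'⟩ := F.exists_piece_distinguished hT m
      exact (DistTriang.isIso₁_iff hT').2 (F.isZero_piece_of_le (hY₂ a) (by lia))
    classical
    -- Below `a` any value will do, since nothing is claimed there.
    let e (m : ℤ) : (F.piece m).obj A ⟶ Y m :=
      if h : m = a then h.symm ▸ ea else
        if h' : a + 1 ≤ m then (haveI := hi m h'; inv ((F.piece m).map i)) ≫ e' m else 0
    have h₁ : e a = ea := dif_pos rfl
    have h₂ (m : ℤ) (hm : a + 1 ≤ m) :
        e m = (haveI := hi m hm; inv ((F.piece m).map i)) ≫ e' m :=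
      (dif_neg (by lia)).trans (dif_pos hm)
    have h₃ (m : ℤ) (hm : a ≤ m) : IsIso (e m) := by
      obtain rfl | hm' := hm.eq_or_lt
      · rw [h₁]
        exact hea
      · rw [h₂ m hm']
        have := (he' m hm').1
        have := hi m hm'
        infer_instance
    refine ⟨A, ?_, hA₁, e, fun m hm => ⟨h₃ m hm, ?_⟩⟩
    · rw [w.heartProp_iff]
      have hm (m : ℤ) : IsZero ((F.piece m).obj A) ∨
          Nonempty ((F.piece m).obj A ≅ (F.piece m).obj (Y m)) := by
        by_cases h : m < a
        · exact Or.inl (F.isZero_piece_of_ge hA₁ h)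
        · have := h₃ m (by lia)
          exact Or.inr ⟨asIso (e m) ≪≫ (F.pieceIso (hY₁ m) (hY₂ m)).symm⟩
      refine ⟨fun m => ?_, fun m => ?_⟩ <;> obtain h | ⟨⟨h⟩⟩ := hm m
      · exact t.isLE_of_isZero (w.ω.map_isZero h) m
      · have := w.isLE_piece (hY m) m
        exact t.isLE_of_iso (w.ω.mapIso h).symm m
      · exact t.isGE_of_isZero (w.ω.map_isZero h) m
      · have := w.isGE_piece (hY m) m
        exact t.isGE_of_iso (w.ω.mapIso h).symm m
    · obtain rfl | hm' := hm.eq_or_lt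
      · have := hi (a + 1) le_rfl
        rw [h₁, h₂ _ le_rfl, h, Category.assoc, Category.assoc, Category.assoc,
          ← Functor.map_comp, ← Functor.map_comp, IsIso.hom_inv_id_assoc, IsIso.inv_hom_id,
          CategoryTheory.Functor.map_id, Category.comp_id]
      · have i₄ := hi m hm'
        have i₅ := hi (m + 1) (by lia)
        have e₁ := (F.pieceδ m).naturality i
        have aux {C₁ C₂ C₃ C₄ C₅ C₆ : X} (f : C₁ ⟶ C₂) (g : C₃ ⟶ C₄) [IsIso f] [IsIso g]
            (δA' : C₁ ⟶ C₃⟦(1 : ℤ)⟧) (δA : C₂ ⟶ C₄⟦(1 : ℤ)⟧) (u : C₁ ⟶ C₅) (v : C₃ ⟶ C₆)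
            (δY : C₅ ⟶ C₆⟦(1 : ℤ)⟧) (h₁ : f ≫ δA = δA' ≫ g⟦(1 : ℤ)⟧')
            (h₂ : δA' ≫ v⟦(1 : ℤ)⟧' = u ≫ δY) :
            δA ≫ (inv g ≫ v)⟦(1 : ℤ)⟧' = (inv f ≫ u) ≫ δY := by
          rw [← cancel_epi f, reassoc_of% h₁, ← Functor.map_comp, IsIso.hom_inv_id_assoc, h₂,
            Category.assoc, IsIso.hom_inv_id_assoc]
        rw [h₂ m hm', h₂ (m + 1) (by lia)]
        exact aux _ _ _ _ _ _ _ e₁ (he' m hm').2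

/-- A bounded family of pieces with connecting morphisms comes from an object of the heart. -/
lemma exists_of_pieces (Y : ℤ → X) (hY : ∀ i, E.heartProp t (Y i)) (hY₁ : ∀ i, F.ge i (Y i))
    (hY₂ : ∀ i, F.le i (Y i)) (δ : ∀ i, Y i ⟶ (Y (i + 1))⟦(1 : ℤ)⟧)
    (hδ : ∀ i, δ i ≫ (δ (i + 1))⟦(1 : ℤ)⟧' = 0) (a b : ℤ) (ha : ∀ i < a, IsZero (Y i))
    (hb : ∀ i, b < i → IsZero (Y i)) : ∃ (A : X) (_ : E.heartProp t A)
      (e : ∀ i, (F.piece i).obj A ≅ Y i), ∀ i,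
        (F.pieceδ i).app A ≫ (e (i + 1)).hom⟦(1 : ℤ)⟧' = (e i).hom ≫ δ i := by
  obtain ⟨A, hA, hA₁, e, he⟩ := w.exists_of_pieces_aux Y hY hY₁ hY₂ δ hδ (b + 1 - a).toNat a
    (fun i hi => hb i (by lia))
  have hi (i : ℤ) : IsIso (e i) := by
    by_cases h : i < a
    · exact (F.isZero_piece_of_ge hA₁ h).isIso (ha i h) _
    · exact (he i (by lia)).1
  refine ⟨A, hA, fun i => asIso (e i), fun i => ?_⟩
  by_cases h : i < a
  · exact (F.isZero_piece_of_ge hA₁ h).eq_of_src _ _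
  · exact (he i (by lia)).2

end Forgetful

end Enhancement

end FCategory

end

/-! ### The heart of the induced t-structure is the category of bounded complexes -/

section

variable {T : Type u} [Category.{v} T] [Preadditive T] [HasZeroObject T] [HasShift T ℤ]
  [∀ n : ℤ, (shiftFunctor T n).Additive] [Pretriangulated T] [IsTriangulated T]
  {X : Type u'} [Category.{v'} X] [Preadditive X] [HasZeroObject X] [HasShift X ℤ]
  [∀ n : ℤ, (shiftFunctor X n).Additive] [Pretriangulated X]

namespace FCategory

instance additive_piece (F : FCategory X) (i : ℤ) : (F.piece i).Additive := by
  dsimp only [piece, σge, σle]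
  infer_instance

namespace Enhancement

/-- `A` is concentrated in filtration degree `n` and lies in the heart of the induced
t-structure. -/
def concentrated {F : FCategory X} {E : F.Enhancement T} (w : E.Forgetful) (t : TStructure T)
    (n : ℤ) : ObjectProperty X :=
  fun A => F.ge n A ∧ F.le n A ∧ t.IsLE (w.ω.obj A) n ∧ t.IsGE (w.ω.obj A) n

namespace Forgetful

variable {F : FCategory X} {E : F.Enhancement T} (w : E.Forgetful) (t : TStructure T)

lemma concentrated_piece {A : X} (hA : E.heartProp t A) (n : ℤ) :
    concentrated w t n ((F.piece n).obj A) :=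
  ⟨F.ge_piece n A, F.le_piece n A, w.isLE_piece hA n, w.isGE_piece hA n⟩

lemma isLE_ω_shift {n : ℤ} (m : ℤ) (hm : m + 1 = n) {A : X} (h : t.IsLE (w.ω.obj A) n) :
    t.IsLE (w.ω.obj (A⟦(1 : ℤ)⟧)) m := by
  have := t.isLE_shift (w.ω.obj A) n 1 m (by lia)
  exact t.isLE_of_iso (show (w.ω.obj A)⟦(1 : ℤ)⟧ ≅ w.ω.obj (A⟦(1 : ℤ)⟧) from
    ((w.ω.commShiftIso (1 : ℤ)).app A).symm) m

lemma isGE_ω_shift {n : ℤ} (m : ℤ) (hm : m + 1 = n) {A : X} (h : t.IsGE (w.ω.obj A) n) :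
    t.IsGE (w.ω.obj (A⟦(1 : ℤ)⟧)) m := by
  have := t.isGE_shift (w.ω.obj A) n 1 m (by lia)
  exact t.isGE_of_iso (show (w.ω.obj A)⟦(1 : ℤ)⟧ ≅ w.ω.obj (A⟦(1 : ℤ)⟧) from
    ((w.ω.commShiftIso (1 : ℤ)).app A).symm) m

lemma bijective_tH_map_ω {n : ℤ} {A B : X} (h₁ : F.le n A) (h₂ : F.ge n B)
    (hA : t.IsLE (w.ω.obj A) n) (hA' : t.IsGE (w.ω.obj A) n)
    (hB : t.IsLE (w.ω.obj B) n) (hB' : t.IsGE (w.ω.obj B) n) :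
    Function.Bijective (fun f : A ⟶ B => (tH t n).map (w.ω.map f)) :=
  (bijective_tH_map t n _ _ hA hA' hB hB').comp (w.bijective_map' n h₁ h₂)

lemma bijective_tH_map_concentrated {n : ℤ} {A B : X} (hA : concentrated w t n A)
    (hB : concentrated w t n B) : Function.Bijective (fun f : A ⟶ B => (tH t n).map (w.ω.map f)) :=
  w.bijective_tH_map_ω t hA.2.1 hB.1 hA.2.2.1 hA.2.2.2 hB.2.2.1 hB.2.2.2

/-- The identification of the cohomology of a shifted object. -/
noncomputable def tHωShift (i : ℤ) (B : X) :
    (tH t i).obj (w.ω.obj (B⟦(1 : ℤ)⟧)) ≅ (tH t (i + 1)).obj (w.ω.obj B) :=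
  (tH t i).mapIso ((w.ω.commShiftIso (1 : ℤ)).app B) ≪≫ (tHShift t i).app (w.ω.obj B)

lemma tHωShift_hom_naturality (i : ℤ) {B B' : X} (g : B ⟶ B') :
    (w.tHωShift t i B).hom ≫ (tH t (i + 1)).map (w.ω.map g) =
      (tH t i).map (w.ω.map (g⟦(1 : ℤ)⟧')) ≫ (w.tHωShift t i B').hom := by
  have h₁ := (tHShift t i).hom.naturality (w.ω.map g)
  have h₂ := (w.ω.commShiftIso (1 : ℤ)).hom.naturality g
  dsimp at h₁ h₂
  dsimp only [tHωShift, Iso.trans_hom, Functor.mapIso_hom, Iso.app_hom]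
  rw [Category.assoc, ← h₁, ← Functor.map_comp_assoc, ← h₂, Functor.map_comp, Category.assoc]

/-- The morphism in the heart which is induced by a morphism of degree one. -/
noncomputable def hδ (i : ℤ) {A B : X} (δ : A ⟶ B⟦(1 : ℤ)⟧) :
    (tH t i).obj (w.ω.obj A) ⟶ (tH t (i + 1)).obj (w.ω.obj B) :=
  (tH t i).map (w.ω.map δ) ≫ (w.tHωShift t i B).hom

lemma dH_app (i : ℤ) (A : X) : (w.dH t i).app A = w.hδ t i ((F.pieceδ i).app A) := by
  have aux {Y₁ Y₂ Y₃ : T} {H : HeartCat t} (f : Y₁ ⟶ Y₂) (g : Y₂ ⟶ Y₃) (h : (tH t i).obj Y₃ ⟶ H) :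
      (tH t i).map (f ≫ g) ≫ h = (tH t i).map f ≫ (tH t i).map g ≫ h := by
    rw [Functor.map_comp, Category.assoc]
  exact aux _ _ _

lemma map_comp_hδ (i : ℤ) {A A' B : X} (f : A ⟶ A') (δ : A' ⟶ B⟦(1 : ℤ)⟧) :
    (tH t i).map (w.ω.map f) ≫ w.hδ t i δ = w.hδ t i (f ≫ δ) := by
  simp [hδ]

lemma hδ_comp_map (i : ℤ) {A B B' : X} (δ : A ⟶ B⟦(1 : ℤ)⟧) (g : B ⟶ B') :
    w.hδ t i δ ≫ (tH t (i + 1)).map (w.ω.map g) = w.hδ t i (δ ≫ g⟦(1 : ℤ)⟧') := by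
  simp [hδ, tHωShift_hom_naturality]

lemma hδ_comp_hδ (i : ℤ) {A B C : X} (δ : A ⟶ B⟦(1 : ℤ)⟧) (δ' : B ⟶ C⟦(1 : ℤ)⟧) :
    w.hδ t i δ ≫ w.hδ t (i + 1) δ' = w.hδ t i (δ ≫ δ'⟦(1 : ℤ)⟧') ≫
      (w.tHωShift t (i + 1) C).hom := by
  rw [← w.hδ_comp_map t i δ δ', Category.assoc]
  rfl

lemma bijective_hδ (i : ℤ) {A B : X} (h₁ : F.le i A) (h₂ : F.ge i B)
    (hA : t.IsLE (w.ω.obj A) i) (hA' : t.IsGE (w.ω.obj A) i)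
    (hB : t.IsLE (w.ω.obj B) (i + 1)) (hB' : t.IsGE (w.ω.obj B) (i + 1)) :
    Function.Bijective (fun δ : A ⟶ B⟦(1 : ℤ)⟧ => w.hδ t i δ) := by
  have h := w.bijective_tH_map_ω t h₁ (F.ge_shift i 1 B h₂) hA hA' (w.isLE_ω_shift t i rfl hB)
    (w.isGE_ω_shift t i rfl hB')
  exact (Iso.homToEquiv (w.tHωShift t i B)).bijective.comp h

lemma bijective_hδ_concentrated (i : ℤ) {A B : X} (hA : concentrated w t i A)
    (hB : concentrated w t (i + 1) B) :
    Function.Bijective (fun δ : A ⟶ B⟦(1 : ℤ)⟧ => w.hδ t i δ) :=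
  w.bijective_hδ t i hA.2.1 (F.ge_succ_le _ _ hB.1) hA.2.2.1 hA.2.2.2 hB.2.2.1 hB.2.2.2

/-- This reflects `d² = 0` from the heart to a degree two composition in `X`. `C⟦1⟧` has the right
cohomological degree for `bijective_hδ`, and its filtration degree is high enough. -/
lemma comp_shift_eq_zero (i : ℤ) {A B C : X} (hA : concentrated w t i A)
    (hC : concentrated w t (i + 1 + 1) C) (δ : A ⟶ B⟦(1 : ℤ)⟧) (δ' : B ⟶ C⟦(1 : ℤ)⟧)
    (h : w.hδ t i δ ≫ w.hδ t (i + 1) δ' = 0) : δ ≫ δ'⟦(1 : ℤ)⟧' = 0 := by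
  rw [hδ_comp_hδ] at h
  have h₁ : w.hδ t i (δ ≫ δ'⟦(1 : ℤ)⟧') = 0 :=
     (cancel_mono _).1 (h.trans zero_comp.symm)
  refine (w.bijective_hδ t i hA.2.1 (F.ge_antitone (by lia) _ (F.ge_shift _ 1 _ hC.1)) hA.2.2.1
    hA.2.2.2 (w.isLE_ω_shift t _ rfl hC.2.2.1) (w.isGE_ω_shift t _ rfl hC.2.2.2)).1 ?_
  dsimp only
  rw [h₁, hδ, Functor.map_zero, Functor.map_zero, zero_comp]

lemma H0_d (A : X) (i : ℤ) :
    ((w.H0 t).obj A).d i (i + 1) = w.hδ t i ((F.pieceδ i).app A) :=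
  (CochainComplex.of_d (fun i => ((F.piece i ⋙ w.ω) ⋙ tH t i).obj A)
    (fun i => (w.dH t i).app A) i).trans (w.dH_app t i A)

lemma H0_map_f {A B : X} (f : A ⟶ B) (i : ℤ) :
    ((w.H0 t).map f).f i = (tH t i).map (w.ω.map ((F.piece i).map f)) := rfl

lemma isZero_H0_X {A : X} {i : ℤ} (h : IsZero ((F.piece i).obj A)) :
    IsZero (((w.H0 t).obj A).X i) :=
  (tH t i).map_isZero (w.ω.map_isZero h)

lemma isBounded_H0 (A : X) : isBoundedComplex (HeartCat t) ((w.H0 t).obj A) := by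
  obtain ⟨a, ha⟩ := F.exists_ge A
  obtain ⟨b, hb⟩ := F.exists_le A
  refine ⟨a, b, ?_, ?_⟩
  · rw [CochainComplex.isStrictlyGE_iff]
    exact fun i hi => w.isZero_H0_X t (F.isZero_piece_of_ge ha hi)
  · rw [CochainComplex.isStrictlyLE_iff]
    exact fun i hi => w.isZero_H0_X t (F.isZero_piece_of_le hb hi)

/-- The functor from the heart of the induced t-structure to bounded complexes. -/
noncomputable def heartH0 : (E.heartProp t).FullSubcategory ⥤ BoundedComplex (HeartCat t) :=
  (isBoundedComplex _).lift ((E.heartProp t).ι ⋙ w.H0 t) (fun A => w.isBounded_H0 t A.obj)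

lemma faithful_heartH0 : (w.heartH0 t).Faithful where
  map_injective {A B f g} h := by
    apply (E.heartProp t).ι.map_injective
    have h' : (w.H0 t).map f.hom = (w.H0 t).map g.hom := congrArg (fun k => k.hom) h
    rw [← sub_eq_zero]
    refine w.eq_zero_of_piece_map A.property B.property _ (fun i => ?_)
    refine ((F.piece i).map_sub (f := f.hom) (g := g.hom)).trans (sub_eq_zero.2 ?_)
    exact (w.bijective_tH_map_concentrated t (w.concentrated_piece t A.property i)
      (w.concentrated_piece t B.property i)).1 (congrArg (fun k => k.f i) h')

lemma exists_H0_map {A B : X} (hA : E.heartProp t A) (hB : E.heartProp t B)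
    (φ : (w.H0 t).obj A ⟶ (w.H0 t).obj B) : ∃ f : A ⟶ B, (w.H0 t).map f = φ := by
  choose ψ hψ using fun i => (w.bijective_tH_map_concentrated t (w.concentrated_piece t hA i)
    (w.concentrated_piece t hB i)).2 (φ.f i)
  dsimp only at hψ
  let Ψ : F.PieceHom A B :=
    { app := ψ
      comm i := by
        refine (w.bijective_hδ_concentrated t i (w.concentrated_piece t hA i)
          (w.concentrated_piece t hB (i + 1))).1 ?_
        have h := φ.comm i (i + 1)
        rw [H0_d, H0_d] at h
        dsimp only
        rw [← hδ_comp_map, ← map_comp_hδ, hψ, hψ]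
        exact h.symm }
  obtain ⟨f, hf⟩ := w.exists_of_pieceHom hA hB Ψ
  refine ⟨f, ?_⟩
  ext i : 1
  rw [H0_map_f, hf]
  exact hψ i

lemma full_heartH0 : (w.heartH0 t).Full where
  map_surjective {A B} φ := by
    obtain ⟨f, hf⟩ := w.exists_H0_map t A.property B.property φ.hom
    exact ⟨⟨f⟩, (isBoundedComplex _).ι.map_injective hf⟩

lemma exists_concentrated (n : ℤ) (H : HeartCat t) :
    ∃ A : X, concentrated w t n A ∧ Nonempty ((tH t n).obj (w.ω.obj A) ≅ H) := by
  obtain ⟨Y, h₁, h₂, ⟨e⟩⟩ := exists_tH_iso t n H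
  obtain ⟨A, hA₁, hA₂, ⟨e'⟩⟩ := w.exists_of_isConcentrated n Y
  exact ⟨A, ⟨hA₁, hA₂, t.isLE_of_iso e'.symm n, t.isGE_of_iso e'.symm n⟩,
    ⟨(tH t n).mapIso e' ≪≫ e⟩⟩

/-- Each term is realised in its own filtration degree and each differential by a unique degree one
morphism, after which the pieces are glued. -/
lemma exists_H0_iso (K : BoundedComplex (HeartCat t)) :
    ∃ A, E.heartProp t A ∧ Nonempty ((w.H0 t).obj A ≅ K.obj) := by
  obtain ⟨a, b, ha, hb⟩ := K.property
  choose Y hY e using fun i => w.exists_concentrated t i (K.obj.X i)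
  replace e i := (e i).some
  choose δ hδ' using fun i => (w.bijective_hδ_concentrated t i (hY i) (hY (i + 1))).2
    ((e i).hom ≫ K.obj.d i (i + 1) ≫ (e (i + 1)).inv)
  dsimp only at hδ'
  have hY0 (i : ℤ) (h : IsZero (K.obj.X i)) : IsZero (Y i) :=
    w.isZero_of_isZero_ω (hY i).1 (hY i).2.1 (isZero_of_isZero_tH t i _ (hY i).2.2.1 (hY i).2.2.2
      (h.of_iso (e i)))
  obtain ⟨A, hA, u, hu⟩ := w.exists_of_pieces Y
    (fun i => w.heartProp_of_isConcentrated (hY i).1 (hY i).2.1 (hY i).2.2.1 (hY i).2.2.2)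
    (fun i => (hY i).1) (fun i => (hY i).2.1) δ (fun i =>
      w.comp_shift_eq_zero t i (hY i) (hY (i + 1 + 1)) _ _ (by
        rw [hδ', hδ']
        simp)) a b
    (fun i hi => hY0 i ((CochainComplex.isStrictlyGE_iff _ a).1 ha i hi))
    (fun i hi => hY0 i ((CochainComplex.isStrictlyLE_iff _ b).1 hb i hi))
  refine ⟨A, hA, ⟨HomologicalComplex.Hom.isoOfComponents
    (fun i => (tH t i).mapIso (w.ω.mapIso (u i)) ≪≫ e i) ?_⟩⟩
  rintro i _ rfl
  have h := congrArg (w.hδ t i) (hu i)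
  rw [← hδ_comp_map, ← map_comp_hδ, hδ'] at h
  have aux {C₁ C₂ C₃ C₄ C₅ C₆ : HeartCat t} (p : C₁ ⟶ C₂) (m : C₂ ⟶ C₃) (q : C₁ ⟶ C₄) (e : C₄ ⟶ C₅)
      (d : C₅ ⟶ C₆) (e' : C₃ ≅ C₆) (h : p ≫ m = q ≫ e ≫ d ≫ e'.inv) :
      (q ≫ e) ≫ d = p ≫ m ≫ e'.hom := by
    rw [reassoc_of% h, e'.inv_hom_id, Category.comp_id, Category.assoc]
  exact (aux _ _ _ _ _ _ h).trans (congrArg (fun k => k ≫ _) (w.H0_d t A i).symm)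

lemma essSurj_heartH0 : (w.heartH0 t).EssSurj where
  mem_essImage K := by
    obtain ⟨A, hA, ⟨e⟩⟩ := w.exists_H0_iso t K
    exact ⟨⟨A, hA⟩, ⟨(isBoundedComplex _).fullyFaithfulι.preimageIso e⟩⟩

lemma isEquivalence_heartH0 : (w.heartH0 t).IsEquivalence :=
  have := w.full_heartH0 t
  have := w.faithful_heartH0 t
  have := w.essSurj_heartH0 t
  { }

lemma exists_inverse_H0 :
    ∃ G : BoundedComplex (HeartCat t) ⥤ (E.heartProp t).FullSubcategory, G.IsEquivalence ∧
      Nonempty (G ⋙ (E.heartProp t).ι ⋙ w.H0 t ≅ (isBoundedComplex (HeartCat t)).ι) := by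
  have := w.isEquivalence_heartH0 t
  exact ⟨(w.heartH0 t).inv, inferInstance,
    ⟨Functor.isoWhiskerRight (w.heartH0 t).asEquivalence.counitIso (isBoundedComplex _).ι⟩⟩

end Forgetful

end Enhancement

end FCategory

end

/-! ### The realisation functor on complexes -/

section

variable {T : Type u} [Category.{v} T] [Preadditive T] [HasZeroObject T] [HasShift T ℤ]
  [∀ n : ℤ, (shiftFunctor T n).Additive] [Pretriangulated T] [IsTriangulated T]

/-- The fibre of a morphism between objects concentrated in degree `n` is concentrated in degree
`n` if the morphism is an epimorphism in the heart. -/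
lemma DistTriang.isLE_of_epi {t : TStructure T} {P Y Z : T} {f : P ⟶ Y} {g : Y ⟶ Z}
    {h : Z ⟶ P⟦(1 : ℤ)⟧} (hT : Triangle.mk f g h ∈ distTriang T) (n : ℤ) (hY : t.IsLE Y n)
    (hZ : t.IsLE Z n) (hZ' : t.IsGE Z n) (hg : Epi ((tH t n).map g)) :
    t.IsLE P n := by
  rw [t.isLE_iff_orthogonal n (n + 1) rfl]
  intro L x hL
  apply (shiftFunctor T (1 : ℤ)).map_injective
  rw [Functor.map_zero]
  have hL' : t.IsGE (L⟦(1 : ℤ)⟧) n := t.isGE_shift L (n + 1) 1 n (by lia)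
  -- `L⟦1⟧` is in `T^{≥ n}`, so its truncation is concentrated in degree `n`; a morphism from `Z`
  -- can be compared there within the heart, where `g` is epimorphic.
  let y := t.liftTruncLE (h ≫ x⟦(1 : ℤ)⟧') n
  have hy : y ≫ (t.truncLEι n).app _ = h ≫ x⟦(1 : ℤ)⟧' := t.liftTruncLE_ι _ _
  have hgy : g ≫ y = 0 := t.to_truncLE_obj_ext (by
    rw [Category.assoc, hy, ← Category.assoc, DistTriang.zero₂₃ hT, zero_comp, zero_comp])
  have hy0 : y = 0 := by
    refine (bijective_tH_map t n Z _ hZ hZ' inferInstance inferInstance).1 ?_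
    dsimp only
    rw [Functor.map_zero, ← cancel_epi ((tH t n).map g), ← Functor.map_comp, hgy,
      Functor.map_zero, comp_zero]
  rw [hy0, zero_comp] at hy
  obtain ⟨z, hz⟩ : ∃ z : Y⟦(1 : ℤ)⟧ ⟶ L⟦(1 : ℤ)⟧, x⟦(1 : ℤ)⟧' = (-f⟦(1 : ℤ)⟧') ≫ z :=
    Triangle.yoneda_exact₃ _ (rot_of_distTriang _ hT) _ hy.symm
  have := t.isLE_shift Y n 1 (n - 1) (by lia)
  rw [hz, t.zero_of_isLE_of_isGE z (n - 1) n (by lia) this hL', comp_zero]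

variable {X : Type u'} [Category.{v'} X] [Preadditive X] [HasZeroObject X] [HasShift X ℤ]
  [∀ n : ℤ, (shiftFunctor X n).Additive] [Pretriangulated X]

namespace FCategory

namespace Enhancement

namespace Forgetful

variable {F : FCategory X} {E : F.Enhancement T} (w : E.Forgetful) (t : TStructure T)

instance additive_H0 : (w.H0 t).Additive where
  map_add {A B f g} := by
    ext i : 1
    exact ((F.piece i ⋙ w.ω) ⋙ tH t i).map_add

/-- With only two filtration degrees, the connecting morphism of the truncation triangle is the
differential up to isomorphisms. If `ω` makes it invertible, the middle term of the triangle dies.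
-/
lemma isZero_ω_of_isIso_hδ {A : X} {n : ℤ} (hA : E.heartProp t A) (h₁ : F.ge n A)
    (h₂ : F.le (n + 1) A) (h : IsIso (w.hδ t n ((F.pieceδ n).app A))) : IsZero (w.ω.obj A) := by
  have hc := w.concentrated_piece t hA n
  have hc' := w.concentrated_piece t hA (n + 1)
  have i₁ : IsIso ((tH t n).map (w.ω.map ((F.pieceδ n).app A))) :=
    @IsIso.of_isIso_comp_right _ _ _ _ _ _ (w.tHωShift t n _).hom inferInstance h
  have i₂ : IsIso (w.ω.map ((F.pieceδ n).app A)) :=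
    isIso_of_isIso_tH_map t n hc.2.2.1 hc.2.2.2 (w.isLE_ω_shift t n rfl hc'.2.2.1)
      (w.isGE_ω_shift t n rfl hc'.2.2.2) _ i₁
  have i₃ := F.isIso_σle_map_σgeι h₁
  have i₄ : IsIso ((F.σleπ (n + 1)).app ((F.σge (n + 1)).obj A)) := F.isIso_σleπ (F.le_σge h₂)
  have aux {C₁ C₂ C₃ C₄ : X} (a : C₁ ⟶ C₂) (b : C₂ ⟶ C₃⟦(1 : ℤ)⟧) (c : C₃ ⟶ C₄) [IsIso a] [IsIso c]
      (k : C₁ ⟶ C₄⟦(1 : ℤ)⟧) (e : k = a ≫ b ≫ c⟦(1 : ℤ)⟧') (hk : IsIso (w.ω.map k)) :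
      IsIso (w.ω.map b) := by
    rw [e, Functor.map_comp, Functor.map_comp] at hk
    have := IsIso.of_isIso_comp_left (w.ω.map a) (w.ω.map b ≫ w.ω.map (c⟦(1 : ℤ)⟧'))
    exact IsIso.of_isIso_comp_right (w.ω.map b) (w.ω.map (c⟦(1 : ℤ)⟧'))
  have i₅ : IsIso (w.ω.map ((F.σδ n).app A)) := @aux _ _ _ _ _ _ _ i₃ i₄ _ (F.pieceδ_app n A) i₂
  have i₆ : IsIso (w.ω.map ((F.σδ n).app A) ≫
    (w.ω.commShiftIso (1 : ℤ)).hom.app ((F.σge (n + 1)).obj A)) := inferInstance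
  exact (DistTriang.isIso₃_iff (w.ω.map_distinguished _ (F.σ_distinguished n A))).1 i₆

lemma exists_piece_map_distinguished {A B C : X} {f : A ⟶ B} {g : B ⟶ C} {h : C ⟶ A⟦(1 : ℤ)⟧}
    (hT : Triangle.mk f g h ∈ distTriang X) (i : ℤ) :
    ∃ h', Triangle.mk (w.ω.map ((F.piece i).map f)) (w.ω.map ((F.piece i).map g)) h' ∈
      distTriang T := by
  obtain ⟨h', hT'⟩ := F.exists_piece_distinguished hT i
  exact ⟨_, w.ω.map_distinguished _ hT'⟩

/-- Tested on pieces: a fibre of a map between objects of degree `i` can only fail to have degree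
`i` through a cokernel in degree `i + 1`, which the epimorphisms exclude. -/
lemma heartProp_of_epi {A B C : X} {f : A ⟶ B} {g : B ⟶ C} {h : C ⟶ A⟦(1 : ℤ)⟧}
    (hT : Triangle.mk f g h ∈ distTriang X) (hB : E.heartProp t B) (hC : E.heartProp t C)
    (hg : ∀ i, Epi (((w.H0 t).map g).f i)) : E.heartProp t A := by
  rw [w.heartProp_iff]
  refine ⟨fun i => ?_, fun i => ?_⟩ <;> obtain ⟨h', hT'⟩ := w.exists_piece_map_distinguished hT i
  · exact DistTriang.isLE_of_epi hT' i (w.isLE_piece hB i)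
      (w.isLE_piece hC i) (w.isGE_piece hC i) (hg i)
  · have := w.isGE_piece hC i
    exact DistTriang.isGE₁ t hT' i (w.isGE_piece hB i) (t.isGE_of_ge _ (i - 1) i)

include w in
-- So `f` is a monomorphism in the heart. On each piece, `k` lifts to the desuspension of the piece
-- of `C`, which lies one degree too high to receive morphisms from `Z`.
lemma eq_zero_of_comp_eq_zero {A B C Z : X} {f : A ⟶ B} {g : B ⟶ C} {h : C ⟶ A⟦(1 : ℤ)⟧}
    (hT : Triangle.mk f g h ∈ distTriang X) (hA : E.heartProp t A) (hC : E.heartProp t C)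
    (hZ : E.heartProp t Z) (k : Z ⟶ A) (hk : k ≫ f = 0) : k = 0 := by
  refine w.eq_zero_of_piece_map hZ hA k (fun i => ?_)
  obtain ⟨h', hT'⟩ := w.exists_piece_map_distinguished hT i
  refine (w.bijective_tH_map_concentrated t (w.concentrated_piece t hZ i)
    (w.concentrated_piece t hA i)).1 ?_
  dsimp only
  refine congrArg (tH t i).map (Eq.trans ?_ (w.ω.map_zero _ _).symm)
  obtain ⟨y, hy⟩ := Triangle.coyoneda_exact₂ _ (inv_rot_of_distTriang _ hT')
    (w.ω.map ((F.piece i).map k)) (by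
      have h₀ : w.ω.map ((F.piece i).map k) ≫ w.ω.map ((F.piece i).map f) = 0 := by
        rw [← Functor.map_comp, ← Functor.map_comp, hk, Functor.map_zero, Functor.map_zero]
      exact h₀)
  have hY := w.isGE_piece hC i
  have := t.isGE_shift (w.ω.obj ((F.piece i).obj C)) i (-1) (i + 1) (by lia)
  rw [hy]
  exact (congrArg (fun k => k ≫ _) (t.zero_of_isLE_of_isGE y i (i + 1) (by lia)
    (w.isLE_piece hZ i) this)).trans zero_comp

variable {G : BoundedComplex (HeartCat t) ⥤ (E.heartProp t).FullSubcategory} [G.IsEquivalence]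
  (ε : G ⋙ (E.heartProp t).ι ⋙ w.H0 t ≅ (isBoundedComplex (HeartCat t)).ι)

include ε in
lemma additive_of_H0_iso : G.Additive := by
  have := w.faithful_heartH0 t
  have : (w.heartH0 t ⋙ (isBoundedComplex _).ι).Faithful := inferInstance
  have : ((E.heartProp t).ι ⋙ w.H0 t).Faithful := this
  have : (G ⋙ (E.heartProp t).ι ⋙ w.H0 t).Additive := Functor.additive_of_iso ε.symm
  exact Functor.additive_of_comp_faithful G ((E.heartProp t).ι ⋙ w.H0 t)

/-- The terms of a bounded complex, in terms of the corresponding object of the heart. -/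
noncomputable def pieceIsoX (K : BoundedComplex (HeartCat t)) (i : ℤ) :
    (tH t i).obj (w.ω.obj ((F.piece i).obj (G.obj K).obj)) ≅ K.obj.X i :=
  (HomologicalComplex.eval _ _ i).mapIso (ε.app K)

include ε

lemma isZero_piece_iff (K : BoundedComplex (HeartCat t)) (i : ℤ) :
    IsZero ((F.piece i).obj (G.obj K).obj) ↔ IsZero (K.obj.X i) := by
  refine ⟨fun h => (w.isZero_H0_X t h).of_iso (w.pieceIsoX t ε K i).symm, fun h => ?_⟩
  have hc := w.concentrated_piece t (G.obj K).property i
  exact w.isZero_of_isZero_ω hc.1 hc.2.1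
    (isZero_of_isZero_tH t i _ hc.2.2.1 hc.2.2.2 (h.of_iso (w.pieceIsoX t ε K i)))

lemma ge_of_isStrictlyGE {K : BoundedComplex (HeartCat t)} {n : ℤ} (h : K.obj.IsStrictlyGE n) :
    F.ge n (G.obj K).obj :=
  F.ge_of_isZero_piece n _ (fun i hi => (w.isZero_piece_iff t ε K i).2
    ((CochainComplex.isStrictlyGE_iff _ n).1 h i hi))

lemma le_of_isStrictlyLE {K : BoundedComplex (HeartCat t)} {n : ℤ} (h : K.obj.IsStrictlyLE n) :
    F.le n (G.obj K).obj :=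
  F.le_of_isZero_piece n _ (fun i hi => (w.isZero_piece_iff t ε K i).2
    ((CochainComplex.isStrictlyLE_iff _ n).1 h i hi))

lemma isZero_of_isIso_d (K : BoundedComplex (HeartCat t)) (n : ℤ) (hg : K.obj.IsStrictlyGE n)
    (hl : K.obj.IsStrictlyLE (n + 1)) (hd : IsIso (K.obj.d n (n + 1))) :
    IsZero (w.ω.obj (G.obj K).obj) := by
  refine w.isZero_ω_of_isIso_hδ t (G.obj K).property (w.ge_of_isStrictlyGE t ε hg)
    (w.le_of_isStrictlyLE t ε hl) ?_
  rw [← H0_d]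
  have h : ((w.H0 t).obj (G.obj K).obj).d n (n + 1) ≫ (ε.hom.app K).f (n + 1) =
      (ε.hom.app K).f n ≫ K.obj.d n (n + 1) := ((ε.hom.app K).comm n (n + 1)).symm
  have i₁ : IsIso ((ε.hom.app K).f n) := inferInstanceAs (IsIso (w.pieceIsoX t ε K n).hom)
  have i₂ : IsIso ((ε.hom.app K).f (n + 1)) :=
    inferInstanceAs (IsIso (w.pieceIsoX t ε K (n + 1)).hom)
  have aux {C₁ C₂ C₃ C₄ : HeartCat t} (a : C₁ ⟶ C₂) (b : C₂ ⟶ C₃) (c : C₁ ⟶ C₄) (d : C₄ ⟶ C₃)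
      (h : a ≫ b = c ≫ d) (hb : IsIso b) (hc : IsIso c) (hd : IsIso d) : IsIso a := by
    have : IsIso (a ≫ b) := by
      rw [h]
      infer_instance
    exact IsIso.of_isIso_comp_right a b
  exact aux _ _ _ _ h i₂ i₁ hd

lemma bijective_map_of_isStrictly {K L : BoundedComplex (HeartCat t)} {n : ℤ}
    (hK : K.obj.IsStrictlyLE n) (hL : L.obj.IsStrictlyGE n) :
    Function.Bijective (fun f : K ⟶ L => w.ω.map (G.map f).hom) :=
  (w.bijective_map' n (w.le_of_isStrictlyLE t ε hK) (w.ge_of_isStrictlyGE t ε hL)).comp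
    (((E.heartProp t).fullyFaithfulι.map_bijective _ _).comp
      ((Functor.FullyFaithful.ofFullyFaithful G).map_bijective K L))

lemma exists_complex_iso (n : ℤ) (Y : T) (hl : t.IsLE Y n) (hg : t.IsGE Y n) :
    ∃ K : BoundedComplex (HeartCat t), (K.obj.IsStrictlyGE n ∧ K.obj.IsStrictlyLE n) ∧
      Nonempty (w.ω.obj (G.obj K).obj ≅ Y) := by
  obtain ⟨A, hA₁, hA₂, ⟨e⟩⟩ := w.exists_of_isConcentrated n Y
  have hA : E.heartProp t A := w.heartProp_of_isConcentrated hA₁ hA₂ (t.isLE_of_iso e.symm n)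
    (t.isGE_of_iso e.symm n)
  let e' : (G.obj (G.objPreimage ⟨A, hA⟩)).obj ≅ A :=
    (E.heartProp t).ι.mapIso (G.objObjPreimageIso ⟨A, hA⟩)
  refine ⟨G.objPreimage ⟨A, hA⟩, ⟨?_, ?_⟩, ⟨w.ω.mapIso e' ≪≫ e⟩⟩
  · rw [CochainComplex.isStrictlyGE_iff]
    exact fun i hi => (w.isZero_piece_iff t ε _ i).1
      ((F.isZero_piece_of_ge hA₁ hi).of_iso ((F.piece i).mapIso e'))
  · rw [CochainComplex.isStrictlyLE_iff]
    exact fun i hi => (w.isZero_piece_iff t ε _ i).1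
      ((F.isZero_piece_of_le hA₂ hi).of_iso ((F.piece i).mapIso e'))

lemma epi_H0_map {K L : BoundedComplex (HeartCat t)} (g : K ⟶ L) (i : ℤ) (hg : Epi (g.hom.f i)) :
    Epi (((w.H0 t).map (G.map g).hom).f i) := by
  have h : ((w.H0 t).map (G.map g).hom).f i ≫ (w.pieceIsoX t ε L i).hom =
      (w.pieceIsoX t ε K i).hom ≫ g.hom.f i := congrArg (fun k => k.f i) (ε.hom.naturality g)
  have aux {C₁ C₂ C₃ C₄ : HeartCat t} (a : C₁ ⟶ C₂) (b : C₂ ≅ C₃) (c : C₁ ≅ C₄) (d : C₄ ⟶ C₃)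
      (h : a ≫ b.hom = c.hom ≫ d) (hd : Epi d) : Epi a := by
    rw [← Iso.eq_comp_inv] at h
    rw [h]
    infer_instance
  exact aux _ _ _ _ h hg

/-- Short exact sequences of bounded complexes give distinguished triangles. -/
lemma exists_distinguished {K₁ K₂ K₃ : BoundedComplex (HeartCat t)} (f : K₁ ⟶ K₂) (g : K₂ ⟶ K₃)
    (hfg : f ≫ g = 0) (hf : Mono f) (hg : ∀ i, Epi (g.hom.f i))
    (hfg' : ∀ {L : BoundedComplex (HeartCat t)} (j : L ⟶ K₂), j ≫ g = 0 → ∃ v : L ⟶ K₁, v ≫ f = j) :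
    ∃ h, Triangle.mk (w.ω.map (G.map f).hom) (w.ω.map (G.map g).hom) h ∈ distTriang T := by
  have := w.additive_of_H0_iso t ε
  -- The fibre of `g` taken in `X` stays in the heart, so it comes from a complex `L`. Both `L` and
  -- `K₁` have the universal property of the kernel of `g`, which identifies them.
  obtain ⟨A, a, h, hT⟩ := distinguished_cocone_triangle₁ (G.map g).hom
  have hA : E.heartProp t A := w.heartProp_of_epi t hT (G.obj K₂).property (G.obj K₃).property
    (fun i => w.epi_H0_map t ε g i (hg i))
  let L := G.objPreimage ⟨A, hA⟩
  let e : (G.obj L).obj ≅ A := (E.heartProp t).ι.mapIso (G.objObjPreimageIso ⟨A, hA⟩)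
  obtain ⟨j, hj⟩ := G.map_surjective (X := L) (Y := K₂) ⟨e.hom ≫ a⟩
  have hj' : (G.map j).hom = e.hom ≫ a := congrArg (fun k => k.hom) hj
  have h0 {K L : BoundedComplex (HeartCat t)} (k : K ⟶ L) (hk : (G.map k).hom = 0) : k = 0 :=
    G.map_injective (((E.heartProp t).ι.map_injective hk).trans (G.map_zero _ _).symm)
  have hc {K L M : BoundedComplex (HeartCat t)} (k : K ⟶ L) (l : L ⟶ M) :
      (G.map (k ≫ l)).hom = (G.map k).hom ≫ (G.map l).hom :=
    congrArg (fun k => k.hom) (G.map_comp k l)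
  obtain ⟨v, hv⟩ := hfg' j (h0 _ (by
    rw [hc, hj', Category.assoc, DistTriang.zero₁₂ hT, comp_zero]))
  have hz : (G.map f).hom ≫ (G.map g).hom = 0 := by
    rw [← hc, hfg, G.map_zero]
    rfl
  obtain ⟨b, hb⟩ := DistTriang.lift₂ hT (G.map f).hom hz
  obtain ⟨u, hu⟩ := G.map_surjective (X := K₁) (Y := L) ⟨b ≫ e.inv⟩
  have hu' : (G.map u).hom = b ≫ e.inv := congrArg (fun k => k.hom) hu
  have huj : u ≫ j = f := by
    apply G.map_injective
    apply (E.heartProp t).ι.map_injective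
    refine (hc u j).trans ?_
    rw [hu', hj', Category.assoc, Iso.inv_hom_id_assoc]
    exact hb.symm
  have huv : u ≫ v = 𝟙 _ := by
    rw [← cancel_mono f, Category.assoc, hv, huj, Category.id_comp]
  -- The difference dies after the monomorphism from the fibre.
  have hvu : v ≫ u = 𝟙 _ := by
    rw [← sub_eq_zero]
    apply h0
    rw [← cancel_mono e.hom, zero_comp]
    refine w.eq_zero_of_comp_eq_zero t hT hA (G.obj K₃).property (G.obj L).property _ ?_
    rw [Category.assoc, ← hj', ← hc, Preadditive.sub_comp, Category.assoc, huj, hv,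
      Category.id_comp, sub_self, G.map_zero]
    rfl
  let e₁ : (G.obj K₁).obj ≅ A := (E.heartProp t).ι.mapIso (G.mapIso ⟨u, v, huv, hvu⟩) ≪≫ e
  have he₁ : e₁.hom ≫ a = (G.map f).hom := by
    have : e₁.hom = b := by
      refine (congrArg (fun k => k ≫ e.hom) hu').trans ?_
      rw [Category.assoc, Iso.inv_hom_id, Category.comp_id]
    rw [this]
    exact hb.symm
  have hT' : Triangle.mk (G.map f).hom (G.map g).hom (h ≫ e₁.inv⟦(1 : ℤ)⟧') ∈ distTriang X :=
    distTriang_of_iso hT e₁ (Iso.refl _) (Iso.refl _) ((Category.comp_id _).trans he₁.symm)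
      ((Category.comp_id _).trans (Category.id_comp _).symm) (by
        rw [Category.assoc, ← Functor.map_comp, Iso.inv_hom_id, CategoryTheory.Functor.map_id]
        exact (Category.comp_id _).trans (Category.id_comp _).symm)
  exact ⟨_, w.ω.map_distinguished _ hT'⟩

/-- The composition of an inverse of `H0` with an f-forgetful functor realises the heart. -/
lemma realisesHeart :
    letI := heartAbelian t
    RealisesHeart t (G ⋙ (E.heartProp t).ι ⋙ w.ω) := by
  let _ := heartAbelian t
  exact
  { exact := by
      intro X₁ X₂ X₃ f g hw hS
      refine w.exists_distinguished t ε f g hw hS.mono_f (fun i => ?_) (fun j hj => ?_)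
      · have h₁ : Epi g := hS.epi_g
        have h₂ : Epi ((isBoundedComplex (HeartCat t)).ι.map g) := inferInstance
        exact inferInstanceAs (Epi ((HomologicalComplex.eval _ _ i).map
          ((isBoundedComplex (HeartCat t)).ι.map g)))
      · exact ⟨hS.fIsKernel.lift (KernelFork.ofι j hj), hS.fIsKernel.fac _ WalkingParallelPair.zero⟩
    isZero_of_isIso_d := fun K n hg hl hd => w.isZero_of_isIso_d t ε K n hg hl hd
    isLE_of_isConcentrated := fun hK => w.isLE_ω_of_le (G.obj _).property
      (w.le_of_isStrictlyLE t ε hK.2)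
    isGE_of_isConcentrated := fun hK => w.isGE_ω_of_ge (G.obj _).property
      (w.ge_of_isStrictlyGE t ε hK.1)
    bijective := fun hK hL => w.bijective_map_of_isStrictly t ε hK.2 hL.1
    exists_iso := fun n Y hl hg => w.exists_complex_iso t ε n Y hl hg }

end Forgetful

end Enhancement

end FCategory

end

/-! ### Consequences of fullness -/

section

variable {C : Type*} [Category C] [Abelian C]
  {T : Type*} [Category T] [Preadditive T] [HasZeroObject T] [HasShift T ℤ]
  [∀ n : ℤ, (shiftFunctor T n).Additive] [Pretriangulated T]
  {Φ : C ⥤ T} [Φ.Additive] {W : MorphismProperty C}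

lemma isRoof_of_full (hW : ∀ ⦃K L : C⦄ (f : K ⟶ L), W f ↔ IsIso (Φ.map f))
    {R : W.Localization ⥤ T} (e : W.Q ⋙ R ≅ Φ) (hΦ : ExactWithAcyclics Φ) (hR : R.Full) ⦃K L : C⦄
    (g : Φ.obj K ⟶ Φ.obj L) : IsRoof Φ g := by
  obtain ⟨x, hx⟩ := R.map_surjective (X := W.Q.obj K) (Y := W.Q.obj L)
    (e.hom.app K ≫ g ≫ e.inv.app L)
  obtain ⟨K', s, f, hs, hf⟩ := exists_roof_Q hW hΦ x
  refine ⟨K', s, f, hs, ?_⟩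
  have h₁ : R.map (W.Q.map s) ≫ R.map x = R.map (W.Q.map f) := by rw [← R.map_comp, hf]
  have h₂ : R.map (W.Q.map s) ≫ e.hom.app K = e.hom.app K' ≫ Φ.map s := e.hom.naturality s
  have h₃ : R.map (W.Q.map f) ≫ e.hom.app L = e.hom.app K' ≫ Φ.map f := e.hom.naturality f
  have h₄ : R.map x ≫ e.hom.app L = e.hom.app K ≫ g := by
    rw [hx, Category.assoc, Category.assoc, Iso.inv_hom_id_app]
    exact congrArg _ (Category.comp_id _)
  rw [← cancel_epi (e.hom.app K'), ← reassoc_of% h₂, ← h₄, reassoc_of% h₁, h₃]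

end

/-! ### Morphisms between objects of the heart in different degrees, when all morphisms are roofs.
-/

section

variable {A : Type*} [Category A] [Abelian A]

/-- When `L` has no differentials its terms are its homology, which the cycles of `K` surject onto
through the homology of `K`. -/
lemma epi_iCycles_comp_of_quasiIsoAt {K L : CochainComplex A ℤ} (s : K ⟶ L) (a : ℤ)
    (hs : QuasiIsoAt s a) (h₁ : ∀ i j, L.d i j = 0) : Epi (K.iCycles a ≫ s.f a) := by
  have i₁ : IsIso (L.iCycles a) := (L.sc a).isIso_iCycles (h₁ _ _)
  have i₂ : IsIso (L.homologyπ a) := (L.sc a).isIso_homologyπ (h₁ _ _)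
  have i₃ : IsIso (HomologicalComplex.homologyMap s a) := inferInstance
  rw [← HomologicalComplex.cyclesMap_i]
  have h := HomologicalComplex.homologyπ_naturality s a
  have : HomologicalComplex.cyclesMap s a =
      (K.homologyπ a ≫ HomologicalComplex.homologyMap s a) ≫ inv (L.homologyπ a) := by
    rw [h, Category.assoc, IsIso.hom_inv_id, Category.comp_id]
  rw [this]
  infer_instance

variable {T : Type*} [Category T] [Preadditive T] [HasZeroObject T] [HasShift T ℤ]
  [∀ n : ℤ, (shiftFunctor T n).Additive] [Pretriangulated T]
  {t : TStructure T} {Φ : BoundedComplex A ⥤ T} [Φ.Additive]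

namespace RealisesHeart

open BoundedComplex

/-- Morphisms of negative degree between objects of the heart factor through morphisms of
degree one. -/
lemma exists_factorisation (hΦ : RealisesHeart t Φ)
    (hroof : ∀ ⦃K L : BoundedComplex A⦄ (g : Φ.obj K ⟶ Φ.obj L), IsRoof Φ g) {a b : ℤ} (hab : b < a)
    {Y Z : T} (hY : t.IsLE Y a) (hY' : t.IsGE Y a) (hZ : t.IsLE Z b) (hZ' : t.IsGE Z b)
    (φ : Y ⟶ Z) : ∃ (V : T) (h : Y ⟶ V) (ψ : V ⟶ Z), t.IsLE V (a - 1) ∧ t.IsGE V (a - 1) ∧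
      φ = h ≫ ψ := by
  obtain ⟨K, hK, ⟨eY⟩⟩ := hΦ.exists_iso a Y hY hY'
  obtain ⟨L, hL, ⟨eZ⟩⟩ := hΦ.exists_iso b Z hZ hZ'
  obtain ⟨K', s, f, hs, hf⟩ := hroof (eY.hom ≫ φ ≫ eZ.inv)
  have hs' : QuasiIso s.hom := (hΦ.boundedQuasiIso_iff s).2 hs
  have hKX (i : ℤ) (hi : i ≠ a) : IsZero (K.obj.X i) := by
    obtain hi | hi := lt_or_gt_of_ne hi
    · exact (CochainComplex.isStrictlyGE_iff _ a).1 hK.1 i hi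
    · exact (CochainComplex.isStrictlyLE_iff _ a).1 hK.2 i hi
  have hepi := epi_iCycles_comp_of_quasiIsoAt s.hom a inferInstance (fun i j => by
    by_cases hi : i = a
    · by_cases hj : j = a
      · exact K.obj.shape _ _ (by simp; lia)
      · exact (hKX j hj).eq_of_tgt _ _
    · exact (hKX i hi).eq_of_src _ _)
  -- Placing the degree `a` cycles of `K'` in degree `a` gives a complex that maps to `K'` and whose
  -- composite to `K` is an epimorphism of concentrated complexes.
  let S : BoundedComplex A :=
    ⟨(HomologicalComplex.single A (ComplexShape.up ℤ) a).obj (K'.obj.cycles a),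
      ⟨a, a, inferInstance, inferInstance⟩⟩
  have hS : S.IsConcentrated a := ⟨inferInstanceAs (CochainComplex.IsStrictlyGE
    ((HomologicalComplex.single A (ComplexShape.up ℤ) a).obj (K'.obj.cycles a)) a),
    inferInstanceAs (CochainComplex.IsStrictlyLE
    ((HomologicalComplex.single A (ComplexShape.up ℤ) a).obj (K'.obj.cycles a)) a)⟩
  have hd (k : ℤ) (_ : (ComplexShape.up ℤ).Rel a k) : K'.obj.iCycles a ≫ K'.obj.d a k = 0 :=
    K'.obj.iCycles_d a k
  let c : S ⟶ K' := ObjectProperty.homMk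
    (HomologicalComplex.mkHomFromSingle (K'.obj.iCycles a) hd)
  have hca : Epi ((c ≫ s).hom.f a) := by
    have e : (c ≫ s).hom.f a = (HomologicalComplex.singleObjXSelf (ComplexShape.up ℤ) a _).hom ≫
        K'.obj.iCycles a ≫ s.hom.f a := by
      change c.hom.f a ≫ s.hom.f a = _
      rw [show c.hom.f a = _ from HomologicalComplex.mkHomFromSingle_f _ hd, Category.assoc]
    rw [e]
    infer_instance
  have hc : Epi (c ≫ s) := by
    have : Epi (c ≫ s).hom := by
      have (i : ℤ) : Epi ((c ≫ s).hom.f i) := by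
        by_cases hi : i = a
        · subst hi
          exact hca
        · exact ⟨fun g h _ => (hKX i hi).eq_of_src _ _⟩
      exact HomologicalComplex.epi_of_epi_f _ this
    exact (isBoundedComplex A).ι.epi_of_epi_map this
  -- `S` and `L` live in the different degrees `a` and `b`. Hence the given morphism dies on `Φ S`
  -- and factors through the suspended kernel, which is concentrated in degree `a - 1`.
  have hcf : c ≫ f = 0 := by
    refine (isBoundedComplex A).ι.map_injective (HomologicalComplex.hom_ext _ _ (fun i => ?_))
    by_cases hi : i = a
    · subst hi
      exact ((CochainComplex.isStrictlyLE_iff _ b).1 hL.2 i hab).eq_of_tgt _ _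
    · exact (HomologicalComplex.isZero_single_obj_X _ _ _ _ hi).eq_of_src _ _
  have hN : (kernel (c ≫ s)).IsConcentrated a := by
    have hm (i : ℤ) : Mono ((kernel.ι (c ≫ s)).hom.f i) :=
      inferInstanceAs (Mono (((isBoundedComplex A).ι ⋙ HomologicalComplex.eval A _ i).map
        (kernel.ι (c ≫ s))))
    refine ⟨?_, ?_⟩
    · rw [CochainComplex.isStrictlyGE_iff]
      exact fun i hi => IsZero.of_mono ((kernel.ι (c ≫ s)).hom.f i)
        ((CochainComplex.isStrictlyGE_iff _ a).1 hS.1 i hi)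
    · rw [CochainComplex.isStrictlyLE_iff]
      exact fun i hi => IsZero.of_mono ((kernel.ι (c ≫ s)).hom.f i)
        ((CochainComplex.isStrictlyLE_iff _ a).1 hS.2 i hi)
  obtain ⟨h, hT⟩ := hΦ.exact (shortExact_kernel (c ≫ s))
  have hz : Φ.map (c ≫ s) ≫ eY.hom ≫ φ ≫ eZ.inv = 0 := by
    rw [Φ.map_comp, Category.assoc, hf, ← Φ.map_comp, hcf, Φ.map_zero]
  obtain ⟨ψ, hψ⟩ := DistTriang.desc₃ hT _ hz
  have h₁ := hΦ.isLE_of_isConcentrated hN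
  have h₂ := hΦ.isGE_of_isConcentrated hN
  refine ⟨_, eY.inv ≫ h, ψ ≫ eZ.hom, t.isLE_shift (Φ.obj (kernel (c ≫ s))) a 1 (a - 1) (by lia),
    t.isGE_shift (Φ.obj (kernel (c ≫ s))) a 1 (a - 1) (by lia), ?_⟩
  rw [Category.assoc, ← reassoc_of% hψ]
  simp

lemma hom_eq_zero_of_projective (hΦ : RealisesHeart t Φ)
    (hroof : ∀ ⦃K L : BoundedComplex A⦄ (g : Φ.obj K ⟶ Φ.obj L), IsRoof Φ g) {a b : ℤ} (hab : b < a)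
    {P Z : T} (hP : t.IsLE P a) (hP' : t.IsGE P a)
    (h : ∀ (V : T) (f : P ⟶ V), t.IsLE V (a - 1) → t.IsGE V (a - 1) → f = 0)
    (hZ : t.IsLE Z b) (hZ' : t.IsGE Z b) (φ : P ⟶ Z) : φ = 0 := by
  obtain ⟨V, f, ψ, hV, hV', rfl⟩ := hΦ.exists_factorisation hroof hab hP hP' hZ hZ' φ
  rw [h V f hV hV', zero_comp]

/-- The factorisation splits off a degree one morphism at the source, the wrong end for an
injective. Repeating it brings the source down one degree at a time until it is adjacent to `I`. -/
lemma hom_eq_zero_of_injective (hΦ : RealisesHeart t Φ)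
    (hroof : ∀ ⦃K L : BoundedComplex A⦄ (g : Φ.obj K ⟶ Φ.obj L), IsRoof Φ g) {b : ℤ}
    {I : T} (hI : t.IsLE I b) (hI' : t.IsGE I b)
    (h : ∀ (V : T) (f : V ⟶ I), t.IsLE V (b + 1) → t.IsGE V (b + 1) → f = 0) (n : ℕ) :
    ∀ (Y : T) (φ : Y ⟶ I), t.IsLE Y (b + n + 1) → t.IsGE Y (b + n + 1) → φ = 0 := by
  induction n with
  | zero =>
    intro Y φ hY hY'
    exact h Y φ (by simpa using hY) (by simpa using hY')
  | succ n ih =>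
    intro Y φ hY hY'
    obtain ⟨V, f, ψ, hV, hV', rfl⟩ := hΦ.exists_factorisation hroof (by push_cast; lia) hY hY'
      hI hI' φ
    have e : b + ((n + 1 : ℕ) : ℤ) + 1 - 1 = b + n + 1 := by push_cast; ring
    rw [e] at hV hV'
    rw [ih V ψ hV hV', comp_zero]

end RealisesHeart

end

/-! ### Silting and cosilting objects -/

section

variable {T : Type u} [Category.{v} T] [Preadditive T] [HasZeroObject T] [HasShift T ℤ]
  [∀ n : ℤ, (shiftFunctor T n).Additive] [Pretriangulated T]

section Shift

lemma hom_shift_neg_eq_zero {A L : T} (n : ℤ) (h : ∀ f : A ⟶ L⟦n⟧, f = 0) (f : A⟦-n⟧ ⟶ L) :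
    f = 0 := by
  apply (shiftFunctor T n).map_injective
  rw [Functor.map_zero, ← cancel_epi (show A ≅ A⟦-n⟧⟦n⟧ from (shiftNegShift A n).symm).hom, comp_zero]
  exact h _

lemma hom_eq_zero_of_shift {A L : T} (n : ℤ) (h : ∀ f : A⟦n⟧ ⟶ L⟦n⟧, f = 0) (f : A ⟶ L) :
    f = 0 := by
  apply (shiftFunctor T n).map_injective
  rw [Functor.map_zero]
  exact h _

lemma hom_eq_zero_of_iso {A A' L L' : T} (e : A ≅ A') (e' : L ≅ L') (h : ∀ f : A' ⟶ L', f = 0)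
    (f : A ⟶ L) : f = 0 := by
  rw [← cancel_epi e.inv, ← cancel_mono e'.hom, comp_zero, zero_comp]
  exact h _

lemma hom_to_shift_neg_eq_zero {A L : T} (n : ℤ) (h : ∀ f : A⟦n⟧ ⟶ L, f = 0) (f : A ⟶ L⟦-n⟧) :
    f = 0 :=
  hom_eq_zero_of_shift n (hom_eq_zero_of_iso (Iso.refl _) (shiftNegShift L n) h) f

end Shift

section Truncation

variable [IsTriangulated T] (t : TStructure T)

/-- An object which has no morphisms to objects of the aisle shifted by one lies in the heart, if
projectivity in the heart implies vanishing of all higher extensions. -/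
lemma isGE_zero_of_hom_eq_zero {N : T} (hN : t.IsLE N 0)
    (hom : ∀ (Z : T) (f : N ⟶ Z), t.IsLE Z (-1) → f = 0)
    (hproj : ∀ P : T, t.IsLE P 0 → t.IsGE P 0 →
      (∀ (V : T) (f : P ⟶ V), t.IsLE V (-1) → t.IsGE V (-1) → f = 0) →
      ∀ (b : ℤ) (Z : T) (f : P ⟶ Z), b < 0 → t.IsLE Z b → t.IsGE Z b → f = 0)
    (hnondeg : ∀ W : T, (∀ n : ℤ, t.IsLE W n) → IsZero W) : t.IsGE N 0 := by
  let W := (t.truncLT 0).obj N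
  let P := (t.truncGE 0).obj N
  have hT : Triangle.mk ((t.truncLTι 0).app N) ((t.truncGEπ 0).app N)
      ((t.truncGEδLT 0).app N) ∈ distTriang T := t.triangleLTGE_distinguished 0 N
  have hW : t.IsLE W (-1) := t.isLE_truncLT_obj N 0 (-1) (by lia)
  have hW' : t.IsLE (W⟦(1 : ℤ)⟧) (-2) := t.isLE_shift W (-1) 1 (-2) (by lia)
  -- Restricted to `N`, a morphism from `P` to an object of degree `-1` vanishes, so it comes from
  -- `W⟦1⟧`, which lies in `T^{≤ -2}`. Thus `P` is projective in the heart.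
  have hP : ∀ (b : ℤ) (Z : T) (f : P ⟶ Z), b < 0 → t.IsLE Z b → t.IsGE Z b → f = 0 := by
    refine hproj P inferInstance inferInstance (fun V f hV hV' => ?_)
    obtain ⟨y, rfl⟩ := DistTriang.desc₃ hT f (hom V _ hV)
    rw [t.zero_of_isLE_of_isGE y (-2) (-1) (by lia) hW' hV', comp_zero]
  have hk (k : ℕ) : t.IsLE W (-1 - k) := by
    induction k with
    | zero => simpa using hW
    | succ k ih =>
      have hZ : t.IsLE ((t.truncGE (-1 - (k : ℤ))).obj W) (-1 - k) := inferInstance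
      have h0 : (t.truncGEπ (-1 - (k : ℤ))).app W = 0 := by
        have hZ' := t.isLE_shift ((t.truncGE (-1 - (k : ℤ))).obj W) (-1 - k) 1 (-2 - k) (by lia)
        have hZ'' := t.isGE_shift ((t.truncGE (-1 - (k : ℤ))).obj W) (-1 - k) 1 (-2 - k) (by lia)
        -- The obstruction to extending the projection of `W` onto its top cohomology to `N` is a
        -- morphism from `P` to an object of degree `-2 - k`, zero by `hP`; and `N` has no morphisms
        -- to negative degrees.
        obtain ⟨y, hy⟩ : ∃ y : N ⟶ _, (t.truncGEπ (-1 - (k : ℤ))).app W =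
            (t.truncLTι 0).app N ≫ y := by
          obtain ⟨y, hy⟩ := Triangle.yoneda_exact₂ _ (inv_rot_of_distTriang _ hT)
            ((t.truncGEπ (-1 - (k : ℤ))).app W) (by
              refine hom_eq_zero_of_shift (1 : ℤ) (hom_eq_zero_of_iso
                (show P⟦(-1 : ℤ)⟧⟦(1 : ℤ)⟧ ≅ P from shiftNegShift P (1 : ℤ)) (Iso.refl _)
                (fun f => hP (-2 - k) _ f (by lia) hZ' hZ'')) _)
          exact ⟨y, hy⟩
        rw [hy, hom _ y (t.isLE_of_le _ (-1 - k) (-1) (by lia)), comp_zero]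
      have h1 : IsZero ((t.truncGE (-1 - (k : ℤ))).obj W) := by
        rw [IsZero.iff_id_eq_zero]
        exact t.from_truncGE_obj_ext ((congrArg (fun f => f ≫ _) h0).trans (by simp))
      rw [t.isLE_iff_orthogonal (-1 - ((k + 1 : ℕ) : ℤ)) (-1 - k) (by push_cast; ring)]
      intro Y f hY
      rw [← t.π_descTruncGE f (-1 - k), h1.eq_of_src (t.descTruncGE f (-1 - k)) 0, comp_zero]
  have hW0 : IsZero W := hnondeg W (fun n => t.isLE_of_le _ (-1 - (-1 - n).toNat) n (by lia))
  have := (DistTriang.isIso₂_iff hT).2 hW0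
  exact t.isGE_of_iso (show P ≅ N from (asIso ((t.truncGEπ 0).app N)).symm) 0

/-- The dual argument: `W` is the part of `N` in degrees `≥ 1`, and its lowest cohomology is removed
repeatedly by lifting its inclusion to `N`. -/
lemma isLE_zero_of_hom_eq_zero {N : T} (hN : t.IsGE N 0)
    (hom : ∀ (Z : T) (f : Z ⟶ N), t.IsGE Z 1 → f = 0)
    (hinj : ∀ I : T, t.IsLE I 0 → t.IsGE I 0 →
      (∀ (V : T) (f : V ⟶ I), t.IsLE V 1 → t.IsGE V 1 → f = 0) →
      ∀ (b : ℤ) (Z : T) (f : Z ⟶ I), 0 < b → t.IsLE Z b → t.IsGE Z b → f = 0)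
    (hnondeg : ∀ W : T, (∀ n : ℤ, t.IsGE W n) → IsZero W) : t.IsLE N 0 := by
  let I := (t.truncLT 1).obj N
  let W := (t.truncGE 1).obj N
  have hT : Triangle.mk ((t.truncLTι 1).app N) ((t.truncGEπ 1).app N)
      ((t.truncGEδLT 1).app N) ∈ distTriang T := t.triangleLTGE_distinguished 1 N
  have hI₁ : t.IsLE I 0 := t.isLE_truncLT_obj N 1 0 (by lia)
  have hW : t.IsGE W 1 := inferInstance
  have hW' : t.IsGE (W⟦(-1 : ℤ)⟧) 2 := t.isGE_shift W 1 (-1) 2 (by lia)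
  have hI : ∀ (b : ℤ) (Z : T) (f : Z ⟶ I), 0 < b → t.IsLE Z b → t.IsGE Z b → f = 0 := by
    refine hinj I hI₁ inferInstance (fun V f hV hV' => ?_)
    obtain ⟨y, hy⟩ := Triangle.coyoneda_exact₂ _ (inv_rot_of_distTriang _ hT) f (hom V _ hV')
    rw [hy]
    exact (congrArg (fun f => f ≫ _) (t.zero_of_isLE_of_isGE y 1 2 (by lia) hV hW')).trans zero_comp
  have hk (k : ℕ) : t.IsGE W (1 + k) := by
    induction k with
    | zero => simpa using hW
    | succ k ih =>
      have hZ : t.IsLE ((t.truncLE (1 + (k : ℤ))).obj W) (1 + k) := inferInstance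
      have hZ₂ : t.IsGE ((t.truncLE (1 + (k : ℤ))).obj W) (1 + k) := inferInstance
      have h0 : (t.truncLEι (1 + (k : ℤ))).app W = 0 := by
        have hZ' := t.isLE_shift ((t.truncLE (1 + (k : ℤ))).obj W) (1 + k) (-1) (2 + k) (by lia)
        have hZ'' := t.isGE_shift ((t.truncLE (1 + (k : ℤ))).obj W) (1 + k) (-1) (2 + k) (by lia)
        obtain ⟨y, hy⟩ := DistTriang.lift₃ hT ((t.truncLEι (1 + (k : ℤ))).app W) (by
          refine hom_eq_zero_of_shift (-1 : ℤ) (hom_eq_zero_of_iso (Iso.refl _)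
            (show I⟦(1 : ℤ)⟧⟦(-1 : ℤ)⟧ ≅ I from shiftShiftNeg I (1 : ℤ))
            (fun f => hI (2 + k) _ f (by lia) hZ' hZ'')) _)
        rw [hy, hom _ y (t.isGE_of_ge _ 1 (1 + k) (by lia)), zero_comp]
      have h1 : IsZero ((t.truncLE (1 + (k : ℤ))).obj W) := by
        rw [IsZero.iff_id_eq_zero]
        exact t.to_truncLE_obj_ext ((congrArg (fun f => _ ≫ f) h0).trans (by simp))
      rw [t.isGE_iff_orthogonal (1 + k) (1 + ((k + 1 : ℕ) : ℤ)) (by push_cast; ring)]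
      intro Y f hY
      rw [← t.liftTruncLE_ι f (1 + k), h1.eq_of_tgt (t.liftTruncLE f (1 + k)) 0, zero_comp]
  have hW0 : IsZero W := hnondeg W (fun n => t.isGE_of_ge _ n (1 + (n - 1).toNat) (by lia))
  have := (DistTriang.isIso₁_iff hT).2 hW0
  exact t.isLE_of_iso (show I ≅ N from asIso ((t.truncLTι 1).app N)) 0

end Truncation

end

/-! ### Realisation functors with respect to a t-structure -/

section

variable {A : Type*} [Category A] [Abelian A]
  {T : Type*} [Category T] [Preadditive T] [HasZeroObject T] [HasShift T ℤ]
  [∀ n : ℤ, (shiftFunctor T n).Additive] [Pretriangulated T]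
  {t : TStructure T} {Φ : BoundedComplex A ⥤ T} [Φ.Additive]

/-- Roofs are obtained from fullness alone, so a full realisation functor is automatically faithful.
-/
lemma RealisesHeart.full_faithful_iff (hΦ : RealisesHeart t Φ) {R : BoundedDerived A ⥤ T}
    (e : boundedQ A ⋙ R ≅ Φ) :
    (R.Full ∧ R.Faithful) ↔ ∀ ⦃K L : BoundedComplex A⦄ (g : Φ.obj K ⟶ Φ.obj L), IsRoof Φ g :=
  have hW : ∀ ⦃K L : BoundedComplex A⦄ (f : K ⟶ L), boundedQuasiIso A f ↔ IsIso (Φ.map f) :=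
    fun _ _ f => hΦ.boundedQuasiIso_iff f
  ⟨fun h => isRoof_of_full hW e hΦ.exactWithAcyclics h.1,
    fun h => ⟨localization_full hW e h, localization_faithful hW e hΦ.exactWithAcyclics h⟩⟩

end

section

variable {T : Type u} [Category.{v} T] [Preadditive T] [HasZeroObject T] [HasShift T ℤ]
  [∀ n : ℤ, (shiftFunctor T n).Additive] [Pretriangulated T] [IsTriangulated T]
  {X : Type u'} [Category.{v'} X] [Preadditive X] [HasZeroObject X] [HasShift X ℤ]
  [∀ n : ℤ, (shiftFunctor X n).Additive] [Pretriangulated X]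

namespace FCategory

namespace Enhancement

variable {F : FCategory X} {E : F.Enhancement T} {t : TStructure T}

lemma Forgetful.additive_comp (w : E.Forgetful)
    {G : BoundedComplex (HeartCat t) ⥤ (E.heartProp t).FullSubcategory} [G.IsEquivalence]
    (ε : G ⋙ (E.heartProp t).ι ⋙ w.H0 t ≅ (isBoundedComplex (HeartCat t)).ι) :
    (G ⋙ (E.heartProp t).ι ⋙ w.ω).Additive := by
  have := w.additive_of_H0_iso t ε
  have : w.ω.Additive := inferInstance
  infer_instance

/-- `Φ` inverts quasi-isomorphisms, hence factors through the localisation. -/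
lemma exists_isRealisation [IsTriangulated X] (E : F.Enhancement T) (t : TStructure T) :
    ∃ R : BoundedDerived (HeartCat t) ⥤ T, E.IsRealisation t R := by
  obtain ⟨w⟩ := E.nonempty_forgetful
  obtain ⟨G, hG, ⟨ε⟩⟩ := w.exists_inverse_H0 t
  let _ := heartAbelian t
  have := w.additive_comp ε
  have hΦ := w.realisesHeart t ε
  have h : (boundedQuasiIso (HeartCat t)).IsInvertedBy (G ⋙ (E.heartProp t).ι ⋙ w.ω) :=
    fun _ _ f hf => (hΦ.boundedQuasiIso_iff f).1 hf
  exact ⟨Localization.Construction.lift _ h, w, G, hG, ⟨ε⟩,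
    ⟨eqToIso (Localization.Construction.fac _ h)⟩⟩

namespace IsRealisation

variable {R : BoundedDerived (HeartCat t) ⥤ T}

lemma full_faithful_of_enough_projectives (hR : E.IsRealisation t R)
    (hP : ∀ (n : ℤ) (Y : T), t.IsLE Y n → t.IsGE Y n → ∃ (P Z : T) (u : P ⟶ Y) (v : Y ⟶ Z)
      (h : Z ⟶ P⟦(1 : ℤ)⟧), Triangle.mk u v h ∈ distTriang T ∧ t.IsLE P n ∧ t.IsGE P n ∧
        t.IsGE Z (n - 1) ∧ t.IsLE Z (n - 1) ∧
        ∀ (L : T) (f : P ⟶ L), t.IsLE L (n - 1) → f = 0) : R.Full ∧ R.Faithful := by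
  obtain ⟨w, G, hG, ⟨ε⟩, ⟨e⟩⟩ := hR
  let _ := heartAbelian t
  have := w.additive_comp ε
  have hΦ := w.realisesHeart t ε
  exact (hΦ.full_faithful_iff e).2 (hΦ.isRoof_of_enough_projectives hP)

lemma full_faithful_of_enough_injectives (hR : E.IsRealisation t R)
    (hI : ∀ (n : ℤ) (Y : T), t.IsLE Y n → t.IsGE Y n → ∃ (Z I : T) (u : Z ⟶ Y) (v : Y ⟶ I)
      (h : I ⟶ Z⟦(1 : ℤ)⟧), Triangle.mk u v h ∈ distTriang T ∧ t.IsLE I n ∧ t.IsGE I n ∧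
        t.IsGE Z (n + 1) ∧ t.IsLE Z (n + 1) ∧
        ∀ (L : T) (f : L ⟶ I), t.IsGE L (n + 1) → f = 0) : R.Full ∧ R.Faithful := by
  obtain ⟨w, G, hG, ⟨ε⟩, ⟨e⟩⟩ := hR
  let _ := heartAbelian t
  have := w.additive_comp ε
  have hΦ := w.realisesHeart t ε
  exact (hΦ.full_faithful_iff e).2 (hΦ.isRoof_of_enough_injectives hI)

lemma hom_eq_zero_of_projective (hR : E.IsRealisation t R) (h : R.Full ∧ R.Faithful) {P : T}
    (hP : t.IsLE P 0) (hP' : t.IsGE P 0)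
    (hV : ∀ (V : T) (f : P ⟶ V), t.IsLE V (-1) → t.IsGE V (-1) → f = 0) (b : ℤ) (Z : T)
    (f : P ⟶ Z) (hb : b < 0) (hZ : t.IsLE Z b) (hZ' : t.IsGE Z b) : f = 0 := by
  obtain ⟨w, G, hG, ⟨ε⟩, ⟨e⟩⟩ := hR
  let _ := heartAbelian t
  have := w.additive_comp ε
  have hΦ := w.realisesHeart t ε
  exact hΦ.hom_eq_zero_of_projective ((hΦ.full_faithful_iff e).1 h) hb hP hP' hV hZ hZ' f

lemma hom_eq_zero_of_injective (hR : E.IsRealisation t R) (h : R.Full ∧ R.Faithful) {I : T}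
    (hI : t.IsLE I 0) (hI' : t.IsGE I 0)
    (hV : ∀ (V : T) (f : V ⟶ I), t.IsLE V 1 → t.IsGE V 1 → f = 0) (b : ℤ) (Z : T)
    (f : Z ⟶ I) (hb : 0 < b) (hZ : t.IsLE Z b) (hZ' : t.IsGE Z b) : f = 0 := by
  obtain ⟨w, G, hG, ⟨ε⟩, ⟨e⟩⟩ := hR
  let _ := heartAbelian t
  have := w.additive_comp ε
  have hΦ := w.realisesHeart t ε
  obtain ⟨n, rfl⟩ : ∃ n : ℕ, b = 0 + n + 1 := ⟨(b - 1).toNat, by lia⟩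
  exact hΦ.hom_eq_zero_of_injective ((hΦ.full_faithful_iff e).1 h) hI hI' hV n Z f hZ hZ'

end IsRealisation

end Enhancement

end FCategory

end

/-! ### Silting and cosilting t-structures -/

section

variable {T : Type u} [Category.{v} T] [Preadditive T] [HasZeroObject T] [HasShift T ℤ]
  [∀ n : ℤ, (shiftFunctor T n).Additive] [Pretriangulated T]

lemma rightPerp_shift_iff (M Z : T) (I : Set ℤ) (n : ℤ) :
    rightPerp M I (Z⟦n⟧) ↔ ∀ m, m - n ∈ I → ∀ f : M ⟶ Z⟦m⟧, f = 0 := by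
  have e (i m : ℤ) (h : n + i = m) : Z⟦m⟧ ≅ Z⟦n⟧⟦i⟧ := (shiftFunctorAdd' T n i m h).app Z
  exact ⟨fun h m hm => hom_eq_zero_of_iso (Iso.refl _) (e (m - n) m (by lia)) (h (m - n) hm),
    fun h i hi => hom_eq_zero_of_iso (Iso.refl _) (e i (n + i) rfl).symm (h (n + i) (by simpa))⟩

lemma leftPerp_shift_iff (M Z : T) (I : Set ℤ) (n : ℤ) :
    leftPerp M I (Z⟦n⟧) ↔ ∀ m, m + n ∈ I → ∀ f : Z ⟶ M⟦m⟧, f = 0 := by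
  have e (i j m : ℤ) (h : i + j = m) : M⟦m⟧ ≅ M⟦i⟧⟦j⟧ := (shiftFunctorAdd' T i j m h).app M
  refine ⟨fun h m hm => hom_eq_zero_of_shift n (hom_eq_zero_of_iso (Iso.refl _)
    (e m n (m + n) rfl).symm (h (m + n) hm)), fun h i hi => hom_eq_zero_of_shift (-n)
      (hom_eq_zero_of_iso (shiftShiftNeg Z n) (e i (-n) (i - n) (by lia)).symm
        (h (i - n) (by simpa)))⟩

namespace IsSilting

variable {M : T} (hM : IsSilting M)

lemma isLE_iff (Z : T) (n : ℤ) :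
    hM.tStructure.IsLE Z n ↔ ∀ m, n < m → ∀ f : M ⟶ Z⟦m⟧, f = 0 := by
  have e : hM.tStructure.le 0 = rightPerp M (Set.Ioi 0) := hM.1.choose_spec.1
  rw [← hM.tStructure.isLE_shift_iff Z n n 0 (by lia), ← hM.tStructure.le_iff_isLE, e, rightPerp_shift_iff]
  simp

lemma isGE_iff (Z : T) (n : ℤ) :
    hM.tStructure.IsGE Z n ↔ ∀ m, m < n → ∀ f : M ⟶ Z⟦m⟧, f = 0 := by
  have e : hM.tStructure.ge 0 = rightPerp M (Set.Iio 0) := hM.1.choose_spec.2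
  rw [← hM.tStructure.isGE_shift_iff Z n n 0 (by lia), ← hM.tStructure.ge_iff_isGE, e, rightPerp_shift_iff]
  simp

lemma hom_eq_zero {Z : T} (hZ : hM.tStructure.IsLE Z (-1)) (f : M ⟶ Z) : f = 0 :=
  hom_eq_zero_of_iso (Iso.refl _) ((shiftFunctorZero T ℤ).app Z).symm
    ((hM.isLE_iff Z (-1)).1 hZ 0 (by lia)) f

lemma isLE_self : hM.tStructure.IsLE M 0 := (hM.isLE_iff M 0).2 hM.2

lemma isZero_of_isLE (W : T) (h : ∀ n, hM.tStructure.IsLE W n) : IsZero W := by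
  have h' : hM.tStructure.IsGE W 0 := (hM.isGE_iff W 0).2
    (fun m _ => (hM.isLE_iff W (m - 1)).1 (h _) m (by lia))
  have := h (-1)
  exact hM.tStructure.isZero W (-1) 0 (by lia)

variable {I : Type v} {c : Cofan (fun _ : I => M)} (hc : IsColimit c)

include hc

lemma hom_coproduct_eq_zero {Z : T} (hZ : hM.tStructure.IsLE Z (-1)) (f : c.pt ⟶ Z) : f = 0 :=
  Cofan.IsColimit.hom_ext hc _ _ (fun _ => (hM.hom_eq_zero hZ _).trans comp_zero.symm)

lemma isLE_coproduct : hM.tStructure.IsLE c.pt 0 := by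
  rw [hM.tStructure.isLE_iff_orthogonal 0 1 rfl]
  intro Y f hY
  have := hM.isLE_self
  exact Cofan.IsColimit.hom_ext hc _ _ (fun _ =>
    (hM.tStructure.zero_of_isLE_of_isGE _ 0 1 (by lia) inferInstance hY).trans comp_zero.symm)

end IsSilting

namespace IsCosilting

variable {M : T} (hM : IsCosilting M)

lemma isLE_iff (Z : T) (n : ℤ) :
    hM.tStructure.IsLE Z n ↔ ∀ m, m + n < 0 → ∀ f : Z ⟶ M⟦m⟧, f = 0 := by
  have e : hM.tStructure.le 0 = leftPerp M (Set.Iio 0) := hM.1.choose_spec.1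
  rw [← hM.tStructure.isLE_shift_iff Z n n 0 (by lia), ← hM.tStructure.le_iff_isLE, e, leftPerp_shift_iff]
  simp

lemma isGE_iff (Z : T) (n : ℤ) :
    hM.tStructure.IsGE Z n ↔ ∀ m, 0 < m + n → ∀ f : Z ⟶ M⟦m⟧, f = 0 := by
  have e : hM.tStructure.ge 0 = leftPerp M (Set.Ioi 0) := hM.1.choose_spec.2
  rw [← hM.tStructure.isGE_shift_iff Z n n 0 (by lia), ← hM.tStructure.ge_iff_isGE, e, leftPerp_shift_iff]
  simp

lemma hom_eq_zero {Z : T} (hZ : hM.tStructure.IsGE Z 1) (f : Z ⟶ M) : f = 0 :=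
  hom_eq_zero_of_iso (Iso.refl _) ((shiftFunctorZero T ℤ).app M).symm
    ((hM.isGE_iff Z 1).1 hZ 0 (by lia)) f

lemma isGE_self : hM.tStructure.IsGE M 0 :=
  (hM.isGE_iff M 0).2 (fun m hm => hM.2 m (by simpa using hm))

lemma isZero_of_isGE (W : T) (h : ∀ n, hM.tStructure.IsGE W n) : IsZero W := by
  have h' : hM.tStructure.IsLE W 0 := (hM.isLE_iff W 0).2
    (fun m _ => (hM.isGE_iff W (1 - m)).1 (h _) m (by lia))
  have := h 1
  exact hM.tStructure.isZero W 0 1 (by lia)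

variable {I : Type v} {c : Fan (fun _ : I => M)} (hc : IsLimit c)

include hc

lemma hom_product_eq_zero {Z : T} (hZ : hM.tStructure.IsGE Z 1) (f : Z ⟶ c.pt) : f = 0 :=
  Fan.IsLimit.hom_ext hc _ _ (fun _ => (hM.hom_eq_zero hZ _).trans zero_comp.symm)

lemma isGE_product : hM.tStructure.IsGE c.pt 0 := by
  rw [hM.tStructure.isGE_iff_orthogonal (-1) 0 (by lia)]
  intro Y f hY
  have := hM.isGE_self
  exact Fan.IsLimit.hom_ext hc _ _ (fun _ =>
    (hM.tStructure.zero_of_isLE_of_isGE _ (-1) 0 (by lia) hY inferInstance).trans zero_comp.symm)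

end IsCosilting

lemma hom_retract_eq_zero {Y Y' A : T} (r : Retract Y Y') (n : ℤ)
    (h : ∀ f : A ⟶ Y'⟦n⟧, f = 0) (f : A ⟶ Y⟦n⟧) : f = 0 := by
  have e : (f ≫ r.i⟦n⟧') ≫ r.r⟦n⟧' = f := by
    rw [Category.assoc, ← Functor.map_comp, r.retract, CategoryTheory.Functor.map_id]
    exact Category.comp_id _
  rw [← e, h (f ≫ r.i⟦n⟧'), zero_comp]

lemma retract_hom_eq_zero {Y Y' A : T} (r : Retract Y Y') (h : ∀ f : Y' ⟶ A, f = 0)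
    (f : Y ⟶ A) : f = 0 := by
  have e : r.i ≫ r.r ≫ f = f := by rw [r.retract_assoc]
  rw [← e, h (r.r ≫ f), comp_zero]

/-- Coproducts of copies of `M` are always in the aisle, and direct summands inherit vanishing, so
only the coaisle condition on coproducts remains. -/
lemma IsSilting.isTilting_iff {M : T} (hM : IsSilting M) :
    IsTilting M ↔ ∀ (I : Type v) (c : Cofan (fun _ : I => M)), IsColimit c →
      hM.tStructure.IsGE c.pt 0 := by
  refine ⟨fun h I c hc => ?_, fun h => ⟨hM, ?_⟩⟩
  · rw [hM.isGE_iff]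
    exact fun m hm => h.2 c.pt ⟨I, c, ⟨hc⟩, ⟨Retract.refl _⟩⟩ m hm.ne
  · rintro Y ⟨I, c, ⟨hc⟩, ⟨r⟩⟩ m hm
    refine hom_retract_eq_zero r m ?_
    obtain hm | hm := lt_or_gt_of_ne hm
    · exact (hM.isGE_iff _ 0).1 (h I c hc) m hm
    · exact (hM.isLE_iff _ 0).1 (hM.isLE_coproduct hc) m hm

lemma IsCosilting.isCotilting_iff {M : T} (hM : IsCosilting M) :
    IsCotilting M ↔ ∀ (I : Type v) (c : Fan (fun _ : I => M)), IsLimit c →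
      hM.tStructure.IsLE c.pt 0 := by
  refine ⟨fun h I c hc => ?_, fun h => ⟨hM, ?_⟩⟩
  · rw [hM.isLE_iff]
    exact fun m hm => h.2 c.pt ⟨I, c, ⟨hc⟩, ⟨Retract.refl _⟩⟩ m (by simp at hm ⊢; lia)
  · rintro Y ⟨I, c, ⟨hc⟩, ⟨r⟩⟩ m hm
    refine retract_hom_eq_zero r ?_
    obtain hm | hm := lt_or_gt_of_ne hm
    · exact (hM.isLE_iff _ 0).1 (h I c hc) m (by simpa using hm)
    · exact (hM.isGE_iff _ 0).1 (hM.isGE_product hc) m (by simpa using hm)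

/-- If `M` is tilting, then the coproducts of copies of `M` are enough projectives. -/
lemma IsTilting.exists_projective [HasCoproducts.{v} T] {M : T} (hM : IsSilting M)
    (hM' : IsTilting M) (n : ℤ) (Y : T) (hY : hM.tStructure.IsLE Y n)
    (hY' : hM.tStructure.IsGE Y n) : ∃ (P Z : T) (u : P ⟶ Y) (v : Y ⟶ Z)
      (h : Z ⟶ P⟦(1 : ℤ)⟧), Triangle.mk u v h ∈ distTriang T ∧ hM.tStructure.IsLE P n ∧
        hM.tStructure.IsGE P n ∧ hM.tStructure.IsGE Z (n - 1) ∧ hM.tStructure.IsLE Z (n - 1) ∧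
        ∀ (L : T) (f : P ⟶ L), hM.tStructure.IsLE L (n - 1) → f = 0 := by
  let t := hM.tStructure
  -- One copy of `M` for each morphism to `Y⟦n⟧` makes every such morphism factor through the
  -- evaluation `u₀`.
  let c : Cofan (fun _ : M ⟶ Y⟦n⟧ => M) := colimit.cocone _
  have hc : IsColimit c := colimit.isColimit _
  have h₁ : t.IsLE c.pt 0 := hM.isLE_coproduct hc
  have h₂ : t.IsGE c.pt 0 := hM.isTilting_iff.1 hM' _ c hc
  let u₀ : c.pt ⟶ Y⟦n⟧ := Cofan.IsColimit.desc hc (fun f => f)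
  have hu₀ (f : M ⟶ Y⟦n⟧) : c.inj f ≫ u₀ = f := Cofan.IsColimit.fac hc _ f
  let eY : Y⟦n⟧⟦-n⟧ ≅ Y := shiftShiftNeg Y n
  let u : c.pt⟦-n⟧ ⟶ Y := u₀⟦-n⟧' ≫ eY.hom
  have hu (f : M⟦-n⟧ ⟶ Y) : ∃ y, f = y ≫ u := by
    obtain ⟨g, hg⟩ := (shiftFunctor T (-n)).map_surjective (f ≫ eY.inv)
    refine ⟨(c.inj g)⟦-n⟧', ?_⟩
    rw [← Category.assoc, ← Functor.map_comp, hu₀, hg, Category.assoc, eY.inv_hom_id,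
      Category.comp_id]
  have h₁' : t.IsLE (c.pt⟦-n⟧) n := t.isLE_shift c.pt 0 (-n) n (by lia)
  have h₂' : t.IsGE (c.pt⟦-n⟧) n := t.isGE_shift c.pt 0 (-n) n (by lia)
  obtain ⟨Z, v, h, hT⟩ := distinguished_cocone_triangle u
  have hZ : t.IsLE Z n := DistTriang.isLE₃ t hT n (t.isLE_of_le _ n (n + 1)) hY
  refine ⟨_, Z, u, v, h, hT, h₁', h₂', DistTriang.isGE₃ t hT (n - 1)
    (by rwa [sub_add_cancel]) (t.isGE_of_ge _ (n - 1) n), ?_, fun L f hL => ?_⟩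
  · rw [hM.isLE_iff]
    intro m hm
    obtain rfl | hm' := (show n ≤ m by lia).eq_or_lt
    · refine hom_eq_zero_of_shift (-n) (hom_eq_zero_of_iso (Iso.refl _) (shiftShiftNeg Z n)
        (fun f => ?_))
      -- In the critical degree `n`, a morphism to `Z` first lifts to `Y`, because `M` has no
      -- morphisms to higher shifts of the coproduct; by `hu` it then passes through `u` and dies in
      -- `Z`.
      have h₀ : f ≫ h = 0 := hom_shift_neg_eq_zero n (hom_eq_zero_of_iso (Iso.refl _)
        (show c.pt⟦-n⟧⟦(1 : ℤ)⟧⟦n⟧ ≅ c.pt⟦-n⟧⟦n + 1⟧ from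
          ((shiftFunctorAdd' T 1 n (n + 1) (by lia)).app _).symm)
        ((hM.isLE_iff _ n).1 h₁' (n + 1) (by lia))) _
      obtain ⟨g, rfl⟩ := DistTriang.lift₃ hT f h₀
      obtain ⟨y, rfl⟩ := hu g
      rw [Category.assoc, DistTriang.zero₁₂ hT, comp_zero]
    · exact (hM.isLE_iff Z n).1 hZ m hm'
  · refine hom_shift_neg_eq_zero n (fun g => hM.hom_coproduct_eq_zero hc ?_ g) f
    exact t.isLE_shift L (n - 1) n (-1) (by lia)

/-- If `M` is cotilting, then the products of copies of `M` are enough injectives. -/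
lemma IsCotilting.exists_injective [HasProducts.{v} T] {M : T} (hM : IsCosilting M)
    (hM' : IsCotilting M) (n : ℤ) (Y : T) (hY : hM.tStructure.IsLE Y n)
    (hY' : hM.tStructure.IsGE Y n) : ∃ (Z I : T) (u : Z ⟶ Y) (v : Y ⟶ I)
      (h : I ⟶ Z⟦(1 : ℤ)⟧), Triangle.mk u v h ∈ distTriang T ∧ hM.tStructure.IsLE I n ∧
        hM.tStructure.IsGE I n ∧ hM.tStructure.IsGE Z (n + 1) ∧ hM.tStructure.IsLE Z (n + 1) ∧
        ∀ (L : T) (f : L ⟶ I), hM.tStructure.IsGE L (n + 1) → f = 0 := by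
  let t := hM.tStructure
  let c : Fan (fun _ : Y⟦n⟧ ⟶ M => M) := limit.cone _
  have hc : IsLimit c := limit.isLimit _
  have h₁ : t.IsGE c.pt 0 := hM.isGE_product hc
  have h₂ : t.IsLE c.pt 0 := hM.isCotilting_iff.1 hM' _ c hc
  let v₀ : Y⟦n⟧ ⟶ c.pt := Fan.IsLimit.lift hc (fun f => f)
  have hv₀ (f : Y⟦n⟧ ⟶ M) : v₀ ≫ c.proj f = f := Fan.IsLimit.fac hc _ f
  let eY : Y⟦n⟧⟦-n⟧ ≅ Y := shiftShiftNeg Y n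
  let v : Y ⟶ c.pt⟦-n⟧ := eY.inv ≫ v₀⟦-n⟧'
  have hv (f : Y ⟶ M⟦-n⟧) : ∃ y, f = v ≫ y := by
    obtain ⟨g, hg⟩ := (shiftFunctor T (-n)).map_surjective (eY.hom ≫ f)
    refine ⟨(c.proj g)⟦-n⟧', ?_⟩
    rw [Category.assoc, ← Functor.map_comp, hv₀, hg, eY.inv_hom_id_assoc]
  have h₁' : t.IsGE (c.pt⟦-n⟧) n := t.isGE_shift c.pt 0 (-n) n (by lia)
  have h₂' : t.IsLE (c.pt⟦-n⟧) n := t.isLE_shift c.pt 0 (-n) n (by lia)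
  obtain ⟨Z, u, h, hT⟩ := distinguished_cocone_triangle₁ v
  have hZ : t.IsGE Z n := DistTriang.isGE₁ t hT n hY' (t.isGE_of_ge _ (n - 1) n)
  refine ⟨Z, _, u, v, h, hT, h₂', h₁', ?_, DistTriang.isLE₁ t hT (n + 1)
    (t.isLE_of_le _ n (n + 1)) (by rwa [add_sub_cancel_right]), fun L f hL => ?_⟩
  · rw [hM.isGE_iff]
    intro m hm
    obtain rfl | hm' := (show -n ≤ m by lia).eq_or_lt
    · intro f
      have h₃ := t.isGE_shift (c.pt⟦-n⟧) n (-1) (n + 1) (by lia)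
      -- Dually, the morphism extends to `Y`, since the desuspended product lies in `T^{≥ n + 1}`,
      -- and by `hv` the extension passes through `v`, which vanishes on `Z`.
      obtain ⟨g, rfl⟩ : ∃ g : Y ⟶ M⟦-n⟧, f = u ≫ g :=
        Triangle.yoneda_exact₂ _ (inv_rot_of_distTriang _ hT) f
          ((hM.isGE_iff _ (n + 1)).1 h₃ (-n) (by lia) _)
      obtain ⟨y, rfl⟩ := hv g
      rw [← Category.assoc, DistTriang.zero₁₂ hT, zero_comp]
    · exact (hM.isGE_iff Z n).1 hZ m (by lia)
  · refine hom_to_shift_neg_eq_zero n (fun g => hM.hom_product_eq_zero hc ?_ g) f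
    exact t.isGE_shift L (n + 1) n 1 (by lia)

end

theorem proposition5p1
    {T : Type u} [Category.{v} T] [Preadditive T] [HasZeroObject T] [HasShift T ℤ]
    [∀ n : ℤ, (shiftFunctor T n).Additive] [Pretriangulated T] [IsTriangulated T]
    {X : Type u'} [Category.{v'} X] [Preadditive X] [HasZeroObject X] [HasShift X ℤ]
    [∀ n : ℤ, (shiftFunctor X n).Additive] [Pretriangulated X] [IsTriangulated X]
    (F : FCategory X) (E : F.Enhancement T) :
    (HasCoproducts.{v} T → ∀ (M : T) (hM : IsSilting M),
      (∃ R : BoundedDerived (HeartCat hM.tStructure) ⥤ T, E.IsRealisation hM.tStructure R) ∧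
      ∀ R : BoundedDerived (HeartCat hM.tStructure) ⥤ T, E.IsRealisation hM.tStructure R →
        ((R.Full ∧ R.Faithful) ↔ IsTilting M)) ∧
    (HasProducts.{v} T → ∀ (M : T) (hM : IsCosilting M),
      (∃ R : BoundedDerived (HeartCat hM.tStructure) ⥤ T, E.IsRealisation hM.tStructure R) ∧
      ∀ R : BoundedDerived (HeartCat hM.tStructure) ⥤ T, E.IsRealisation hM.tStructure R →
        ((R.Full ∧ R.Faithful) ↔ IsCotilting M)) := by
  refine ⟨fun _ M hM => ⟨E.exists_isRealisation _, fun R hR => ⟨fun h => ?_, fun h =>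
    hR.full_faithful_of_enough_projectives (h.exists_projective hM)⟩⟩,
    fun _ M hM => ⟨E.exists_isRealisation _, fun R hR => ⟨fun h => ?_, fun h =>
    hR.full_faithful_of_enough_injectives (h.exists_injective hM)⟩⟩⟩
  -- Fullness enters only through the vanishing of higher extensions out of projectives of the
  -- heart.
  · exact hM.isTilting_iff.2 fun I c hc => isGE_zero_of_hom_eq_zero _ (hM.isLE_coproduct hc)
      (fun Z f hZ => hM.hom_coproduct_eq_zero hc hZ f)
      (fun P hP hP' hV => hR.hom_eq_zero_of_projective h hP hP' hV) hM.isZero_of_isLE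
  · exact hM.isCotilting_iff.2 fun I c hc => isLE_zero_of_hom_eq_zero _ (hM.isGE_product hc)
      (fun Z f hZ => hM.hom_product_eq_zero hc hZ f)
      (fun P hP hP' hV => hR.hom_eq_zero_of_injective h hP hP' hV) hM.isZero_of_isGE
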